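/- Let $\lambda\in\{1,-1\}$ and $0<T<\infty$. For $n\ge 1$ let $g_{0n}\in C^\infty([0,T),\mathbb{C})$ satisfy $g_{0n}^{(m)}(0)=0$ for all $m\ge 0$. Let $$q(x,t)=\varepsilon q_1(x,t)+\varepsilon^2 q_2(x,t)+\cdots$$ be a perturbative solution on the half-line of the nonlinear Schrödinger equation $$i q_t+q_{xx}-2\lambda|q|^2q=0,\qquad x>0,\ 0<t<T,$$ with $q(x,0)=0$ for $x>0$ and $q(0,t)=\varepsilon g_{01}(t)+\varepsilon^2 g_{02}(t)+\cdots$ for $0\le t<T$. That is, these relations hold as identities of formal power series in the real parameter $\varepsilon$ (with $|q|^2q=q\bar q q$). For every $n\ge1$ the functions $q_n$, $\partial_xq_n$, $\partial_x^2q_n$, $\partial_tq_n$ exist and are continuous on $[0,\infty)\times[0,T)$, and $q_n,\partial_xq_n,\partial_x^2q_n$ are $O((1+x)^{-2})$, uniformly for $t$ in compact subintervals of $[0,T)$. Let $g_{1n}(t)=\partial_xq_n(0,t)$ be the coefficients of the Neumann data $q_x(0,t)=\varepsilon g_{11}(t)+\varepsilon^2g_{12}(t)+\cdots$, and let $c=\frac{\sqrt\pi}{2}e^{-i\pi/4}$.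 Then for all $0\le t<T$, $$g_{1n}(t)=-\frac{e^{-i\pi/4}}{\sqrt\pi}\int_0^t\frac{\dot g_{0n}(t')}{\sqrt{t-t'}}\,dt',\qquad n=1,2,$$ and $$\begin{aligned} g_{13}(t)=\;&\frac{2\lambda c}{\pi i}\int_0^t\frac{|g_{01}(t')|^2g_{01}(t')}{\sqrt{t-t'}}\,dt' -\frac{2\lambda c}{\pi i}\int_0^t|g_{01}(t')|^2\int_0^{t'}\frac{\dot g_{01}(t'')}{\sqrt{t-t''}}\,dt''\,dt' -\frac{2c}{\pi}\int_0^t\frac{\dot g_{03}(t')}{\sqrt{t-t'}}\,dt'\\ &-\frac{\lambda c}{\pi i}\int_0^tg_{01}(t')\int_0^{t'}\bar g_{01}(t'')\int_0^{t''}\frac{\dot g_{01}(t''')}{(t-t'+t''-t''')^{3/2}}\,dt'''\,dt''\,dt'\\ &+\frac{\lambda c}{\pi}\int_0^tg_{01}(t')\int_0^{t'}\bar g_{11}(t'')\int_0^{t''}\frac{g_{11}(t''')}{(t-t'+t''-t''')^{3/2}}\,dt'''\,dt''\,dt'\\ &-\frac{\lambda c}{\pi}\int_0^tg_{11}(t')\int_0^{t'}\bar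 g_{01}(t'')\int_0^{t''}\frac{g_{11}(t''')}{(t-t'+t''-t''')^{3/2}}\,dt'''\,dt''\,dt'\\ &+\frac{\lambda c}{\pi}\int_0^tg_{11}(t')\int_0^{t'}\bar g_{11}(t'')\int_0^{t''}\frac{g_{01}(t''')}{(t-t'+t''-t''')^{3/2}}\,dt'''\,dt''\,dt'\\ &+i\lambda g_{01}(t)\int_0^t\bigl[\bar g_{01}(t')g_{11}(t')-\bar g_{11}(t')g_{01}(t')\bigr]\,dt'. \end{aligned}$$ -/

import Mathlib

open Set
open scoped ContDiff

noncomputable section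

namespace HalfLineNLS

/-- The partial derivative `∂u/∂x` on the closed half-line `0 ≤ x` (one-sided at `x = 0`). -/
def dx (u : ℝ → ℝ → ℂ) (x t : ℝ) : ℂ :=
  derivWithin (fun y => u y t) (Ici 0) x

/-- The partial derivative `∂u/∂t` on the time interval `0 ≤ t < T` (one-sided at `t = 0`). -/
def dt (T : ℝ) (u : ℝ → ℝ → ℂ) (x t : ℝ) : ℂ :=
  derivWithin (fun s => u x s) (Ico 0 T) t

/-- Classical regularity up to the boundary of `{0 ≤ x, 0 ≤ t < T}`: the derivatives
`u_x`, `u_xx`, `u_t` exist, and `u`, `u_x`, `u_xx`, `u_t` are jointly continuous. -/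
structure IsClassical (T : ℝ) (u : ℝ → ℝ → ℂ) : Prop where
  diff_x : ∀ x ∈ Ici (0 : ℝ), ∀ t ∈ Ico 0 T,
    DifferentiableWithinAt ℝ (fun y => u y t) (Ici 0) x
  diff_xx : ∀ x ∈ Ici (0 : ℝ), ∀ t ∈ Ico 0 T,
    DifferentiableWithinAt ℝ (fun y => dx u y t) (Ici 0) x
  diff_t : ∀ x ∈ Ici (0 : ℝ), ∀ t ∈ Ico 0 T,
    DifferentiableWithinAt ℝ (fun s => u x s) (Ico 0 T) t
  cont : ContinuousOn (fun p : ℝ × ℝ => u p.1 p.2) (Ici 0 ×ˢ Ico 0 T)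
  cont_x : ContinuousOn (fun p : ℝ × ℝ => dx u p.1 p.2) (Ici 0 ×ˢ Ico 0 T)
  cont_xx : ContinuousOn (fun p : ℝ × ℝ => dx (dx u) p.1 p.2) (Ici 0 ×ˢ Ico 0 T)
  cont_t : ContinuousOn (fun p : ℝ × ℝ => dt T u p.1 p.2) (Ici 0 ×ˢ Ico 0 T)

/-- Decay as `x → ∞`: `u`, `u_x`, `u_xx` are `O((1 + x)⁻²)`, uniformly for `t` in compact
subintervals of `[0, T)`. -/
def VanishesAtInfinity (T : ℝ) (u : ℝ → ℝ → ℂ) : Prop :=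
  ∀ τ ∈ Ico 0 T, ∃ C : ℝ, ∀ x ∈ Ici (0 : ℝ), ∀ t ∈ Icc 0 τ,
    (1 + x) ^ 2 * ‖u x t‖ ≤ C ∧ (1 + x) ^ 2 * ‖dx u x t‖ ≤ C ∧
      (1 + x) ^ 2 * ‖dx (dx u) x t‖ ≤ C

/-- The formal power series `∑ₙ aₙ εⁿ` in the (real) small parameter `ε`. -/
abbrev series (a : ℕ → ℂ) : PowerSeries ℂ := PowerSeries.mk a

/-- Complex conjugation of a formal power series in the real parameter `ε`. -/
abbrev conjSeries (A : PowerSeries ℂ) : PowerSeries ℂ := PowerSeries.map (starRingEnd ℂ) A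

/-- The formal series `q(x,t) = ε q₁(x,t) + ε² q₂(x,t) + ⋯` is a perturbative solution, for
`0 ≤ t < T`, of the equation `i q_t + q_xx - 2 lam |q|² q = 0` on the half-line, with initial
data `q(x,0) = 0` and Dirichlet data `q(0,t) = ε g₀₁(t) + ε² g₀₂(t) + ⋯`: all of this holds as
an identity of formal power series in `ε`, with `|q|² q = q q̄ q`. -/
structure IsPerturbativeSolution (lam T : ℝ) (g₀ : ℕ → ℝ → ℂ) (q : ℕ → ℝ → ℝ → ℂ) : Prop where
  order_zero : ∀ x ∈ Ici (0 : ℝ), ∀ t ∈ Ico 0 T, q 0 x t = 0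
  classical : ∀ n, 1 ≤ n → IsClassical T (q n)
  decay : ∀ n, 1 ≤ n → VanishesAtInfinity T (q n)
  nls : ∀ x ∈ Ioi (0 : ℝ), ∀ t ∈ Ioo 0 T,
    PowerSeries.C Complex.I * series (fun n => dt T (q n) x t)
      + series (fun n => dx (dx (q n)) x t)
      - PowerSeries.C (2 * (lam : ℂ)) *
          (series (fun n => q n x t) * conjSeries (series (fun n => q n x t)) *
            series (fun n => q n x t)) = 0
  initial : ∀ n, 1 ≤ n → ∀ x ∈ Ioi (0 : ℝ), q n x 0 = 0
  dirichlet : ∀ n, 1 ≤ n → ∀ t ∈ Ico 0 T, q n 0 t = g₀ n t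

/-- Smoothness of a boundary datum on `[0, T)` and compatibility with zero initial data: all
derivatives vanish at `t = 0`. -/
def IsFlatDatum (T : ℝ) (g : ℝ → ℂ) : Prop :=
  ContDiffOn ℝ ∞ g (Ico 0 T) ∧ ∀ m : ℕ, iteratedDerivWithin m g (Ico 0 T) 0 = 0

/-- The coefficient `g₁ₙ(t)` of `εⁿ` in the Neumann data `q_x(0,t)`. -/
def neumann (q : ℕ → ℝ → ℝ → ℂ) (n : ℕ) (t : ℝ) : ℂ := dx (q n) 0 t

/-- The constant `c = (√π / 2) e^{-iπ/4}`. -/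
def c : ℂ := ((√Real.pi / 2 : ℝ) : ℂ) * Complex.exp (-(Complex.I * Real.pi / 4))

/-- The nested integral
`∫₀ᵗ f(t') ∫₀^{t'} conj g(t'') ∫₀^{t''} h(t''') / (t - t' + t'' - t''')^{3/2} dt''' dt'' dt'`. -/
def nested (f g h : ℝ → ℂ) (t : ℝ) : ℂ :=
  ∫ t₁ in (0 : ℝ)..t, f t₁ *
    ∫ t₂ in (0 : ℝ)..t₁, (starRingEnd ℂ) (g t₂) *
      ∫ t₃ in (0 : ℝ)..t₂, h t₃ / (((t - t₁ + t₂ - t₃) ^ (3 / 2 : ℝ) : ℝ) : ℂ)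

end HalfLineNLS

end

open Set MeasureTheory Filter Topology

noncomputable section

namespace HalfLineNLS

open Complex (I)
open scoped ComplexConjugate

/-! Since `q 0 = 0`, the cubic term first enters at order three. Hence `q 1` and `q 2` solve the
free Schrödinger equation, and `z = q 3` solves it with forcing `2λ|u|²u`, where `u = q 1`. The
formula for the Neumann trace of `z` comes from a half-line Fourier argument at real frequency `k`.

The transform `iter₁ z = ∫ e^{iky} z` satisfies `f' = -ik² f + boundary terms + forcing`, and the
forcing `∫ e^{iky}|u|²u` is not a boundary quantity. The third iterated integral `iter₃ u`, with
alternating conjugates, satisfies an equation of the same type whose only bulk term is `2i ∫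
e^{iky}|u|²u`. In `iter₁ z + λ iter₃ u` the two bulk terms cancel, so `duhamel_iter₁_add_iter₃`
expresses this sum through traces at `x = 0` alone. The needed traces of `iter₁ u` and `iter₂ u` are
again Duhamel integrals of boundary values (`iter₁_trace`, `iter₂_trace`).

Multiply by `k` and add the identities at `k` and `-k`. The unknown trace `z_x(0,·)` enters the
Duhamel side through an odd function of `k` and disappears (`interiorTerm_add_neg`). After
integration by parts in `x`, the other side contains `∫ e^{iky} z_x(y,t) dy`, from which `z_x(0,t)`
is recovered by Fourier inversion at the endpoint.

The integrals over `k` do not converge absolutely, so both sides are paired with `e^{-δk²}` and `δ →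
0+`. On the interior side the half-line Fourier integral of `f` tends to `π f(0)`, the
triple-integral remainder vanishes, and `iter₂` at the boundary yields the last term of the formula
(`hasSmoothLimit_interiorTerm`). On the boundary side, `∫ e^{-(δ+iτ)k²} dk` and its `k²`-weighted
version tend to `2c/√τ` and `-ic/τ^{3/2}`, which are the kernels in the statement
(`hasSmoothLimit_boundaryTerm`). Equating the limits gives `neumann_trace`; its case `λ = 0` settles
orders one and two. -/

/-! ### Tail integrals under quadratic decay, and variation of constants. -/

theorem integrable_of_decay {f : ℝ → ℂ} {C : ℝ} (hf : Continuous f)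
    (hb : ∀ y, ‖f y‖ ≤ C * (1 + y ^ 2)⁻¹) : Integrable f :=
  (integrable_inv_one_add_sq.const_mul C).mono' hf.aestronglyMeasurable (ae_of_all _ hb)

theorem bound_of_decay {E : Type*} [NormedAddCommGroup E] {a : E} {C y : ℝ}
    (hb : ‖a‖ ≤ C * (1 + y ^ 2)⁻¹) : ‖a‖ ≤ C := by
  have hC : 0 ≤ C * (1 + y ^ 2)⁻¹ := (norm_nonneg _).trans hb
  have hC' : 0 ≤ C := nonneg_of_mul_nonneg_left hC (by positivity)
  have : (1 + y ^ 2)⁻¹ ≤ 1 := inv_le_one_of_one_le₀ (by nlinarith [sq_nonneg y])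
  nlinarith

theorem tendsto_zero_of_decay {f : ℝ → ℂ} {C : ℝ} (hb : ∀ y, ‖f y‖ ≤ C * (1 + y ^ 2)⁻¹) :
    Tendsto f atTop (𝓝 0) := by
  refine squeeze_zero_norm hb ?_
  have h : Tendsto (fun y : ℝ => 1 + y ^ 2) atTop atTop :=
    tendsto_atTop_add_const_left _ _ (tendsto_pow_atTop two_ne_zero)
  simpa using h.inv_tendsto_atTop.const_mul C

theorem integral_Ioi_eq_sub {f : ℝ → ℂ} (hf : Integrable f) (x : ℝ) :
    ∫ y in Ioi x, f y = (∫ y in Ioi 0, f y) - ∫ y in (0 : ℝ)..x, f y := by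
  have h1 := intervalIntegral.integral_interval_add_Ioi (μ := volume) (f := f) (a := 0) (b := x)
    hf.integrableOn hf.integrableOn
  rw [← h1]; ring

/-- Joint continuity of the tail integral in its lower limit and a parameter. -/
theorem continuous_tail {P : Type*} [TopologicalSpace P] [FirstCountableTopology P]
    {f : P → ℝ → ℂ} {C : ℝ} (hf : Continuous (Function.uncurry f))
    (hb : ∀ p y, ‖f p y‖ ≤ C * (1 + y ^ 2)⁻¹) :
    Continuous (fun z : P × ℝ => ∫ y in Ioi z.2, f z.1 y) := by
  have hc : ∀ p, Continuous (f p) := fun p => hf.uncurry_left p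
  have he : ∀ z : P × ℝ, ∫ y in Ioi z.2, f z.1 y
      = (∫ y in Ioi 0, f z.1 y) - ∫ y in (0 : ℝ)..z.2, f z.1 y := fun z =>
    integral_Ioi_eq_sub (integrable_of_decay (hc z.1) (hb z.1)) z.2
  simp_rw [he]
  refine Continuous.sub ?_ ?_
  · refine continuous_of_dominated (bound := fun y => C * (1 + y ^ 2)⁻¹)
      (fun z => (hc z.1).aestronglyMeasurable) (fun z => ae_of_all _ (hb z.1))
      (integrable_inv_one_add_sq.const_mul C).integrableOn (ae_of_all _ fun y => ?_)
    exact hf.comp (by fun_prop : Continuous fun z : P × ℝ => (z.1, y))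
  · refine intervalIntegral.continuous_parametric_intervalIntegral_of_continuous
      (f := fun (z : P × ℝ) y => f z.1 y) ?_ continuous_snd
    exact hf.comp (by fun_prop : Continuous fun z : (P × ℝ) × ℝ => (z.1.1, z.2))

theorem norm_tail_le {f : ℝ → ℂ} {C : ℝ} (hb : ∀ y, ‖f y‖ ≤ C * (1 + y ^ 2)⁻¹) (x : ℝ) :
    ‖∫ y in Ioi x, f y‖ ≤ C * Real.pi := by
  have hC : 0 ≤ C := (norm_nonneg _).trans (bound_of_decay (hb 0))
  calc ‖∫ y in Ioi x, f y‖ ≤ ∫ y in Ioi x, C * (1 + y ^ 2)⁻¹ :=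
        norm_integral_le_of_norm_le (integrable_inv_one_add_sq.const_mul C).integrableOn
          (ae_of_all _ hb)
    _ ≤ ∫ y : ℝ, C * (1 + y ^ 2)⁻¹ :=
        setIntegral_le_integral (integrable_inv_one_add_sq.const_mul C)
          (ae_of_all _ fun y => by positivity)
    _ = C * Real.pi := by rw [integral_const_mul, integral_univ_inv_one_add_sq]

theorem hasDerivAt_tail {f : ℝ → ℂ} {C : ℝ} (hf : Continuous f)
    (hb : ∀ y, ‖f y‖ ≤ C * (1 + y ^ 2)⁻¹) (x : ℝ) :
    HasDerivAt (fun x => ∫ y in Ioi x, f y) (-f x) x := by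
  rw [funext (integral_Ioi_eq_sub (integrable_of_decay hf hb))]
  have h := intervalIntegral.integral_hasDerivAt_right (hf.intervalIntegrable 0 x)
    (hf.stronglyMeasurableAtFilter _ _) hf.continuousAt
  simpa using h.const_sub (∫ y in Ioi 0, f y)

/-- Fundamental theorem of calculus on `(x, ∞)` for a primitive tending to zero. -/
theorem integral_Ioi_of_deriv {f f' : ℝ → ℂ} {C C' : ℝ} {x : ℝ} (hf : Continuous f)
    (hf' : Continuous f') (hb : ∀ y, ‖f y‖ ≤ C * (1 + y ^ 2)⁻¹)
    (hb' : ∀ y, ‖f' y‖ ≤ C' * (1 + y ^ 2)⁻¹) (hd : ∀ y > x, HasDerivAt f (f' y) y) :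
    ∫ y in Ioi x, f' y = -f x := by
  rw [integral_Ioi_of_hasDerivAt_of_tendsto hf.continuousWithinAt hd
    (integrable_of_decay hf' hb').integrableOn (tendsto_zero_of_decay hb), zero_sub]

/-- Differentiation under a tail integral. -/
theorem hasDerivAt_integral_Ioi {f f' : ℝ → ℝ → ℂ} {a t s₀ C C' : ℝ} (hs₀ : s₀ ∈ Ioo 0 t)
    (hf : ∀ s, Continuous (f s)) (hf' : ∀ s, Continuous (f' s))
    (hb : ∀ s y, ‖f s y‖ ≤ C * (1 + y ^ 2)⁻¹) (hb' : ∀ s y, ‖f' s y‖ ≤ C' * (1 + y ^ 2)⁻¹)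
    (hd : ∀ s ∈ Ioo 0 t, ∀ y > a, HasDerivAt (fun r => f r y) (f' s y) s) :
    HasDerivAt (fun s => ∫ y in Ioi a, f s y) (∫ y in Ioi a, f' s₀ y) s₀ := by
  refine (hasDerivAt_integral_of_dominated_loc_of_deriv_le (μ := volume.restrict (Ioi a))
    (bound := fun y => C' * (1 + y ^ 2)⁻¹) (Ioo_mem_nhds hs₀.1 hs₀.2)
    (Eventually.of_forall fun s => (hf s).aestronglyMeasurable)
    (integrable_of_decay (hf s₀) (hb s₀)).integrableOn (hf' s₀).aestronglyMeasurable
    (ae_of_all _ fun y s _ => hb' s y) (integrable_inv_one_add_sq.const_mul C').integrableOn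
    ?_).2
  refine (ae_restrict_iff' measurableSet_Ioi).2 (ae_of_all _ fun y hy s hs => hd s hs y hy)

/-- Variation of constants for `f' = -i k² f + r`, `f(0) = 0`. -/
theorem duhamel {f r : ℝ → ℂ} {t : ℝ} (k : ℝ) (hf : Continuous f) (hr : Continuous r)
    (h0 : f 0 = 0)
    (hd : ∀ s ∈ Ioo 0 t, HasDerivAt f (-(Complex.I * k ^ 2) * f s + r s) s)
    {s : ℝ} (hs : s ∈ Icc 0 t) :
    f s = ∫ a in (0 : ℝ)..s, Complex.exp (-(Complex.I * k ^ 2) * ((s - a : ℝ) : ℂ)) * r a := by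
  have hE : ∀ a : ℝ, HasDerivAt (fun a : ℝ => Complex.exp (-(Complex.I * k ^ 2) * ((s - a : ℝ) : ℂ)))
      (Complex.exp (-(Complex.I * k ^ 2) * ((s - a : ℝ) : ℂ)) * (Complex.I * k ^ 2)) a := fun a => by
    have h1 : HasDerivAt (fun a : ℝ => ((s - a : ℝ) : ℂ)) (-1) a := by
      simpa using ((hasDerivAt_id a).const_sub s).ofReal_comp
    simpa using (h1.const_mul (-(Complex.I * k ^ 2))).cexp
  have hEc : Continuous fun a : ℝ => Complex.exp (-(Complex.I * k ^ 2) * ((s - a : ℝ) : ℂ)) := by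
    fun_prop
  have := intervalIntegral.integral_eq_sub_of_hasDerivAt_of_le hs.1
    (f := fun a => Complex.exp (-(Complex.I * k ^ 2) * ((s - a : ℝ) : ℂ)) * f a)
    (f' := fun a => Complex.exp (-(Complex.I * k ^ 2) * ((s - a : ℝ) : ℂ)) * r a)
    (hEc.mul hf).continuousOn (fun a ha => by
      refine ((hE a).mul (hd a ⟨ha.1, ha.2.trans_le hs.2⟩)).congr_deriv ?_
      ring) ((hEc.mul hr).intervalIntegrable _ _)
  rw [this, h0]; simp

/-! ### Decaying waves, plane waves and iterated half-line integrals. -/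

/-- A solution of `i u_t + u_xx = F` on `x > 0`, `0 < s < t`, vanishing at `s = 0`, given with its
space derivatives `u₁`, `u₂` as functions extended continuously and with decay to the plane. -/
structure DecayingWave (t : ℝ) (u u₁ u₂ F : ℝ → ℝ → ℂ) : Prop where
  cont : Continuous (Function.uncurry u)
  cont₁ : Continuous (Function.uncurry u₁)
  cont₂ : Continuous (Function.uncurry u₂)
  contF : Continuous (Function.uncurry F)
  -- Only `x > 0` is required: the functions used later are even extensions in `x`, so the extension
  -- of `u_x` is not the derivative of the extension of `u` for `x < 0`.
  hasDeriv_x : ∀ x > 0, ∀ s, HasDerivAt (fun y => u y s) (u₁ x s) x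
  hasDeriv_xx : ∀ x > 0, ∀ s, HasDerivAt (fun y => u₁ y s) (u₂ x s) x
  hasDeriv_t : ∀ x > 0, ∀ s ∈ Ioo 0 t, HasDerivAt (fun r => u x r) (I * (u₂ x s - F x s)) s
  initial : ∀ x, u x 0 = 0
  decay : ∃ C, (∀ x s, ‖u x s‖ ≤ C * (1 + x ^ 2)⁻¹) ∧ (∀ x s, ‖u₁ x s‖ ≤ C * (1 + x ^ 2)⁻¹) ∧
    (∀ x s, ‖u₂ x s‖ ≤ C * (1 + x ^ 2)⁻¹) ∧ ∀ x s, ‖F x s‖ ≤ C * (1 + x ^ 2)⁻¹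

/-- The plane wave `e^{ikx}`. -/
def phase (k x : ℝ) : ℂ := Complex.exp (I * k * x)

theorem norm_phase (k x : ℝ) : ‖phase k x‖ = 1 := by
  have : I * k * x = ((k * x : ℝ) : ℂ) * I := by push_cast; ring
  rw [phase, this, Complex.norm_exp_ofReal_mul_I]

theorem phase_zero (k : ℝ) : phase k 0 = 1 := by simp [phase]

theorem phase_add (k x y : ℝ) : phase k (x + y) = phase k x * phase k y := by
  rw [phase, phase, phase, ← Complex.exp_add]; push_cast; ring_nf

theorem conj_phase (k x : ℝ) : conj (phase k x) = phase k (-x) := by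
  rw [phase, phase, ← Complex.exp_conj]; simp

theorem conj_phase_mul (k x : ℝ) : conj (phase k x) * phase k x = 1 := by
  rw [conj_phase, ← phase_add, neg_add_cancel, phase_zero]

theorem continuous_phase : Continuous (Function.uncurry phase) := by
  unfold phase Function.uncurry; fun_prop

@[fun_prop]
theorem Continuous.phase {X : Type*} [TopologicalSpace X] {f g : X → ℝ} (hf : Continuous f)
    (hg : Continuous g) : Continuous fun z => HalfLineNLS.phase (f z) (g z) :=
  continuous_phase.comp (hf.prodMk hg)

theorem hasDerivAt_phase (k x : ℝ) : HasDerivAt (phase k) (phase k x * (I * k)) x := by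
  have h := ((Complex.ofRealCLM.hasDerivAt (x := x)).const_mul (I * k)).cexp
  have h' : HasDerivAt (fun y : ℝ => Complex.exp (I * k * y))
      (Complex.exp (I * k * x) * (I * k)) x := by simpa using h
  exact h'

theorem norm_phase_mul (k x : ℝ) (a : ℂ) : ‖phase k x * a‖ = ‖a‖ := by
  rw [norm_mul, norm_phase, one_mul]

theorem continuous_comp₂ {X : Type*} [TopologicalSpace X] {u : ℝ → ℝ → ℂ}
    (hu : Continuous (Function.uncurry u)) {f g : X → ℝ} (hf : Continuous f) (hg : Continuous g) :
    Continuous fun z => u (f z) (g z) :=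
  hu.comp (hf.prodMk hg)

theorem continuous_comp₃ {X : Type*} [TopologicalSpace X] {G : ℝ → ℝ → ℝ → ℂ}
    (hG : Continuous fun z : (ℝ × ℝ) × ℝ => G z.1.1 z.1.2 z.2) {f g h : X → ℝ}
    (hf : Continuous f) (hg : Continuous g) (hh : Continuous h) :
    Continuous fun z => G (f z) (g z) (h z) :=
  hG.comp ((hf.prodMk hg).prodMk hh)

/-- First iterated integral `∫_x^∞ e^{iky} u`. -/
def iter₁ (u : ℝ → ℝ → ℂ) (k s x : ℝ) : ℂ := ∫ y in Ioi x, phase k y * u y s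

/-- Second iterated integral `∫_x^∞ conj (e^{iky} u) ∫_y^∞ e^{ikz} u`. -/
def iter₂ (u : ℝ → ℝ → ℂ) (k s x : ℝ) : ℂ :=
  ∫ y in Ioi x, conj (phase k y * u y s) * iter₁ u k s y

/-- Third iterated integral. -/
def iter₃ (u : ℝ → ℝ → ℂ) (k s x : ℝ) : ℂ :=
  ∫ y in Ioi x, (phase k y * u y s) * iter₂ u k s y

theorem decay_mul {a b : ℂ} {C M y : ℝ} (ha : ‖a‖ ≤ C * (1 + y ^ 2)⁻¹) (hb : ‖b‖ ≤ M) :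
    ‖a * b‖ ≤ C * M * (1 + y ^ 2)⁻¹ := by
  rw [norm_mul]
  calc ‖a‖ * ‖b‖ ≤ C * (1 + y ^ 2)⁻¹ * M :=
        mul_le_mul ha hb (norm_nonneg _) ((norm_nonneg _).trans ha)
    _ = _ := by ring

theorem decay_add {a b : ℂ} {C D y : ℝ} (ha : ‖a‖ ≤ C * (1 + y ^ 2)⁻¹)
    (hb : ‖b‖ ≤ D * (1 + y ^ 2)⁻¹) : ‖a + b‖ ≤ (C + D) * (1 + y ^ 2)⁻¹ := by
  rw [add_mul]; exact norm_add_le_of_le ha hb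

theorem decay_sub {a b : ℂ} {C D y : ℝ} (ha : ‖a‖ ≤ C * (1 + y ^ 2)⁻¹)
    (hb : ‖b‖ ≤ D * (1 + y ^ 2)⁻¹) : ‖a - b‖ ≤ (C + D) * (1 + y ^ 2)⁻¹ := by
  rw [add_mul]; exact norm_sub_le_of_le ha hb

theorem decay_const_mul {a b : ℂ} {C y : ℝ} (ha : ‖a‖ ≤ C * (1 + y ^ 2)⁻¹) :
    ‖b * a‖ ≤ ‖b‖ * C * (1 + y ^ 2)⁻¹ := by
  rw [norm_mul, mul_assoc]; exact mul_le_mul_of_nonneg_left ha (norm_nonneg _)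

theorem norm_conj_phase_mul (k x : ℝ) (a : ℂ) : ‖conj (phase k x * a)‖ = ‖a‖ := by
  rw [RCLike.norm_conj, norm_phase_mul]

section Iterated

variable {u : ℝ → ℝ → ℂ} {C : ℝ}

theorem continuous_iter₁ (hu : Continuous (Function.uncurry u))
    (hb : ∀ x s, ‖u x s‖ ≤ C * (1 + x ^ 2)⁻¹) :
    Continuous fun z : (ℝ × ℝ) × ℝ => iter₁ u z.1.1 z.1.2 z.2 := by
  refine continuous_tail (P := ℝ × ℝ) (f := fun p y => phase p.1 y * u y p.2) (C := C) ?_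
    fun p y => by rw [norm_phase_mul]; exact hb y p.2
  have := continuous_comp₂ hu (f := fun z : (ℝ × ℝ) × ℝ => z.2) (g := fun z => z.1.2)
    (by fun_prop) (by fun_prop)
  unfold Function.uncurry
  fun_prop

/-- The phase is unimodular, so the bound is uniform in `k`. This uniformity, inherited by `iter₂`
and `iter₃`, is what allows pairing with a Gaussian in `k` and the use of Fubini. -/
theorem norm_iter₁_le (hb : ∀ x s, ‖u x s‖ ≤ C * (1 + x ^ 2)⁻¹) (k s x : ℝ) :
    ‖iter₁ u k s x‖ ≤ C * Real.pi :=
  norm_tail_le (fun y => by rw [norm_phase_mul]; exact hb y s) x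

theorem decay_iter₂ (hb : ∀ x s, ‖u x s‖ ≤ C * (1 + x ^ 2)⁻¹) (k s y : ℝ) :
    ‖conj (phase k y * u y s) * iter₁ u k s y‖ ≤ C * (C * Real.pi) * (1 + y ^ 2)⁻¹ :=
  decay_mul (by rw [norm_conj_phase_mul]; exact hb y s) (norm_iter₁_le hb k s y)

theorem continuous_iter₂_integrand (hu : Continuous (Function.uncurry u))
    (hb : ∀ x s, ‖u x s‖ ≤ C * (1 + x ^ 2)⁻¹) :
    Continuous fun z : (ℝ × ℝ) × ℝ =>
      conj (phase z.1.1 z.2 * u z.2 z.1.2) * iter₁ u z.1.1 z.1.2 z.2 := by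
  have h1 := continuous_comp₂ hu (f := fun z : (ℝ × ℝ) × ℝ => z.2) (g := fun z => z.1.2)
    (by fun_prop) (by fun_prop)
  have h2 := continuous_iter₁ hu hb
  exact (Complex.continuous_conj.comp
    ((Continuous.phase (by fun_prop) (by fun_prop)).mul h1)).mul h2

theorem continuous_iter₂ (hu : Continuous (Function.uncurry u))
    (hb : ∀ x s, ‖u x s‖ ≤ C * (1 + x ^ 2)⁻¹) :
    Continuous fun z : (ℝ × ℝ) × ℝ => iter₂ u z.1.1 z.1.2 z.2 :=
  continuous_tail (P := ℝ × ℝ) (f := fun p y => conj (phase p.1 y * u y p.2) * iter₁ u p.1 p.2 y)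
    (continuous_iter₂_integrand hu hb) fun p y => decay_iter₂ hb p.1 p.2 y

theorem norm_iter₂_le (hb : ∀ x s, ‖u x s‖ ≤ C * (1 + x ^ 2)⁻¹) (k s x : ℝ) :
    ‖iter₂ u k s x‖ ≤ C * (C * Real.pi) * Real.pi :=
  norm_tail_le (fun y => decay_iter₂ hb k s y) x

theorem decay_iter₃ (hb : ∀ x s, ‖u x s‖ ≤ C * (1 + x ^ 2)⁻¹) (k s y : ℝ) :
    ‖(phase k y * u y s) * iter₂ u k s y‖ ≤ C * (C * (C * Real.pi) * Real.pi) * (1 + y ^ 2)⁻¹ :=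
  decay_mul (by rw [norm_phase_mul]; exact hb y s) (norm_iter₂_le hb k s y)

theorem continuous_iter₃_integrand (hu : Continuous (Function.uncurry u))
    (hb : ∀ x s, ‖u x s‖ ≤ C * (1 + x ^ 2)⁻¹) :
    Continuous fun z : (ℝ × ℝ) × ℝ =>
      (phase z.1.1 z.2 * u z.2 z.1.2) * iter₂ u z.1.1 z.1.2 z.2 := by
  have h1 := continuous_comp₂ hu (f := fun z : (ℝ × ℝ) × ℝ => z.2) (g := fun z => z.1.2)
    (by fun_prop) (by fun_prop)
  have h2 := continuous_iter₂ hu hb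
  exact ((Continuous.phase (by fun_prop) (by fun_prop)).mul h1).mul h2

theorem continuous_iter₃ (hu : Continuous (Function.uncurry u))
    (hb : ∀ x s, ‖u x s‖ ≤ C * (1 + x ^ 2)⁻¹) :
    Continuous fun z : (ℝ × ℝ) × ℝ => iter₃ u z.1.1 z.1.2 z.2 :=
  continuous_tail (P := ℝ × ℝ) (f := fun p y => (phase p.1 y * u y p.2) * iter₂ u p.1 p.2 y)
    (continuous_iter₃_integrand hu hb) fun p y => decay_iter₃ hb p.1 p.2 y

theorem hasDerivAt_iter₁ (hu : Continuous (Function.uncurry u))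
    (hb : ∀ x s, ‖u x s‖ ≤ C * (1 + x ^ 2)⁻¹) (k s x : ℝ) :
    HasDerivAt (iter₁ u k s) (-(phase k x * u x s)) x := by
  have h1 := continuous_comp₂ hu (f := fun z : ℝ => z) (g := fun _ => s)
    (by fun_prop) (by fun_prop)
  have h2 : Continuous fun y => phase k y * u y s := by fun_prop
  exact hasDerivAt_tail h2 (fun y => by rw [norm_phase_mul]; exact hb y s) x

theorem hasDerivAt_iter₂ (hu : Continuous (Function.uncurry u))
    (hb : ∀ x s, ‖u x s‖ ≤ C * (1 + x ^ 2)⁻¹) (k s x : ℝ) :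
    HasDerivAt (iter₂ u k s) (-(conj (phase k x * u x s) * iter₁ u k s x)) x := by
  have h2 : Continuous fun y => conj (phase k y * u y s) * iter₁ u k s y :=
    continuous_comp₃ (G := fun k s y => conj (phase k y * u y s) * iter₁ u k s y)
      (continuous_iter₂_integrand hu hb) continuous_const continuous_const continuous_id
  exact hasDerivAt_tail h2 (fun y => decay_iter₂ hb k s y) x

end Iterated

theorem integral_lin₃ {μ : Measure ℝ} {f g h : ℝ → ℂ} (hf : Integrable f μ) (hg : Integrable g μ)
    (hh : Integrable h μ) (a b c : ℂ) :
    ∫ y, (a * f y + b * g y + c * h y) ∂μ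
      = a * ∫ y, f y ∂μ + b * ∫ y, g y ∂μ + c * ∫ y, h y ∂μ := by
  have h1 : Integrable (fun y => a * f y + b * g y) μ := (hf.const_mul a).add (hg.const_mul b)
  rw [integral_add h1 (hh.const_mul c), integral_add (hf.const_mul a) (hg.const_mul b)]
  simp only [integral_const_mul]

/-! ### Time evolution of the iterated integrals. -/

/-- The flux `e^{ikx} (u_x - i k u)`. -/
def flux (u u₁ : ℝ → ℝ → ℂ) (k s x : ℝ) : ℂ := phase k x * (u₁ x s - I * k * u x s)

namespace DecayingWave

variable {t : ℝ} {u u₁ u₂ F : ℝ → ℝ → ℂ}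

theorem continuous_flux (h : DecayingWave t u u₁ u₂ F) :
    Continuous fun z : (ℝ × ℝ) × ℝ => flux u u₁ z.1.1 z.1.2 z.2 := by
  have h1 := continuous_comp₂ h.cont (f := fun z : (ℝ × ℝ) × ℝ => z.2) (g := fun z => z.1.2)
    (by fun_prop) (by fun_prop)
  have h2 := continuous_comp₂ h.cont₁ (f := fun z : (ℝ × ℝ) × ℝ => z.2) (g := fun z => z.1.2)
    (by fun_prop) (by fun_prop)
  exact (Continuous.phase (by fun_prop) (by fun_prop)).mul
    (h2.sub ((continuous_const.mul (Complex.continuous_ofReal.comp (by fun_prop))).mul h1))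

/-- The first-order terms cancel, which makes the flux a primitive of `e^{ikx}(u_xx + k²u)`. All
exact integrations in `x` below rest on this. -/
theorem hasDerivAt_flux (h : DecayingWave t u u₁ u₂ F) (k s : ℝ) {x : ℝ} (hx : 0 < x) :
    HasDerivAt (flux u u₁ k s) (phase k x * (u₂ x s + k ^ 2 * u x s)) x := by
  have h1 := (hasDerivAt_phase k x).mul
    ((h.hasDeriv_xx x hx s).sub ((h.hasDeriv_x x hx s).const_mul (I * k)))
  refine h1.congr_deriv ?_
  simp only [Pi.sub_apply]
  linear_combination (-(phase k x * k ^ 2 * u x s)) * Complex.I_sq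

theorem decay_flux {C : ℝ} (hb : ∀ x s, ‖u x s‖ ≤ C * (1 + x ^ 2)⁻¹)
    (hb₁ : ∀ x s, ‖u₁ x s‖ ≤ C * (1 + x ^ 2)⁻¹) (k s x : ℝ) :
    ‖flux u u₁ k s x‖ ≤ (C + ‖I * (k : ℂ)‖ * C) * (1 + x ^ 2)⁻¹ := by
  rw [flux, norm_phase_mul]
  exact decay_sub (hb₁ x s) (decay_const_mul (hb x s))

/-- Replace `u_t` by `i(u_xx - F)` under the integral and split `u_xx = (u_xx + k²u) - k²u`. The
first part integrates to the flux at `x`; the second gives back `iter₁`. -/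
theorem hasDerivAt_iter₁_time (h : DecayingWave t u u₁ u₂ F) (k : ℝ) {s x : ℝ}
    (hs : s ∈ Ioo 0 t) (hx : 0 ≤ x) :
    HasDerivAt (fun s => iter₁ u k s x)
      (-I * flux u u₁ k s x - I * k ^ 2 * iter₁ u k s x
        - I * ∫ y in Ioi x, phase k y * F y s) s := by
  obtain ⟨C, hb, hb₁, hb₂, hbF⟩ := h.decay
  have cu := fun s => continuous_comp₂ h.cont (f := fun y : ℝ => y) (g := fun _ => s)
    (by fun_prop) (by fun_prop)
  have cu₂ := fun s => continuous_comp₂ h.cont₂ (f := fun y : ℝ => y) (g := fun _ => s)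
    (by fun_prop) (by fun_prop)
  have cF := fun s => continuous_comp₂ h.contF (f := fun y : ℝ => y) (g := fun _ => s)
    (by fun_prop) (by fun_prop)
  have cfl : Continuous (flux u u₁ k s) :=
    continuous_comp₃ (G := flux u u₁) h.continuous_flux continuous_const continuous_const
      continuous_id
  have key := hasDerivAt_integral_Ioi (a := x) (C := C) (C' := ‖I‖ * (C + C)) hs
    (f := fun s y => phase k y * u y s) (f' := fun s y => phase k y * (I * (u₂ y s - F y s)))
    (fun s => by have := cu s; fun_prop)
    (fun s => by have := cu₂ s; have := cF s; fun_prop)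
    (fun s y => by rw [norm_phase_mul]; exact hb y s)
    (fun s y => by rw [norm_phase_mul]; exact decay_const_mul (decay_sub (hb₂ y s) (hbF y s)))
    (fun s hs y hy => (h.hasDeriv_t y (hx.trans_lt hy) s hs).const_mul _)
  refine key.congr_deriv ?_
  have hD : ∀ y, ‖phase k y * (u₂ y s + k ^ 2 * u y s)‖
      ≤ (C + ‖(k : ℂ) ^ 2‖ * C) * (1 + y ^ 2)⁻¹ := fun y => by
    rw [norm_phase_mul]; exact decay_add (hb₂ y s) (decay_const_mul (hb y s))
  have cD : Continuous fun y => phase k y * (u₂ y s + k ^ 2 * u y s) := by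
    have := cu s; have := cu₂ s; fun_prop
  have hft := integral_Ioi_of_deriv (x := x) cfl cD (decay_flux hb hb₁ k s) hD
    (fun y hy => h.hasDerivAt_flux k s (hx.trans_lt hy))
  have i1 := (integrable_of_decay cD hD).integrableOn (s := Ioi x)
  have cP : Continuous fun y => phase k y * u y s := by have := cu s; fun_prop
  have cQ : Continuous fun y => phase k y * F y s := by have := cF s; fun_prop
  have i2 := (integrable_of_decay (C := C) cP
    (fun y => by rw [norm_phase_mul]; exact hb y s)).integrableOn (s := Ioi x)
  have i3 := (integrable_of_decay (C := C) cQ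
    (fun y => by rw [norm_phase_mul]; exact hbF y s)).integrableOn (s := Ioi x)
  have e : ∀ y, phase k y * (I * (u₂ y s - F y s))
      = I * (phase k y * (u₂ y s + k ^ 2 * u y s)) + (-(I * k ^ 2)) * (phase k y * u y s)
        + (-I) * (phase k y * F y s) := fun y => by ring
  simp_rw [e]
  rw [integral_lin₃ i1 i2 i3, hft, iter₁]
  ring

theorem hasDerivAt_iter₁_time_free (h : DecayingWave t u u₁ u₂ fun _ _ => 0) (k : ℝ) {s x : ℝ}
    (hs : s ∈ Ioo 0 t) (hx : 0 ≤ x) :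
    HasDerivAt (fun s => iter₁ u k s x)
      (-I * flux u u₁ k s x - I * k ^ 2 * iter₁ u k s x) s := by
  simpa using h.hasDerivAt_iter₁_time k hs hx

theorem hasDerivAt_conj {f : ℝ → ℂ} {f' : ℂ} {x : ℝ} (hf : HasDerivAt f f' x) :
    HasDerivAt (fun y => conj (f y)) (conj f') x :=
  Complex.conjCLE.hasFDerivAt.comp_hasDerivAt x hf

/-- The conjugate factor evolves with `+ik²` and `iter₁` with `-ik²`, so the rotation cancels and
the differentiated integrand is an exact `x`-derivative. Consequently only values at the endpoint
`x` remain. -/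
theorem hasDerivAt_iter₂_time (h : DecayingWave t u u₁ u₂ fun _ _ => 0) (k : ℝ) {s x : ℝ}
    (hs : s ∈ Ioo 0 t) (hx : 0 ≤ x) :
    HasDerivAt (fun s => iter₂ u k s x)
      (I * (conj (flux u u₁ k s x) * iter₁ u k s x + conj (u x s) * u x s)) s := by
  obtain ⟨C, hb, hb₁, hb₂, -⟩ := h.decay
  have cu := fun s => continuous_comp₂ h.cont (f := fun y : ℝ => y) (g := fun _ => s)
    (by fun_prop) (by fun_prop)
  have cu₂ := fun s => continuous_comp₂ h.cont₂ (f := fun y : ℝ => y) (g := fun _ => s)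
    (by fun_prop) (by fun_prop)
  have cfl : ∀ s, Continuous (flux u u₁ k s) := fun s =>
    continuous_comp₃ (G := flux u u₁) h.continuous_flux continuous_const continuous_const
      continuous_id
  have cA : ∀ s, Continuous (iter₁ u k s) := fun s =>
    continuous_comp₃ (G := iter₁ u) (continuous_iter₁ h.cont hb) continuous_const
      continuous_const continuous_id
  have conjc := Complex.continuous_conj
  have bA := fun s y => norm_iter₁_le hb k s y
  have bfl := fun s y => decay_flux hb hb₁ k s y
  have bflux := fun s y => bound_of_decay (bfl s y)
  have cE : ∀ s, Continuous fun y => conj (phase k y * u y s) := fun s =>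
    conjc.comp (by have := cu s; fun_prop)
  have cE₂ : ∀ s, Continuous fun y => conj (phase k y * (I * u₂ y s)) := fun s =>
    conjc.comp (by have := cu₂ s; fun_prop)
  have bE : ∀ s y, ‖conj (phase k y * u y s)‖ ≤ C * (1 + y ^ 2)⁻¹ := fun s y => by
    rw [norm_conj_phase_mul]; exact hb y s
  have bE₂ : ∀ s y, ‖conj (phase k y * (I * u₂ y s))‖ ≤ ‖I‖ * C * (1 + y ^ 2)⁻¹ := fun s y => by
    rw [norm_conj_phase_mul]; exact decay_const_mul (hb₂ y s)
  have bAt : ∀ s y, ‖-I * flux u u₁ k s y - I * k ^ 2 * iter₁ u k s y‖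
      ≤ ‖-I‖ * (C + ‖I * (k : ℂ)‖ * C) + ‖I * (k : ℂ) ^ 2‖ * (C * Real.pi) := fun s y => by
    refine norm_sub_le_of_le ?_ ?_
    · rw [norm_mul]; exact mul_le_mul_of_nonneg_left (bflux s y) (norm_nonneg _)
    · rw [norm_mul]; exact mul_le_mul_of_nonneg_left (bA s y) (norm_nonneg _)
  have cD : ∀ s, Continuous fun y => conj (phase k y * (I * u₂ y s)) * iter₁ u k s y
      + conj (phase k y * u y s) * (-I * flux u u₁ k s y - I * k ^ 2 * iter₁ u k s y) := fun s => by
    have := cE s; have := cE₂ s; have := cA s; have := cfl s; fun_prop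
  have bD := fun s y => decay_add (decay_mul (bE₂ s y) (bA s y)) (decay_mul (bE s y) (bAt s y))
  have key := hasDerivAt_integral_Ioi (a := x) hs
    (f := fun s y => conj (phase k y * u y s) * iter₁ u k s y)
    (f' := fun s y => conj (phase k y * (I * u₂ y s)) * iter₁ u k s y
      + conj (phase k y * u y s) * (-I * flux u u₁ k s y - I * k ^ 2 * iter₁ u k s y))
    (fun s => by have := cE s; have := cA s; fun_prop) cD
    (fun s y => decay_iter₂ hb k s y) bD
    (fun s hs y hy => by
      have hy' := hx.trans_lt hy
      have h1 := (h.hasDeriv_t y hy' s hs).const_mul (phase k y)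
      rw [sub_zero] at h1
      exact (hasDerivAt_conj h1).mul (h.hasDerivAt_iter₁_time_free k hs hy'.le))
  refine key.congr_deriv ?_
  have cu' := cu s
  -- The primitive pairs the conjugate flux with `iter₁`; the extra `|u|²` absorbs the product of
  -- the conjugate flux with the derivative of `iter₁`.
  rw [integral_Ioi_of_deriv (x := x)
    (f := fun y => -I * (conj (flux u u₁ k s y) * iter₁ u k s y + conj (u y s) * u y s))
    ?_ (cD s) (fun y => decay_const_mul (decay_add
      (decay_mul (by rw [RCLike.norm_conj]; exact bfl s y) (bA s y))
      (decay_mul (by rw [RCLike.norm_conj]; exact hb y s) (bound_of_decay (hb y s))))) (bD s) ?_]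
  · ring
  · have := cfl s; have := cA s
    have h1 := conjc.comp (cfl s)
    have h2 := conjc.comp cu'
    simp only [Function.comp_def] at h1 h2
    fun_prop
  · intro y hy
    have hy' := hx.trans_lt hy
    have h1 := hasDerivAt_conj (h.hasDerivAt_flux k s hy')
    have h2 := hasDerivAt_iter₁ h.cont hb k s y
    have h3 := h.hasDeriv_x y hy' s
    refine (((h1.mul h2).add ((hasDerivAt_conj h3).mul h3)).const_mul (-I)).congr_deriv ?_
    have e := conj_phase_mul k y
    simp only [flux, map_mul, map_sub, map_add, map_pow, Complex.conj_I, Complex.conj_ofReal]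
    linear_combination (I * u y s * (conj (u₁ y s) + I * k * conj (u y s))
      + I * conj (u y s) * (u₁ y s - I * k * u y s)) * e

/-- Here the integrand is exact only up to the rotation term and `2i e^{iky}|u|²u`. The latter has
the shape of the cubic forcing of the third-order coefficient, and is the reason for introducing
`iter₃`. -/
theorem hasDerivAt_iter₃_time (h : DecayingWave t u u₁ u₂ fun _ _ => 0) (k : ℝ) {s x : ℝ}
    (hs : s ∈ Ioo 0 t) (hx : 0 ≤ x) :
    HasDerivAt (fun s => iter₃ u k s x)
      (-I * k ^ 2 * iter₃ u k s x
        - I * (flux u u₁ k s x * iter₂ u k s x + conj (u x s) * u x s * iter₁ u k s x)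
        + 2 * I * ∫ y in Ioi x, phase k y * (conj (u y s) * u y s * u y s)) s := by
  obtain ⟨C, hb, hb₁, hb₂, -⟩ := h.decay
  have cu := fun s => continuous_comp₂ h.cont (f := fun y : ℝ => y) (g := fun _ => s)
    (by fun_prop) (by fun_prop)
  have cu₂ := fun s => continuous_comp₂ h.cont₂ (f := fun y : ℝ => y) (g := fun _ => s)
    (by fun_prop) (by fun_prop)
  have cfl : ∀ s, Continuous (flux u u₁ k s) := fun s =>
    continuous_comp₃ (G := flux u u₁) h.continuous_flux continuous_const continuous_const
      continuous_id
  have cA : ∀ s, Continuous (iter₁ u k s) := fun s =>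
    continuous_comp₃ (G := iter₁ u) (continuous_iter₁ h.cont hb) continuous_const
      continuous_const continuous_id
  have cB : ∀ s, Continuous (iter₂ u k s) := fun s =>
    continuous_comp₃ (G := iter₂ u) (continuous_iter₂ h.cont hb) continuous_const
      continuous_const continuous_id
  have conjc := Complex.continuous_conj
  have cub : ∀ s, Continuous fun y => conj (u y s) := fun s => conjc.comp (cu s)
  have cflb : ∀ s, Continuous fun y => conj (flux u u₁ k s y) := fun s => conjc.comp (cfl s)
  have bA := fun s y => norm_iter₁_le hb k s y
  have bB := fun s y => norm_iter₂_le hb k s y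
  have bfl := fun s y => decay_flux hb hb₁ k s y
  have bub : ∀ s y, ‖conj (u y s)‖ ≤ C * (1 + y ^ 2)⁻¹ := fun s y => by
    rw [RCLike.norm_conj]; exact hb y s
  have bsq : ∀ s y, ‖conj (u y s) * u y s‖ ≤ C * C * (1 + y ^ 2)⁻¹ := fun s y =>
    decay_mul (bub s y) (bound_of_decay (hb y s))
  have bBt : ∀ s y, ‖I * (conj (flux u u₁ k s y) * iter₁ u k s y + conj (u y s) * u y s)‖
      ≤ ‖I‖ * ((C + ‖I * (k : ℂ)‖ * C) * (C * Real.pi) + C * C) := fun s y =>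
    bound_of_decay (decay_const_mul (decay_add
      (decay_mul (by rw [RCLike.norm_conj]; exact bfl s y) (bA s y)) (bsq s y)))
  have cD : ∀ s, Continuous fun y => phase k y * (I * u₂ y s) * iter₂ u k s y
      + phase k y * u y s
        * (I * (conj (flux u u₁ k s y) * iter₁ u k s y + conj (u y s) * u y s)) := fun s => by
    have := cu s; have := cu₂ s; have := cA s; have := cB s; have := cflb s; have := cub s
    fun_prop
  have bD := fun s y => decay_add
    (decay_mul (a := phase k y * (I * u₂ y s)) (C := ‖I‖ * C) (y := y)
      (by rw [norm_phase_mul]; exact decay_const_mul (hb₂ y s)) (bB s y))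
    (decay_mul (a := phase k y * u y s) (C := C) (y := y)
      (by rw [norm_phase_mul]; exact hb y s) (bBt s y))
  have key := hasDerivAt_integral_Ioi (a := x) hs
    (f := fun s y => phase k y * u y s * iter₂ u k s y)
    (f' := fun s y => phase k y * (I * u₂ y s) * iter₂ u k s y
      + phase k y * u y s
        * (I * (conj (flux u u₁ k s y) * iter₁ u k s y + conj (u y s) * u y s)))
    (fun s => by have := cu s; have := cB s; fun_prop) cD
    (fun s y => decay_iter₃ hb k s y) bD
    (fun s hs y hy => by
      have hy' := hx.trans_lt hy
      have h1 := (h.hasDeriv_t y hy' s hs).const_mul (phase k y)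
      rw [sub_zero] at h1
      exact h1.mul (h.hasDerivAt_iter₂_time k hs hy'.le))
  refine key.congr_deriv ?_
  have cu' := cu s
  have cub' := cub s
  have cQ : Continuous fun y => phase k y * (conj (u y s) * u y s * u y s) := by fun_prop
  have bQ : ∀ y, ‖phase k y * (conj (u y s) * u y s * u y s)‖ ≤ C * C * C * (1 + y ^ 2)⁻¹ :=
    fun y => by rw [norm_phase_mul]; exact decay_mul (bsq s y) (bound_of_decay (hb y s))
  have cS : Continuous fun y => phase k y * u y s * iter₂ u k s y := by
    have := cB s; fun_prop
  have iS := (integrable_of_decay cS (decay_iter₃ hb k s)).integrableOn (s := Ioi x)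
  have iQ := (integrable_of_decay cQ bQ).integrableOn (s := Ioi x)
  have cM : Continuous fun y =>
      flux u u₁ k s y * iter₂ u k s y + conj (u y s) * u y s * iter₁ u k s y := by
    have := cfl s; have := cA s; have := cB s; fun_prop
  -- Subtracting the two non-exact contributions leaves the derivative of `i(flux · iter₂ + |u|²
  -- iter₁)`.
  have cM' : Continuous fun y => phase k y * (I * u₂ y s) * iter₂ u k s y
      + phase k y * u y s
        * (I * (conj (flux u u₁ k s y) * iter₁ u k s y + conj (u y s) * u y s))
      - (-I * k ^ 2 * (phase k y * u y s * iter₂ u k s y)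
        + 2 * I * (phase k y * (conj (u y s) * u y s * u y s))) := by
    have := cD s; fun_prop
  have bM' := fun y => decay_sub (bD s y) (decay_add
    (decay_const_mul (b := -I * (k : ℂ) ^ 2) (decay_iter₃ hb k s y))
    (decay_const_mul (b := 2 * I) (bQ y)))
  have hft := integral_Ioi_of_deriv (x := x)
    (f := fun y => I * (flux u u₁ k s y * iter₂ u k s y + conj (u y s) * u y s * iter₁ u k s y))
    (by fun_prop) cM' (fun y => decay_const_mul (decay_add (decay_mul (bfl s y) (bB s y))
      (decay_mul (bsq s y) (bA s y)))) bM' (fun y hy => by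
      have hy' := hx.trans_lt hy
      have h1 := h.hasDerivAt_flux k s hy'
      have h2 := hasDerivAt_iter₁ h.cont hb k s y
      have h3 := h.hasDeriv_x y hy' s
      have h4 := hasDerivAt_iter₂ h.cont hb k s y
      refine (((h1.mul h4).add (((hasDerivAt_conj h3).mul h3).mul h2)).const_mul I).congr_deriv ?_
      have e := conj_phase_mul k y
      simp only [flux, map_mul, map_sub, Complex.conj_I, Complex.conj_ofReal,
        Pi.mul_apply]
      linear_combination (-I * iter₁ u k s y * (conj (u y s) * (u₁ y s - I * k * u y s)
        + u y s * (conj (u₁ y s) + I * k * conj (u y s)))) * e)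
  have e : ∀ d S Q : ℂ, d - (-I * k ^ 2 * S + 2 * I * Q)
      = 1 * d + (I * k ^ 2) * S + (-(2 * I)) * Q := fun d S Q => by ring
  simp_rw [e] at hft
  rw [integral_lin₃ (integrable_of_decay (cD s) (bD s)).integrableOn iS iQ] at hft
  rw [iter₃]
  linear_combination hft

end DecayingWave

/-! ### Duhamel integrals and boundary traces of the iterated integrals. -/

/-- The propagator `e^{-ik²τ}`. -/
def prop (k τ : ℝ) : ℂ := Complex.exp (-(I * k ^ 2) * (τ : ℂ))

theorem prop_neg (k τ : ℝ) : prop (-k) τ = prop k τ := by simp [prop]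

theorem prop_add (k τ σ : ℝ) : prop k (τ + σ) = prop k τ * prop k σ := by
  rw [prop, prop, prop, ← Complex.exp_add]; push_cast; ring_nf

theorem prop_zero (k : ℝ) : prop k 0 = 1 := by simp [prop]

@[fun_prop]
theorem Continuous.prop {X : Type*} [TopologicalSpace X] {f g : X → ℝ} (hf : Continuous f)
    (hg : Continuous g) : Continuous fun z => HalfLineNLS.prop (f z) (g z) := by
  unfold HalfLineNLS.prop; fun_prop

theorem norm_prop (k τ : ℝ) : ‖prop k τ‖ = 1 := by
  have : -(I * k ^ 2) * (τ : ℂ) = ((-(k ^ 2 * τ) : ℝ) : ℂ) * I := by push_cast; ring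
  rw [prop, this, Complex.norm_exp_ofReal_mul_I]

/-- The Duhamel integral `∫₀ˢ e^{-ik²(s-a)} g(a) da`. -/
def duh (k : ℝ) (g : ℝ → ℂ) (s : ℝ) : ℂ := ∫ a in (0 : ℝ)..s, prop k (s - a) * g a

theorem duh_neg (k : ℝ) (g : ℝ → ℂ) (s : ℝ) : duh (-k) g s = duh k g s := by
  simp only [duh, prop_neg]

theorem continuous_duh {g : ℝ → ℝ → ℂ} (hg : Continuous (Function.uncurry g)) :
    Continuous fun z : ℝ × ℝ => duh z.1 (g z.1) z.2 := by
  refine intervalIntegral.continuous_parametric_intervalIntegral_of_continuous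
    (f := fun (z : ℝ × ℝ) a => prop z.1 (z.2 - a) * g z.1 a) ?_ continuous_snd
  have := continuous_comp₂ hg (f := fun z : (ℝ × ℝ) × ℝ => z.1.1) (g := fun z => z.2)
    (by fun_prop) (by fun_prop)
  unfold Function.uncurry
  fun_prop

theorem continuous_duh_right {g : ℝ → ℂ} (hg : Continuous g) (k : ℝ) : Continuous (duh k g) := by
  have h : Continuous (Function.uncurry fun k s => duh k g s) :=
    continuous_duh (g := fun _ => g) (hg.comp continuous_snd)
  exact h.uncurry_left k

theorem duh_lin₂ {f g : ℝ → ℂ} (hf : Continuous f) (hg : Continuous g) (k : ℝ) (a b : ℂ) (s : ℝ) :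
    duh k (fun r => a * f r + b * g r) s = a * duh k f s + b * duh k g s := by
  have h1 : ∀ r, prop k (s - r) * (a * f r + b * g r)
      = a * (prop k (s - r) * f r) + b * (prop k (s - r) * g r) := fun r => by ring
  have i1 : Continuous fun r => prop k (s - r) * f r := by fun_prop
  have i2 : Continuous fun r => prop k (s - r) * g r := by fun_prop
  simp only [duh, h1]
  rw [intervalIntegral.integral_add ((i1.intervalIntegrable _ _).const_mul _)
    ((i2.intervalIntegrable _ _).const_mul _)]
  simp only [intervalIntegral.integral_const_mul]

theorem duh_lin₃ {f g h : ℝ → ℂ} (hf : Continuous f) (hg : Continuous g) (hh : Continuous h)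
    (k : ℝ) (a b c : ℂ) (s : ℝ) :
    duh k (fun r => a * f r + b * g r + c * h r) s
      = a * duh k f s + b * duh k g s + c * duh k h s := by
  have h1 := duh_lin₂ (f := fun r => a * f r + b * g r) (g := h) (by fun_prop) hh k 1 c s
  rw [duh_lin₂ hf hg] at h1
  simpa using h1

/-- Integration by parts in time, with no contribution at time zero because `g 0 = 0`. It trades a
factor `k²` for a time derivative of Dirichlet data, keeping the expression bounded in `k`. -/
theorem duh_parts {g dg : ℝ → ℂ} {t s : ℝ} (hg : Continuous g) (hdg : Continuous dg)
    (h0 : g 0 = 0) (hd : ∀ s ∈ Ioo 0 t, HasDerivAt g (dg s) s) (k : ℝ) (hs : s ∈ Icc 0 t) :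
    I * k ^ 2 * duh k g s = g s - duh k dg s := by
  have h := duhamel (f := g) (r := fun a => I * k ^ 2 * g a + 1 * dg a) k hg (by fun_prop) h0
    (fun a ha => (hd a ha).congr_deriv (by ring)) hs
  have e : g s = duh k (fun a => I * k ^ 2 * g a + 1 * dg a) s := h
  rw [duh_lin₂ hg hdg] at e
  linear_combination -e

/-- Boundary traces: the part of `iter₂` even in `k`. -/
def evenTrace (g₀ g₁ dg₀ : ℝ → ℂ) (k s : ℝ) : ℂ :=
  ∫ a in (0 : ℝ)..s, (conj (g₁ a) * duh k g₁ a + I * (conj (g₀ a) * duh k dg₀ a))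

/-- Boundary traces: the part of `iter₂` odd in `k`, divided by `k`. -/
def oddTrace (g₀ g₁ : ℝ → ℂ) (k s : ℝ) : ℂ :=
  ∫ a in (0 : ℝ)..s, (I * (conj (g₀ a) * duh k g₁ a) - I * (conj (g₁ a) * duh k g₀ a))

theorem evenTrace_neg (g₀ g₁ dg₀ : ℝ → ℂ) (k s : ℝ) :
    evenTrace g₀ g₁ dg₀ (-k) s = evenTrace g₀ g₁ dg₀ k s := by
  simp only [evenTrace, duh_neg]

theorem oddTrace_neg (g₀ g₁ : ℝ → ℂ) (k s : ℝ) :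
    oddTrace g₀ g₁ (-k) s = oddTrace g₀ g₁ k s := by
  simp only [oddTrace, duh_neg]

theorem continuous_conj_of {X : Type*} [TopologicalSpace X] {g : X → ℂ} (hg : Continuous g) :
    Continuous fun a => conj (g a) :=
  Complex.continuous_conj.comp hg

theorem continuous_evenTrace {g₀ g₁ dg₀ : ℝ → ℂ} (hg₀ : Continuous g₀) (hg₁ : Continuous g₁)
    (hdg₀ : Continuous dg₀) (k : ℝ) : Continuous (evenTrace g₀ g₁ dg₀ k) := by
  have := continuous_duh_right hg₁ k
  have := continuous_duh_right hdg₀ k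
  have := continuous_conj_of hg₀
  have := continuous_conj_of hg₁
  exact intervalIntegral.continuous_primitive
    (fun a b => Continuous.intervalIntegrable (by fun_prop) a b) 0

theorem continuous_oddTrace {g₀ g₁ : ℝ → ℂ} (hg₀ : Continuous g₀) (hg₁ : Continuous g₁)
    (k : ℝ) : Continuous (oddTrace g₀ g₁ k) := by
  have := continuous_duh_right hg₁ k
  have := continuous_duh_right hg₀ k
  have := continuous_conj_of hg₀
  have := continuous_conj_of hg₁
  exact intervalIntegral.continuous_primitive
    (fun a b => Continuous.intervalIntegrable (by fun_prop) a b) 0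

namespace DecayingWave

variable {t : ℝ} {u u₁ u₂ F : ℝ → ℝ → ℂ}

theorem continuous_trace (h : DecayingWave t u u₁ u₂ F) : Continuous (u 0) :=
  h.cont.uncurry_left 0

theorem continuous_trace₁ (h : DecayingWave t u u₁ u₂ F) : Continuous (u₁ 0) :=
  h.cont₁.uncurry_left 0

theorem iter₁_initial (h : DecayingWave t u u₁ u₂ F) (k x : ℝ) : iter₁ u k 0 x = 0 := by
  simp [iter₁, h.initial]

theorem iter₂_initial (h : DecayingWave t u u₁ u₂ F) (k x : ℝ) : iter₂ u k 0 x = 0 := by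
  simp [iter₂, h.initial]

theorem iter₃_initial (h : DecayingWave t u u₁ u₂ F) (k x : ℝ) : iter₃ u k 0 x = 0 := by
  simp [iter₃, h.initial]

theorem iter₁_trace (h : DecayingWave t u u₁ u₂ fun _ _ => 0) (k : ℝ) {s : ℝ}
    (hs : s ∈ Icc 0 t) : iter₁ u k s 0 = -I * duh k (u₁ 0) s - k * duh k (u 0) s := by
  obtain ⟨C, hb, -⟩ := h.decay
  have c0 := h.continuous_trace
  have c1 := h.continuous_trace₁
  have hV : Continuous fun s => iter₁ u k s 0 :=
    continuous_comp₃ (G := iter₁ u) (continuous_iter₁ h.cont hb) continuous_const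
      continuous_id continuous_const
  have e := duhamel (f := fun s => iter₁ u k s 0) (r := fun a => -I * u₁ 0 a + (-(k : ℂ)) * u 0 a)
    k hV (by fun_prop) (h.iter₁_initial k 0) (fun s hs => by
      refine (h.hasDerivAt_iter₁_time_free k hs le_rfl).congr_deriv ?_
      rw [flux, phase_zero]
      linear_combination (k * u 0 s) * Complex.I_sq) hs
  refine e.trans ((duh_lin₂ c1 c0 k (-I) (-(k : ℂ)) s).trans ?_)
  ring

/-- Integration by parts in `x`: the factor `ik` becomes an `x`-derivative of `u`, and both
resulting terms are bounded uniformly in `k`. -/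
theorem iter₁_mul_k (h : DecayingWave t u u₁ u₂ F) (k s : ℝ) {x : ℝ} (hx : 0 ≤ x) :
    I * k * iter₁ u k s x = -(phase k x * u x s) - ∫ y in Ioi x, phase k y * u₁ y s := by
  obtain ⟨C, hb, hb₁, -⟩ := h.decay
  have cu := continuous_comp₂ h.cont (f := fun y : ℝ => y) (g := fun _ => s)
    (by fun_prop) (by fun_prop)
  have cu₁ := continuous_comp₂ h.cont₁ (f := fun y : ℝ => y) (g := fun _ => s)
    (by fun_prop) (by fun_prop)
  have c1 : Continuous fun y => phase k y * u y s := by fun_prop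
  have c2 : Continuous fun y => phase k y * u₁ y s := by fun_prop
  have b1 : ∀ y, ‖phase k y * u y s‖ ≤ C * (1 + y ^ 2)⁻¹ := fun y => by
    rw [norm_phase_mul]; exact hb y s
  have b2 : ∀ y, ‖phase k y * u₁ y s‖ ≤ C * (1 + y ^ 2)⁻¹ := fun y => by
    rw [norm_phase_mul]; exact hb₁ y s
  have hft := integral_Ioi_of_deriv (x := x) (f := fun y => phase k y * u y s)
    (f' := fun y => (I * k) * (phase k y * u y s) + phase k y * u₁ y s) c1 (by fun_prop) b1
    (fun y => decay_add (decay_const_mul (b1 y)) (b2 y)) (fun y hy =>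
      ((hasDerivAt_phase k y).mul (h.hasDeriv_x y (hx.trans_lt hy) s)).congr_deriv (by ring))
  rw [integral_add ((integrable_of_decay c1 b1).integrableOn.const_mul _)
    (integrable_of_decay c2 b2).integrableOn, integral_const_mul] at hft
  rw [iter₁]
  linear_combination hft

theorem iter₂_eq_integral (h : DecayingWave t u u₁ u₂ fun _ _ => 0) (k : ℝ) {s : ℝ}
    (hs : s ∈ Icc 0 t) :
    iter₂ u k s 0 = ∫ a in (0 : ℝ)..s,
      I * (conj (flux u u₁ k a 0) * iter₁ u k a 0 + conj (u 0 a) * u 0 a) := by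
  obtain ⟨C, hb, -⟩ := h.decay
  have hW : Continuous fun s => iter₂ u k s 0 :=
    continuous_comp₃ (G := iter₂ u) (continuous_iter₂ h.cont hb) continuous_const
      continuous_id continuous_const
  have hV : Continuous fun s => iter₁ u k s 0 :=
    continuous_comp₃ (G := iter₁ u) (continuous_iter₁ h.cont hb) continuous_const
      continuous_id continuous_const
  have hfl := continuous_conj_of (continuous_comp₃ (X := ℝ) (G := flux u u₁) h.continuous_flux
    (f := fun _ => k) (g := fun s => s) (h := fun _ => 0) (by fun_prop) (by fun_prop)
    (by fun_prop))
  have c0 := h.continuous_trace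
  have c0' := continuous_conj_of c0
  have hr : Continuous fun a =>
      I * (conj (flux u u₁ k a 0) * iter₁ u k a 0 + conj (u 0 a) * u 0 a) := by fun_prop
  rw [intervalIntegral.integral_eq_sub_of_hasDerivAt_of_le hs.1 hW.continuousOn
    (fun a ha => h.hasDerivAt_iter₂_time k ⟨ha.1, ha.2.trans_le hs.2⟩ le_rfl)
    (hr.intervalIntegrable _ _), h.iter₂_initial, sub_zero]

/-- The explicit factor `k` in the flux is absorbed by `iter₁_mul_k`, and the boundary `|u|²`
cancels. What is left are half-line Fourier integrals of `u` and `u_x`, suited to endpoint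
inversion. -/
theorem iter₂_eq_integral_phase (h : DecayingWave t u u₁ u₂ fun _ _ => 0) (k : ℝ) {s : ℝ}
    (hs : s ∈ Icc 0 t) :
    iter₂ u k s 0 = ∫ a in (0 : ℝ)..s, I * (conj (u₁ 0 a) * (∫ y in Ioi 0, phase k y * u y a)
      - conj (u 0 a) * ∫ y in Ioi 0, phase k y * u₁ y a) := by
  rw [h.iter₂_eq_integral k hs]
  refine intervalIntegral.integral_congr fun a _ => ?_
  have e := h.iter₁_mul_k k a le_rfl
  rw [phase_zero] at e
  simp only [flux, phase_zero, map_mul, map_sub, map_one, Complex.conj_I, Complex.conj_ofReal]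
  change _ = I * (conj (u₁ 0 a) * iter₁ u k a 0 - _)
  linear_combination (I * conj (u 0 a)) * e

/-- Substitute the trace of `iter₁` and sort by parity in `k`. The product of the two factors linear
in `k` gives `k² duh k (u 0)`, which `duh_parts` removes at the same time as the `|u|²` term. -/
theorem iter₂_trace (h : DecayingWave t u u₁ u₂ fun _ _ => 0) {dg₀ : ℝ → ℂ}
    (hdg₀ : Continuous dg₀) (hd : ∀ s ∈ Ioo 0 t, HasDerivAt (u 0) (dg₀ s) s) (k : ℝ) {s : ℝ}
    (hs : s ∈ Icc 0 t) :
    iter₂ u k s 0 = evenTrace (u 0) (u₁ 0) dg₀ k s + k * oddTrace (u 0) (u₁ 0) k s := by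
  have c0 := h.continuous_trace
  have c1 := h.continuous_trace₁
  have c0' := continuous_conj_of c0
  have c1' := continuous_conj_of c1
  have d0 := continuous_duh_right c0 k
  have d1 := continuous_duh_right c1 k
  have d2 := continuous_duh_right hdg₀ k
  rw [h.iter₂_eq_integral k hs, evenTrace, oddTrace, ← intervalIntegral.integral_const_mul,
    ← intervalIntegral.integral_add (Continuous.intervalIntegrable (by fun_prop) _ _)
      (Continuous.intervalIntegrable (by fun_prop) _ _)]
  refine intervalIntegral.integral_congr fun a ha => ?_
  rw [uIcc_of_le hs.1] at ha
  have ha' : a ∈ Icc 0 t := ⟨ha.1, ha.2.trans hs.2⟩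
  have e := duh_parts c0 hdg₀ (h.initial 0) hd k ha'
  simp only [flux, phase_zero, map_mul, map_sub, map_one, Complex.conj_I, Complex.conj_ofReal]
  rw [h.iter₁_trace k ha']
  linear_combination (I * conj (u 0 a)) * (-e) + (-conj (u₁ 0 a) * duh k (u₁ 0) a
    - I * k * conj (u 0 a) * duh k (u₁ 0) a) * Complex.I_sq

end DecayingWave

theorem duh_congr {f g : ℝ → ℂ} {s : ℝ} (hs : 0 ≤ s) (h : ∀ a ∈ Icc 0 s, f a = g a) (k : ℝ) :
    duh k f s = duh k g s := by
  refine intervalIntegral.integral_congr fun a ha => ?_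
  rw [uIcc_of_le hs] at ha
  simp only [h a ha]

theorem duh_const_mul (k : ℝ) (c : ℂ) (g : ℝ → ℂ) (s : ℝ) :
    duh k (fun a => c * g a) s = c * duh k g s := by
  rw [duh, duh, ← intervalIntegral.integral_const_mul]
  congr 1; funext a; ring

/-! ### The global relation at frequency `k` and its symmetrization. -/

/-- The interior contribution at the final time: boundary values at `x = 0` and a remainder. -/
def interiorTerm (lam : ℂ) (u u₁ z₁ : ℝ → ℝ → ℂ) (t k : ℝ) : ℂ :=
  I * (∫ y in Ioi 0, phase k y * z₁ y t) + lam * (I * u 0 t * iter₂ u k t 0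
    + I * ∫ y in Ioi 0, (phase k y * u₁ y t * iter₂ u k t y
      - conj (u y t) * u y t * iter₁ u k t y))

/-- The boundary contribution, even in `k`. -/
def boundaryTerm (lam : ℂ) (g₀ g₁ dg₀ dG₀ : ℝ → ℂ) (t k : ℝ) : ℂ :=
  -I * duh k dG₀ t
    + lam * (k ^ 2 * duh k (fun s => -I * (g₁ s * oddTrace g₀ g₁ k s)
        - g₀ s * evenTrace g₀ g₁ dg₀ k s) t)
    + lam * duh k (fun s => conj (g₀ s) * g₀ s * (g₀ s - duh k dg₀ s)) t

namespace DecayingWave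

variable {t : ℝ} {u u₁ u₂ z z₁ z₂ F : ℝ → ℝ → ℂ}

/-- Integration by parts in the outermost variable. When the derivative falls on `iter₂`, the phase
meets its conjugate, so the resulting term carries no oscillation in that variable. -/
theorem iter₃_mul_k (h : DecayingWave t u u₁ u₂ F) (k s : ℝ) :
    I * k * iter₃ u k s 0 = -(u 0 s * iter₂ u k s 0)
      - ∫ y in Ioi 0, (phase k y * u₁ y s * iter₂ u k s y
        - conj (u y s) * u y s * iter₁ u k s y) := by
  obtain ⟨C, hb, hb₁, -⟩ := h.decay
  have cu := continuous_comp₂ h.cont (f := fun y : ℝ => y) (g := fun _ => s)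
    (by fun_prop) (by fun_prop)
  have cu₁ := continuous_comp₂ h.cont₁ (f := fun y : ℝ => y) (g := fun _ => s)
    (by fun_prop) (by fun_prop)
  have cub := continuous_conj_of cu
  have cA : Continuous (iter₁ u k s) :=
    continuous_comp₃ (G := iter₁ u) (continuous_iter₁ h.cont hb) continuous_const
      continuous_const continuous_id
  have cB : Continuous (iter₂ u k s) :=
    continuous_comp₃ (G := iter₂ u) (continuous_iter₂ h.cont hb) continuous_const
      continuous_const continuous_id
  have c1 : Continuous fun y => phase k y * u y s * iter₂ u k s y := by fun_prop
  have c2 : Continuous fun y => phase k y * u₁ y s * iter₂ u k s y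
        - conj (u y s) * u y s * iter₁ u k s y := by fun_prop
  have b1 := decay_iter₃ hb k s
  have b2 := fun y => decay_sub
    (decay_mul (a := phase k y * u₁ y s) (by rw [norm_phase_mul]; exact hb₁ y s)
      (norm_iter₂_le hb k s y))
    (decay_mul (decay_mul (a := conj (u y s)) (by rw [RCLike.norm_conj]; exact hb y s)
      (bound_of_decay (hb y s))) (norm_iter₁_le hb k s y))
  have hft := integral_Ioi_of_deriv (x := 0) (f := fun y => phase k y * u y s * iter₂ u k s y)
    (f' := fun y => (I * k) * (phase k y * u y s * iter₂ u k s y)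
      + (phase k y * u₁ y s * iter₂ u k s y - conj (u y s) * u y s * iter₁ u k s y))
    c1 (by fun_prop) b1 (fun y => decay_add (decay_const_mul (b1 y)) (b2 y)) (fun y hy => by
      refine (((hasDerivAt_phase k y).mul (h.hasDeriv_x y hy s)).mul
        (hasDerivAt_iter₂ h.cont hb k s y)).congr_deriv ?_
      simp only [map_mul, Pi.mul_apply]
      linear_combination (-conj (u y s) * u y s * iter₁ u k s y) * conj_phase_mul k y)
  rw [integral_add ((integrable_of_decay c1 b1).integrableOn.const_mul _)
    (integrable_of_decay c2 b2).integrableOn, integral_const_mul, phase_zero] at hft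
  rw [iter₃]
  linear_combination hft

theorem interiorTerm_eq (hu : DecayingWave t u u₁ u₂ fun _ _ => 0)
    (hz : DecayingWave t z z₁ z₂ F) (lam : ℂ) (k : ℝ) :
    interiorTerm lam u u₁ z₁ t k
      = k * (iter₁ z k t 0 + lam * iter₃ u k t 0) - I * z 0 t := by
  have e1 := hz.iter₁_mul_k k t le_rfl
  have e2 := hu.iter₃_mul_k k t
  rw [phase_zero] at e1
  rw [interiorTerm]
  linear_combination I * e1 + I * lam * e2
    - (k * (iter₁ z k t 0 + lam * iter₃ u k t 0)) * Complex.I_sq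

/-- The bulk forcing of `iter₁ z` is `-2iλ ∫ e^{iky}|u|²u` and that of `λ iter₃ u` is its negative.
The sum is therefore driven by quantities at `x = 0` only. -/
theorem duhamel_iter₁_add_iter₃ (ht : 0 ≤ t) (hu : DecayingWave t u u₁ u₂ fun _ _ => 0) {lam : ℂ}
    (hz : DecayingWave t z z₁ z₂ fun x s => 2 * lam * (conj (u x s) * u x s * u x s)) (k : ℝ) :
    iter₁ z k t 0 + lam * iter₃ u k t 0 = duh k (fun s => -I * z₁ 0 s - k * z 0 s
      - I * lam * ((u₁ 0 s - I * k * u 0 s) * iter₂ u k s 0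
        + conj (u 0 s) * u 0 s * iter₁ u k s 0)) t := by
  obtain ⟨C, hb, -⟩ := hu.decay
  obtain ⟨C', hb', -⟩ := hz.decay
  have cV : Continuous fun s => iter₁ u k s 0 :=
    continuous_comp₃ (G := iter₁ u) (continuous_iter₁ hu.cont hb) continuous_const
      continuous_id continuous_const
  have cW : Continuous fun s => iter₂ u k s 0 :=
    continuous_comp₃ (G := iter₂ u) (continuous_iter₂ hu.cont hb) continuous_const
      continuous_id continuous_const
  have cS : Continuous fun s => iter₃ u k s 0 :=
    continuous_comp₃ (G := iter₃ u) (continuous_iter₃ hu.cont hb) continuous_const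
      continuous_id continuous_const
  have cZ : Continuous fun s => iter₁ z k s 0 :=
    continuous_comp₃ (G := iter₁ z) (continuous_iter₁ hz.cont hb') continuous_const
      continuous_id continuous_const
  have c0 := hu.continuous_trace
  have c1 := hu.continuous_trace₁
  have c0' := continuous_conj_of c0
  have d0 := hz.continuous_trace
  have d1 := hz.continuous_trace₁
  refine duhamel (t := t) (f := fun s => iter₁ z k s 0 + lam * iter₃ u k s 0) k
    (cZ.add (continuous_const.mul cS)) (by fun_prop)
    (by simp [hz.iter₁_initial, hu.iter₃_initial]) (fun s hs => ?_) ⟨ht, le_rfl⟩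
  refine ((hz.hasDerivAt_iter₁_time k hs le_rfl).add
    ((hu.hasDerivAt_iter₃_time k hs le_rfl).const_mul lam)).congr_deriv ?_
  have e : ∀ y, phase k y * (2 * lam * (conj (u y s) * u y s * u y s))
      = 2 * lam * (phase k y * (conj (u y s) * u y s * u y s)) := fun y => by ring
  simp only [e, integral_const_mul, flux, phase_zero]
  linear_combination (k * z 0 s) * Complex.I_sq

/-- Symmetrizing in `k` removes the unknown Neumann trace of `z`. -/
theorem interiorTerm_add_neg (ht : 0 ≤ t) (hu : DecayingWave t u u₁ u₂ fun _ _ => 0) {lam : ℂ}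
    (hz : DecayingWave t z z₁ z₂ fun x s => 2 * lam * (conj (u x s) * u x s * u x s))
    {dg₀ dG₀ : ℝ → ℂ} (hdg₀ : Continuous dg₀) (hdG₀ : Continuous dG₀)
    (hd : ∀ s ∈ Ioo 0 t, HasDerivAt (u 0) (dg₀ s) s)
    (hD : ∀ s ∈ Ioo 0 t, HasDerivAt (z 0) (dG₀ s) s) (k : ℝ) :
    interiorTerm lam u u₁ z₁ t k + interiorTerm lam u u₁ z₁ t (-k)
      = 2 * boundaryTerm lam (u 0) (u₁ 0) dg₀ dG₀ t k := by
  have c0 := hu.continuous_trace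
  have c1 := hu.continuous_trace₁
  have c0' := continuous_conj_of c0
  have d0 := hz.continuous_trace
  have d1 := hz.continuous_trace₁
  have cE := continuous_evenTrace c0 c1 hdg₀ k
  have cO := continuous_oddTrace c0 c1 k
  have cD0 := continuous_duh_right c0 k
  have cD1 := continuous_duh_right c1 k
  have cDd := continuous_duh_right hdg₀ k
  set We := evenTrace (u 0) (u₁ 0) dg₀ with hWe
  set Wo := oddTrace (u 0) (u₁ 0) with hWo
  -- Parity decomposition of the Duhamel source: `E` is its even part, and the odd part is `k` times
  -- `-z 0 + lam * M + lam * P`. After multiplication by `k`, the part `E`, which holds the unknown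
  -- `z₁ 0`, is odd and drops out of the sum.
  set M : ℝ → ℂ := fun s => -I * (u₁ 0 s * Wo k s) - u 0 s * We k s with hM
  have cM : Continuous M := by fun_prop
  set P : ℝ → ℂ := fun s => I * (conj (u 0 s) * u 0 s * duh k (u 0) s) with hP
  have cP : Continuous P := by fun_prop
  set E : ℝ → ℂ := fun s => -I * z₁ 0 s + lam * (-I * u₁ 0 s * We k s - k ^ 2 * u 0 s * Wo k s
    - conj (u 0 s) * u 0 s * duh k (u₁ 0) s) with hE
  have cEE : Continuous E := by fun_prop
  -- Formulated for any `κ` with `κ² = k²`, so that `κ = k` and `κ = -k` are covered by one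
  -- computation.
  have split : ∀ κ : ℝ, κ ^ 2 = k ^ 2 → (∀ g s, duh κ g s = duh k g s) →
      (∀ s, We κ s = We k s) → (∀ s, Wo κ s = Wo k s) →
      iter₁ z κ t 0 + lam * iter₃ u κ t 0
        = duh k E t + κ * duh k (fun s => (-1) * z 0 s + lam * M s + lam * P s) t := by
    intro κ hκ hduh he ho
    have hκ' : (κ : ℂ) ^ 2 = (k : ℂ) ^ 2 := by exact_mod_cast hκ
    rw [hu.duhamel_iter₁_add_iter₃ ht hz κ, hduh,
      ← one_mul (duh k E t), ← duh_lin₂ cEE (by fun_prop)]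
    refine duh_congr ht (fun s hs => ?_) k
    rw [hu.iter₂_trace hdg₀ hd κ hs, hu.iter₁_trace κ hs, hduh, hduh, ← hWe, ← hWo, he, ho]
    simp only [hE, hM, hP]
    linear_combination (-lam * u 0 s * Wo k s) * hκ'
      + lam * (κ * u 0 s * (We k s + κ * Wo k s)
        + conj (u 0 s) * u 0 s * duh k (u₁ 0) s) * Complex.I_sq
  have ep := split k rfl (fun _ _ => rfl) (fun _ => rfl) (fun _ => rfl)
  have em := split (-k) (by ring) (duh_neg k) (evenTrace_neg _ _ _ k) (oddTrace_neg _ _ k)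
  rw [hu.interiorTerm_eq hz, hu.interiorTerm_eq hz, ep, em, duh_lin₃ d0 cM cP]
  have ez := duh_parts d0 hdG₀ (hz.initial 0) hD k (right_mem_Icc.2 ht)
  -- For `P` the factor `k²` can be traded for a time derivative of Dirichlet data; for `M` it stays
  -- and later produces the `3/2`-power kernels.
  have eP : k ^ 2 * duh k P t
      = duh k (fun s => conj (u 0 s) * u 0 s * (u 0 s - duh k dg₀ s)) t := by
    rw [← duh_const_mul]
    refine duh_congr ht (fun s hs => ?_) k
    rw [← duh_parts c0 hdg₀ (hu.initial 0) hd k hs]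
    simp only [hP]; ring
  rw [boundaryTerm, ← eP]
  push_cast
  linear_combination (2 * I) * ez - 2 * k ^ 2 * duh k (z 0) t * Complex.I_sq

end DecayingWave

/-! ### Gaussian smoothing in `k` and endpoint Fourier inversion. -/

/-- Interchange of a weighted integral in `k` with an integral over a parameter. -/
theorem integral_weight_swap {μ : Measure ℝ} [SFinite μ] {w : ℝ → ℂ} (hw : Integrable w)
    {F : ℝ → ℝ → ℂ} (hF : Continuous (Function.uncurry F)) {b : ℝ → ℝ} (hb : Integrable b μ)
    (hFb : ∀ᵐ y ∂μ, ∀ k, ‖F k y‖ ≤ b y) :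
    ∫ k, w k * ∫ y, F k y ∂μ = ∫ y, (∫ k, w k * F k y) ∂μ := by
  simp_rw [← integral_const_mul]
  refine integral_integral_swap ?_
  refine Integrable.mono' (g := fun p : ℝ × ℝ => ‖w p.1‖ * b p.2) (hw.norm.mul_prod hb)
    (hw.aestronglyMeasurable.comp_fst.mul hF.aestronglyMeasurable) ?_
  filter_upwards [Measure.quasiMeasurePreserving_snd.ae hFb] with p hp
  simp only [Function.uncurry, norm_mul]
  exact mul_le_mul_of_nonneg_left (hp p.1) (norm_nonneg _)

/-- The Gaussian weight `e^{-δk²}`. -/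
def gauss (δ k : ℝ) : ℂ := Complex.exp (-(δ : ℂ) * (k : ℂ) ^ 2)

@[fun_prop]
theorem continuous_gauss (δ : ℝ) : Continuous (gauss δ) := by unfold gauss; fun_prop

theorem integrable_gauss {δ : ℝ} (hδ : 0 < δ) : Integrable (gauss δ) :=
  integrable_cexp_neg_mul_sq (by simpa using hδ)

theorem gauss_neg (δ k : ℝ) : gauss δ (-k) = gauss δ k := by simp [gauss]

/-- Smoothing in the spectral parameter. -/
def smooth (δ : ℝ) (F : ℝ → ℂ) : ℂ := ∫ k, gauss δ k * F k

theorem smooth_comp_neg (δ : ℝ) (F : ℝ → ℂ) : smooth δ (fun k => F (-k)) = smooth δ F := by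
  rw [smooth, smooth, ← integral_neg_eq_self (fun k => gauss δ k * F k)]
  simp only [gauss_neg]

theorem integrable_gauss_mul {δ : ℝ} (hδ : 0 < δ) {F : ℝ → ℂ} (hF : Continuous F) {M : ℝ}
    (hM : ∀ k, ‖F k‖ ≤ M) : Integrable fun k => gauss δ k * F k :=
  (integrable_gauss hδ).mul_bdd (c := M) hF.aestronglyMeasurable (ae_of_all _ hM)

/-- The kernel `√(π/δ) e^{-x²/(4δ)}`. -/
def heat (δ x : ℝ) : ℝ := √(Real.pi / δ) * Real.exp (-(4 * δ)⁻¹ * x ^ 2)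

@[fun_prop]
theorem Continuous.heat {X : Type*} [TopologicalSpace X] {f : X → ℝ} (hf : Continuous f) (δ : ℝ) :
    Continuous fun z => HalfLineNLS.heat δ (f z) := by
  unfold HalfLineNLS.heat; fun_prop

theorem heat_nonneg (δ x : ℝ) : 0 ≤ heat δ x := by unfold heat; positivity

theorem smooth_phase {δ : ℝ} (hδ : 0 < δ) (x : ℝ) :
    smooth δ (fun k => phase k x) = heat δ x := by
  have h := fourierIntegral_gaussian (b := (δ : ℂ)) (by simpa using hδ) (x : ℂ)
  have e : ((Real.pi : ℂ) / (δ : ℂ)) ^ (1 / 2 : ℂ) = ((√(Real.pi / δ) : ℝ) : ℂ) := by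
    rw [Real.sqrt_eq_rpow, Complex.ofReal_cpow (by positivity)]
    push_cast; rfl
  rw [e] at h
  rw [smooth, heat]
  push_cast
  convert h using 2
  · funext k
    rw [gauss, phase, mul_comm]
    congr 2; ring
  · congr 1
    ring

theorem integral_heat {δ : ℝ} (hδ : 0 < δ) (a : ℝ) : ∫ x, heat δ (a + x) = 2 * Real.pi := by
  rw [integral_add_left_eq_self (heat δ) a]
  simp only [heat]
  rw [integral_const_mul, integral_gaussian, ← Real.sqrt_mul (by positivity)]
  have : Real.pi / δ * (Real.pi / (4 * δ)⁻¹) = (2 * Real.pi) ^ 2 := by field_simp; ring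
  rw [this, Real.sqrt_sq (by positivity)]

theorem integrable_heat {δ : ℝ} (hδ : 0 < δ) (a : ℝ) : Integrable fun x => heat δ (a + x) := by
  have : Integrable (heat δ) := (integrable_exp_neg_mul_sq (by positivity)).const_mul _
  exact this.comp_add_left a

theorem norm_integral_heat_le {δ : ℝ} (hδ : 0 < δ) (a x : ℝ) {f : ℝ → ℂ} {M : ℝ}
    (hM : ∀ y, ‖f y‖ ≤ M) : ‖∫ y in Ioi x, (heat δ (a + y) : ℂ) * f y‖ ≤ 2 * Real.pi * M := by
  have hM0 : 0 ≤ M := (norm_nonneg _).trans (hM 0)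
  have hi := (integrable_heat hδ a).mul_const M
  calc ‖∫ y in Ioi x, (heat δ (a + y) : ℂ) * f y‖ ≤ ∫ y in Ioi x, heat δ (a + y) * M := by
        refine norm_integral_le_of_norm_le hi.integrableOn (ae_of_all _ fun y => ?_)
        rw [norm_mul, Complex.norm_real, Real.norm_of_nonneg (heat_nonneg _ _)]
        exact mul_le_mul_of_nonneg_left (hM y) (heat_nonneg _ _)
    _ ≤ ∫ y, heat δ (a + y) * M := setIntegral_le_integral hi
        (ae_of_all _ fun y => mul_nonneg (heat_nonneg _ _) hM0)
    _ = 2 * Real.pi * M := by rw [integral_mul_const, integral_heat hδ]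

/-- Away from the origin the kernel vanishes as `δ → 0`. The crude bound `e^{-a} ≤ 1/a` gains a
factor `δ`, enough to beat the prefactor of order `1/√δ`. -/
theorem heat_le {δ η x : ℝ} (hδ : 0 < δ) (hη : 0 < η) (hx : η ≤ x) :
    heat δ x ≤ √Real.pi * (4 / η ^ 2) * √δ := by
  have h1 : Real.exp (-(4 * δ)⁻¹ * x ^ 2) ≤ 4 * δ / η ^ 2 := by
    have h2 : η ^ 2 / (4 * δ) ≤ (4 * δ)⁻¹ * x ^ 2 := by
      rw [div_eq_inv_mul]; gcongr
    have h3 : (4 * δ)⁻¹ * x ^ 2 ≤ Real.exp ((4 * δ)⁻¹ * x ^ 2) := by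
      have := Real.add_one_le_exp ((4 * δ)⁻¹ * x ^ 2); linarith
    rw [neg_mul, Real.exp_neg, ← inv_div]
    exact inv_anti₀ (by positivity) (h2.trans h3)
  rw [heat, Real.sqrt_div' _ hδ.le]
  calc √Real.pi / √δ * Real.exp (-(4 * δ)⁻¹ * x ^ 2) ≤ √Real.pi / √δ * (4 * δ / η ^ 2) := by gcongr
    _ = √Real.pi * (4 / η ^ 2) * √δ := by
        have : δ = √δ * √δ := (Real.mul_self_sqrt hδ.le).symm
        have h4 : √δ ≠ 0 := (Real.sqrt_pos.2 hδ).ne'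
        field_simp
        nlinarith

/-- The even kernel has total mass `2π` and concentrates at the origin; the half-line sees half of
it, hence the constant `π`. -/
theorem tendsto_integral_heat {h : ℝ → ℂ} (hc : Continuous h) {M : ℝ} (hM : ∀ y, ‖h y‖ ≤ M) :
    Tendsto (fun δ => ∫ y in Ioi 0, (heat δ y : ℂ) * h y) (𝓝[>] 0) (𝓝 (Real.pi * h 0)) := by
  -- After the substitution `y ↦ √δ y` the Gaussian no longer depends on `δ`, and dominated
  -- convergence applies to `h (√δ * y)`.
  have key : Tendsto (fun δ : ℝ => ∫ y in Ioi (0 : ℝ),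
      ((√Real.pi * Real.exp (-(1 / 4) * y ^ 2) : ℝ) : ℂ) * h (√δ * y)) (𝓝[>] 0)
      (𝓝 (∫ y in Ioi (0 : ℝ), ((√Real.pi * Real.exp (-(1 / 4) * y ^ 2) : ℝ) : ℂ) * h 0)) := by
    have hi : Integrable fun y : ℝ => √Real.pi * Real.exp (-(1 / 4) * y ^ 2) :=
      (integrable_exp_neg_mul_sq (by norm_num)).const_mul _
    refine tendsto_integral_filter_of_dominated_convergence
      (fun y => √Real.pi * Real.exp (-(1 / 4) * y ^ 2) * M)
      (Eventually.of_forall fun δ => Continuous.aestronglyMeasurable (by fun_prop))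
      (Eventually.of_forall fun δ => ae_of_all _ fun y => ?_) (hi.mul_const M).integrableOn
      (ae_of_all _ fun y => ?_)
    · rw [norm_mul, Complex.norm_real, Real.norm_of_nonneg (by positivity)]
      exact mul_le_mul_of_nonneg_left (hM _) (by positivity)
    · refine Tendsto.const_mul _ ?_
      have : Continuous fun δ : ℝ => h (√δ * y) := by fun_prop
      have h0 := (this.tendsto 0).mono_left (nhdsWithin_le_nhds (s := Ioi 0))
      simpa using h0
  have e : ∫ y in Ioi (0 : ℝ), ((√Real.pi * Real.exp (-(1 / 4) * y ^ 2) : ℝ) : ℂ) * h 0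
      = Real.pi * h 0 := by
    rw [integral_mul_const, integral_complex_ofReal, integral_const_mul, integral_gaussian_Ioi]
    congr 2
    rw [mul_div_assoc', ← Real.sqrt_mul Real.pi_pos.le]
    have : Real.pi * (Real.pi / (1 / 4)) = (2 * Real.pi) ^ 2 := by ring
    rw [this, Real.sqrt_sq (by positivity)]; ring
  rw [e] at key
  refine key.congr' ?_
  filter_upwards [self_mem_nhdsWithin] with δ (hδ : 0 < δ)
  have hs : 0 < √δ := Real.sqrt_pos.2 hδ
  have := integral_comp_mul_left_Ioi (fun y => (heat δ y : ℂ) * h y) 0 hs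
  rw [mul_zero] at this
  have e2 : ∫ y in Ioi 0, (heat δ y : ℂ) * h y
      = √δ • ∫ y in Ioi 0, (heat δ (√δ * y) : ℂ) * h (√δ * y) := by
    rw [this, smul_smul, mul_inv_cancel₀ hs.ne', one_smul]
  rw [e2, ← integral_smul]
  refine integral_congr_ae (ae_of_all _ fun y => ?_)
  simp only [heat, Complex.real_smul]
  rw [← mul_assoc, ← Complex.ofReal_mul, ← mul_assoc √δ, ← Real.sqrt_mul hδ.le,
    mul_div_cancel₀ _ hδ.ne', mul_pow, Real.sq_sqrt hδ.le]
  congr 4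
  field_simp

theorem integrable_decay_bound (C x : ℝ) :
    Integrable (fun y : ℝ => C * (1 + y ^ 2)⁻¹) (volume.restrict (Ioi x)) :=
  (integrable_inv_one_add_sq.const_mul C).integrableOn

theorem smooth_swap {μ : Measure ℝ} [SFinite μ] {δ : ℝ} (hδ : 0 < δ) {F : ℝ → ℝ → ℂ}
    (hF : Continuous (Function.uncurry F)) {b : ℝ → ℝ} (hb : Integrable b μ)
    (hFb : ∀ᵐ y ∂μ, ∀ k, ‖F k y‖ ≤ b y) :
    smooth δ (fun k => ∫ y, F k y ∂μ) = ∫ y, smooth δ (fun k => F k y) ∂μ :=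
  integral_weight_swap (integrable_gauss hδ) hF hb hFb

theorem smooth_const_mul (δ : ℝ) (c : ℂ) (F : ℝ → ℂ) :
    smooth δ (fun k => c * F k) = c * smooth δ F := by
  rw [smooth, smooth, ← integral_const_mul]
  congr 1; funext k; ring

theorem smooth_sub {δ : ℝ} (hδ : 0 < δ) {F G : ℝ → ℂ} (hF : Continuous F) (hG : Continuous G)
    {M N : ℝ} (hM : ∀ k, ‖F k‖ ≤ M) (hN : ∀ k, ‖G k‖ ≤ N) :
    smooth δ (fun k => F k - G k) = smooth δ F - smooth δ G := by
  simp only [smooth, mul_sub]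
  exact integral_sub (integrable_gauss_mul hδ hF hM) (integrable_gauss_mul hδ hG hN)

theorem continuous_smooth {δ : ℝ} (hδ : 0 < δ) {F : ℝ → ℝ → ℂ}
    (hF : Continuous (Function.uncurry F)) {M : ℝ} (hM : ∀ k y, ‖F k y‖ ≤ M) :
    Continuous fun y => smooth δ (fun k => F k y) := by
  refine continuous_of_dominated (bound := fun k => ‖gauss δ k‖ * M)
    (fun y => ((continuous_gauss δ).mul (hF.uncurry_right y)).aestronglyMeasurable)
    (fun y => ae_of_all _ fun k => ?_) ((integrable_gauss hδ).norm.mul_const M)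
    (ae_of_all _ fun k => continuous_const.mul (hF.uncurry_left k))
  rw [norm_mul]
  exact mul_le_mul_of_nonneg_left (hM k y) (norm_nonneg _)

theorem smooth_phase_tail {δ : ℝ} (hδ : 0 < δ) {f : ℝ → ℂ} (hf : Continuous f) {C : ℝ}
    (hb : ∀ y, ‖f y‖ ≤ C * (1 + y ^ 2)⁻¹) (a x : ℝ) :
    smooth δ (fun k => phase k a * ∫ y in Ioi x, phase k y * f y)
      = ∫ y in Ioi x, (heat δ (a + y) : ℂ) * f y := by
  have e : ∀ k, phase k a * ∫ y in Ioi x, phase k y * f y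
      = ∫ y in Ioi x, f y * phase k (a + y) := fun k => by
    rw [← integral_const_mul]
    congr 1; funext y; rw [phase_add]; ring
  simp_rw [e]
  rw [smooth_swap hδ (F := fun k y => f y * phase k (a + y)) (by unfold Function.uncurry; fun_prop)
    (integrable_decay_bound C x) (ae_of_all _ fun y k => by
      rw [norm_mul, norm_phase, mul_one]; exact hb y)]
  simp_rw [smooth_const_mul, smooth_phase hδ, mul_comm]

theorem tendsto_smooth_phase_integral {f : ℝ → ℂ} (hf : Continuous f) {C : ℝ}
    (hb : ∀ y, ‖f y‖ ≤ C * (1 + y ^ 2)⁻¹) :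
    Tendsto (fun δ => smooth δ fun k => ∫ y in Ioi 0, phase k y * f y) (𝓝[>] 0)
      (𝓝 (Real.pi * f 0)) := by
  refine (tendsto_integral_heat hf (fun y => bound_of_decay (hb y))).congr' ?_
  filter_upwards [self_mem_nhdsWithin] with δ hδ
  have h := smooth_phase_tail hδ hf hb 0 0
  simp only [phase_zero, one_mul, zero_add] at h
  exact h.symm

theorem norm_smooth_phase_tail_le {δ : ℝ} (hδ : 0 < δ) {f : ℝ → ℂ} (hf : Continuous f) {C : ℝ}
    (hb : ∀ y, ‖f y‖ ≤ C * (1 + y ^ 2)⁻¹) (a x : ℝ) :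
    ‖smooth δ (fun k => phase k a * ∫ y in Ioi x, phase k y * f y)‖ ≤ 2 * Real.pi * C := by
  rw [smooth_phase_tail hδ hf hb]
  exact norm_integral_heat_le hδ a x fun y => bound_of_decay (hb y)

/-- The total phase is `a + y ≥ a + x > 0` on the domain of integration, so the concentrating kernel
is never evaluated near its peak. -/
theorem tendsto_smooth_phase_tail {f : ℝ → ℂ} (hf : Continuous f) {C : ℝ}
    (hb : ∀ y, ‖f y‖ ≤ C * (1 + y ^ 2)⁻¹) {a x : ℝ} (hax : 0 < a + x) :
    Tendsto (fun δ => smooth δ fun k => phase k a * ∫ y in Ioi x, phase k y * f y) (𝓝[>] 0)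
      (𝓝 0) := by
  have hs : Tendsto (fun δ : ℝ => √Real.pi * (4 / (a + x) ^ 2) * √δ * (C * Real.pi)) (𝓝[>] 0)
      (𝓝 0) := by
    have h : Continuous fun δ : ℝ => √Real.pi * (4 / (a + x) ^ 2) * √δ * (C * Real.pi) := by
      fun_prop
    simpa using (h.tendsto 0).mono_left (nhdsWithin_le_nhds (s := Ioi 0))
  refine squeeze_zero_norm' ?_ hs
  filter_upwards [self_mem_nhdsWithin] with δ (hδ : 0 < δ)
  rw [smooth_phase_tail hδ hf hb]
  have hC : 0 ≤ C := (norm_nonneg _).trans (bound_of_decay (hb 0))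
  set K := √Real.pi * (4 / (a + x) ^ 2) * √δ with hK
  have hK0 : 0 ≤ K := by positivity
  calc ‖∫ y in Ioi x, (heat δ (a + y) : ℂ) * f y‖ ≤ ∫ y in Ioi x, K * (C * (1 + y ^ 2)⁻¹) := by
        refine norm_integral_le_of_norm_le ((integrable_decay_bound C x).const_mul K)
          ((ae_restrict_iff' measurableSet_Ioi).2 (ae_of_all _ fun y hy => ?_))
        rw [norm_mul, Complex.norm_real, Real.norm_of_nonneg (heat_nonneg _ _)]
        have hy' : a + x ≤ a + y := by have := mem_Ioi.1 hy; linarith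
        exact mul_le_mul (heat_le hδ hax hy') (hb y) (norm_nonneg _) hK0
    _ ≤ ∫ y, K * (C * (1 + y ^ 2)⁻¹) := setIntegral_le_integral
        ((integrable_inv_one_add_sq.const_mul C).const_mul K)
        (ae_of_all _ fun y => by positivity)
    _ = K * (C * Real.pi) := by
        rw [integral_const_mul, integral_const_mul, integral_univ_inv_one_add_sq]

/-! ### Smoothed limits of the iterated integrals. -/

section Iterated

variable {u : ℝ → ℝ → ℂ} {C : ℝ}

/-- Conjugation reverses the middle phase, so the phase accompanying `iter₁` at `w` is `x - w`. With
the phase `y > w` inside `iter₁`, the total `x - w + y` exceeds `x`. -/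
theorem smooth_phase_iter₂ {δ : ℝ} (hδ : 0 < δ) (hu : Continuous (Function.uncurry u))
    (hb : ∀ x s, ‖u x s‖ ≤ C * (1 + x ^ 2)⁻¹) (s x : ℝ) :
    smooth δ (fun k => phase k x * iter₂ u k s x)
      = ∫ w in Ioi x, conj (u w s) * smooth δ (fun k => phase k (x - w) * iter₁ u k s w) := by
  have cA : Continuous fun z : ℝ × ℝ => iter₁ u z.1 s z.2 :=
    continuous_comp₃ (G := iter₁ u) (continuous_iter₁ hu hb) continuous_fst
      continuous_const continuous_snd
  have cu := continuous_conj_of (continuous_comp₂ hu (f := fun z : ℝ × ℝ => z.2) (g := fun _ => s)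
    (by fun_prop) (by fun_prop))
  have e : ∀ k, phase k x * iter₂ u k s x
      = ∫ w in Ioi x, conj (u w s) * (phase k (x - w) * iter₁ u k s w) := fun k => by
    rw [iter₂, ← integral_const_mul]
    congr 1; funext w
    rw [sub_eq_add_neg, phase_add, map_mul, conj_phase]; ring
  simp_rw [e]
  rw [smooth_swap hδ (F := fun k w => conj (u w s) * (phase k (x - w) * iter₁ u k s w))
    (by unfold Function.uncurry; fun_prop) (integrable_decay_bound (C * (C * Real.pi)) x)
    (ae_of_all _ fun w k => decay_mul (by rw [RCLike.norm_conj]; exact hb w s)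
      (by rw [norm_phase_mul]; exact norm_iter₁_le hb k s w))]
  simp_rw [smooth_const_mul]

theorem continuous_smooth_phase_iter₁ {δ : ℝ} (hδ : 0 < δ) (hu : Continuous (Function.uncurry u))
    (hb : ∀ x s, ‖u x s‖ ≤ C * (1 + x ^ 2)⁻¹) (s x : ℝ) :
    Continuous fun w => smooth δ (fun k => phase k (x - w) * iter₁ u k s w) := by
  have cA : Continuous fun z : ℝ × ℝ => iter₁ u z.1 s z.2 :=
    continuous_comp₃ (G := iter₁ u) (continuous_iter₁ hu hb) continuous_fst
      continuous_const continuous_snd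
  exact continuous_smooth hδ (F := fun k w => phase k (x - w) * iter₁ u k s w) (M := C * Real.pi)
    (by unfold Function.uncurry; fun_prop)
    fun k w => by rw [norm_phase_mul]; exact norm_iter₁_le hb k s w

theorem norm_smooth_phase_iter₂_le {δ : ℝ} (hδ : 0 < δ) (hu : Continuous (Function.uncurry u))
    (hb : ∀ x s, ‖u x s‖ ≤ C * (1 + x ^ 2)⁻¹) (s x : ℝ) :
    ‖smooth δ (fun k => phase k x * iter₂ u k s x)‖ ≤ C * (2 * Real.pi * C) * Real.pi := by
  rw [smooth_phase_iter₂ hδ hu hb]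
  have cu := continuous_comp₂ hu (f := fun z : ℝ => z) (g := fun _ => s)
    (by fun_prop) (by fun_prop)
  exact norm_tail_le (fun w => decay_mul (by rw [RCLike.norm_conj]; exact hb w s)
    (norm_smooth_phase_tail_le hδ cu (fun y => hb y s) (x - w) w)) x

theorem tendsto_smooth_phase_iter₂ (hu : Continuous (Function.uncurry u))
    (hb : ∀ x s, ‖u x s‖ ≤ C * (1 + x ^ 2)⁻¹) (s : ℝ) {x : ℝ} (hx : 0 < x) :
    Tendsto (fun δ => smooth δ (fun k => phase k x * iter₂ u k s x)) (𝓝[>] 0) (𝓝 0) := by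
  have cu := continuous_comp₂ hu (f := fun z : ℝ => z) (g := fun _ => s)
    (by fun_prop) (by fun_prop)
  have cub := continuous_conj_of cu
  have key : Tendsto (fun δ => ∫ w in Ioi x,
      conj (u w s) * smooth δ (fun k => phase k (x - w) * iter₁ u k s w)) (𝓝[>] 0)
      (𝓝 (∫ w in Ioi x, (0 : ℂ))) := by
    refine tendsto_integral_filter_of_dominated_convergence
      (fun w => C * (2 * Real.pi * C) * (1 + w ^ 2)⁻¹) ?_ ?_ (integrable_decay_bound _ x)
      (ae_of_all _ fun w => ?_)
    · filter_upwards [self_mem_nhdsWithin] with δ hδ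
      exact (cub.mul (continuous_smooth_phase_iter₁ hδ hu hb s x)).aestronglyMeasurable
    · filter_upwards [self_mem_nhdsWithin] with δ hδ
      exact ae_of_all _ fun w => decay_mul (by rw [RCLike.norm_conj]; exact hb w s)
        (norm_smooth_phase_tail_le hδ cu (fun y => hb y s) (x - w) w)
    · have := (tendsto_smooth_phase_tail cu (fun y => hb y s) (a := x - w) (x := w)
        (by linarith)).const_mul (conj (u w s))
      rw [mul_zero] at this
      exact this
  rw [integral_zero] at key
  refine key.congr' ?_
  filter_upwards [self_mem_nhdsWithin] with δ hδ
  exact (smooth_phase_iter₂ hδ hu hb s x).symm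

/-- In both terms the net phase exceeds the outer variable `y > 0`, so the smoothed integrands tend
to zero pointwise. The bounds uniform in `δ` provide an integrable majorant in `y`. -/
theorem tendsto_smooth_remainder {u₁ : ℝ → ℝ → ℂ} (hu : Continuous (Function.uncurry u))
    (hu₁ : Continuous (Function.uncurry u₁)) (hb : ∀ x s, ‖u x s‖ ≤ C * (1 + x ^ 2)⁻¹)
    (hb₁ : ∀ x s, ‖u₁ x s‖ ≤ C * (1 + x ^ 2)⁻¹) (s : ℝ) :
    Tendsto (fun δ => smooth δ fun k => ∫ y in Ioi 0, (phase k y * u₁ y s * iter₂ u k s y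
      - conj (u y s) * u y s * iter₁ u k s y)) (𝓝[>] 0) (𝓝 0) := by
  have cu := continuous_comp₂ hu (f := fun z : ℝ => z) (g := fun _ => s)
    (by fun_prop) (by fun_prop)
  have cu₁ := continuous_comp₂ hu₁ (f := fun z : ℝ => z) (g := fun _ => s)
    (by fun_prop) (by fun_prop)
  have cu' := continuous_comp₂ hu (f := fun z : ℝ × ℝ => z.2) (g := fun _ => s)
    (by fun_prop) (by fun_prop)
  have cu₁' := continuous_comp₂ hu₁ (f := fun z : ℝ × ℝ => z.2) (g := fun _ => s)
    (by fun_prop) (by fun_prop)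
  have cub := continuous_conj_of cu
  have cub' := continuous_conj_of cu'
  have cA : Continuous fun z : ℝ × ℝ => iter₁ u z.1 s z.2 :=
    continuous_comp₃ (G := iter₁ u) (continuous_iter₁ hu hb) continuous_fst
      continuous_const continuous_snd
  have cB : Continuous fun z : ℝ × ℝ => iter₂ u z.1 s z.2 :=
    continuous_comp₃ (G := iter₂ u) (continuous_iter₂ hu hb) continuous_fst
      continuous_const continuous_snd
  have bsq : ∀ y, ‖conj (u y s) * u y s‖ ≤ C * C * (1 + y ^ 2)⁻¹ := fun y =>
    decay_mul (by rw [RCLike.norm_conj]; exact hb y s) (bound_of_decay (hb y s))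
  have hA : ∀ δ y, smooth δ (fun k => iter₁ u k s y)
      = smooth δ (fun k => phase k 0 * ∫ w in Ioi y, phase k w * u w s) := fun δ y => by
    simp only [phase_zero, one_mul]; rfl
  have key : Tendsto (fun δ => ∫ y in Ioi 0,
      (u₁ y s * smooth δ (fun k => phase k y * iter₂ u k s y)
        - conj (u y s) * u y s * smooth δ (fun k => iter₁ u k s y))) (𝓝[>] 0)
      (𝓝 (∫ y in Ioi (0 : ℝ), (0 : ℂ))) := by
    refine tendsto_integral_filter_of_dominated_convergence
      (fun w => (C * (C * (2 * Real.pi * C) * Real.pi) + C * C * (2 * Real.pi * C))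
        * (1 + w ^ 2)⁻¹) ?_ ?_ (integrable_decay_bound _ 0)
      ((ae_restrict_iff' measurableSet_Ioi).2 (ae_of_all _ fun y hy => ?_))
    · filter_upwards [self_mem_nhdsWithin] with δ hδ
      refine Continuous.aestronglyMeasurable (Continuous.sub (cu₁.mul ?_) ((cub.mul cu).mul ?_))
      · exact continuous_smooth hδ (F := fun k y => phase k y * iter₂ u k s y)
          (M := C * (C * Real.pi) * Real.pi) (by unfold Function.uncurry; fun_prop)
          fun k y => by rw [norm_phase_mul]; exact norm_iter₂_le hb k s y
      · exact continuous_smooth hδ (F := fun k y => iter₁ u k s y) cA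
          fun k y => norm_iter₁_le hb k s y
    · filter_upwards [self_mem_nhdsWithin] with δ hδ
      refine ae_of_all _ fun y => decay_sub
        (decay_mul (hb₁ y s) (norm_smooth_phase_iter₂_le hδ hu hb s y)) (decay_mul (bsq y) ?_)
      rw [hA]
      exact norm_smooth_phase_tail_le hδ cu (fun y => hb y s) 0 y
    · have h1 := (tendsto_smooth_phase_iter₂ hu hb s hy).const_mul (u₁ y s)
      have h2 := (tendsto_smooth_phase_tail cu (fun y => hb y s) (a := 0) (x := y)
        (by simpa using hy)).const_mul (conj (u y s) * u y s)
      simp_rw [hA]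
      simpa using h1.sub h2
  rw [integral_zero] at key
  refine key.congr' ?_
  filter_upwards [self_mem_nhdsWithin] with δ hδ
  rw [smooth_swap hδ (F := fun k y => phase k y * u₁ y s * iter₂ u k s y
      - conj (u y s) * u y s * iter₁ u k s y) (by unfold Function.uncurry; fun_prop)
    (integrable_decay_bound (C * (C * (C * Real.pi) * Real.pi) + C * C * (C * Real.pi)) 0)
    (ae_of_all _ fun y k => decay_sub (decay_mul (by rw [norm_phase_mul]; exact hb₁ y s)
      (norm_iter₂_le hb k s y)) (decay_mul (bsq y) (norm_iter₁_le hb k s y)))]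
  refine integral_congr_ae (ae_of_all _ fun y => ?_)
  have c1 : Continuous fun k => phase k y * iter₂ u k s y :=
    (by fun_prop : Continuous fun k => phase k y).mul
      (continuous_comp₃ (G := iter₂ u) (continuous_iter₂ hu hb) continuous_id
        continuous_const continuous_const)
  have c2 : Continuous fun k => iter₁ u k s y :=
    continuous_comp₃ (G := iter₁ u) (continuous_iter₁ hu hb) continuous_id
        continuous_const continuous_const
  have h1 := smooth_sub hδ (F := fun k => u₁ y s * (phase k y * iter₂ u k s y))
    (G := fun k => conj (u y s) * u y s * iter₁ u k s y) (by fun_prop) (by fun_prop)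
    (M := C * (C * (C * Real.pi) * Real.pi) * (1 + y ^ 2)⁻¹)
    (N := C * C * (C * Real.pi) * (1 + y ^ 2)⁻¹)
    (fun k => decay_mul (hb₁ y s) (by rw [norm_phase_mul]; exact norm_iter₂_le hb k s y))
    (fun k => decay_mul (bsq y) (norm_iter₁_le hb k s y))
  rw [smooth_const_mul, smooth_const_mul] at h1
  refine h1.symm.trans (congrArg (smooth δ) ?_)
  funext k; ring

end Iterated

/-! ### Calculus of smoothed limits, and the limit of the interior term. -/

/-- `F` is integrable against every Gaussian weight, with limit `L` as the weight tends to `1`. -/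
def HasSmoothLimit (F : ℝ → ℂ) (L : ℂ) : Prop :=
  (∀ δ > 0, Integrable fun k => gauss δ k * F k) ∧ Tendsto (fun δ => smooth δ F) (𝓝[>] 0) (𝓝 L)

namespace HasSmoothLimit

variable {F G : ℝ → ℂ} {L M : ℂ}

theorem add (hF : HasSmoothLimit F L) (hG : HasSmoothLimit G M) :
    HasSmoothLimit (fun k => F k + G k) (L + M) := by
  refine ⟨fun δ hδ => ?_, (hF.2.add hG.2).congr' ?_⟩
  · simp only [mul_add]
    exact (hF.1 δ hδ).add (hG.1 δ hδ)
  · filter_upwards [self_mem_nhdsWithin] with δ hδ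
    simp only [smooth, mul_add]
    exact (integral_add (hF.1 δ hδ) (hG.1 δ hδ)).symm

theorem const_mul (hF : HasSmoothLimit F L) (c : ℂ) :
    HasSmoothLimit (fun k => c * F k) (c * L) := by
  refine ⟨fun δ hδ => ?_, ?_⟩
  · simpa only [mul_left_comm] using (hF.1 δ hδ).const_mul c
  · simp_rw [smooth_const_mul]
    exact hF.2.const_mul c

theorem comp_neg (hF : HasSmoothLimit F L) : HasSmoothLimit (fun k => F (-k)) L := by
  refine ⟨fun δ hδ => ?_, ?_⟩
  · simpa only [gauss_neg] using (hF.1 δ hδ).comp_neg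
  · simp_rw [smooth_comp_neg]
    exact hF.2

theorem of_bounded (hF : Continuous F) {B : ℝ} (hB : ∀ k, ‖F k‖ ≤ B)
    (h : Tendsto (fun δ => smooth δ F) (𝓝[>] 0) (𝓝 L)) : HasSmoothLimit F L :=
  ⟨fun _ hδ => integrable_gauss_mul hδ hF hB, h⟩

theorem unique (hF : HasSmoothLimit F L) (hG : HasSmoothLimit F M) : L = M :=
  tendsto_nhds_unique hF.2 hG.2

end HasSmoothLimit

theorem hasSmoothLimit_iter₁ {u : ℝ → ℝ → ℂ} {C : ℝ} (hu : Continuous (Function.uncurry u))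
    (hb : ∀ x s, ‖u x s‖ ≤ C * (1 + x ^ 2)⁻¹) (s : ℝ) :
    HasSmoothLimit (fun k => iter₁ u k s 0) (Real.pi * u 0 s) := by
  have cu := continuous_comp₂ hu (f := fun z : ℝ => z) (g := fun _ => s)
    (by fun_prop) (by fun_prop)
  exact .of_bounded (continuous_comp₃ (G := iter₁ u) (continuous_iter₁ hu hb) continuous_id
    continuous_const continuous_const) (fun k => norm_iter₁_le hb k s 0)
    (tendsto_smooth_phase_integral cu fun y => hb y s)

theorem norm_smooth_iter₁_le {δ : ℝ} (hδ : 0 < δ) {u : ℝ → ℝ → ℂ} {C : ℝ}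
    (hu : Continuous (Function.uncurry u)) (hb : ∀ x s, ‖u x s‖ ≤ C * (1 + x ^ 2)⁻¹) (s : ℝ) :
    ‖smooth δ fun k => iter₁ u k s 0‖ ≤ 2 * Real.pi * C := by
  have cu := continuous_comp₂ hu (f := fun z : ℝ => z) (g := fun _ => s)
    (by fun_prop) (by fun_prop)
  have h := norm_smooth_phase_tail_le hδ cu (fun y => hb y s) 0 0
  simp only [phase_zero, one_mul] at h
  exact h

/-- Interchange of smoothing with an integral over `[0, s]`. -/
theorem integral_weight_interval_swap {w : ℝ → ℂ} (hw : Integrable w) {F : ℝ → ℝ → ℂ}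
    (hF : Continuous (Function.uncurry F)) {s B : ℝ} (hs : 0 ≤ s)
    (hB : ∀ a ∈ Icc 0 s, ∀ k, ‖F k a‖ ≤ B) :
    ∫ k, w k * ∫ a in (0 : ℝ)..s, F k a = ∫ a in (0 : ℝ)..s, ∫ k, w k * F k a := by
  simp only [intervalIntegral.integral_of_le hs]
  refine integral_weight_swap hw hF (b := fun _ => B) (integrable_const B) ?_
  exact (ae_restrict_iff' measurableSet_Ioc).2 (ae_of_all _ fun a ha => hB a ⟨ha.1.le, ha.2⟩)

namespace DecayingWave

variable {t : ℝ} {u u₁ u₂ z z₁ z₂ F : ℝ → ℝ → ℂ}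

/-- The representation of `iter₂` as a time integral of boundary values is used, so that the limit
involves only boundary traces. Each inner Fourier integral contributes `π` times a trace. -/
theorem hasSmoothLimit_iter₂ (ht : 0 ≤ t) (h : DecayingWave t u u₁ u₂ fun _ _ => 0) :
    HasSmoothLimit (fun k => iter₂ u k t 0) (∫ a in (0 : ℝ)..t,
      I * (conj (u₁ 0 a) * (Real.pi * u 0 a) - conj (u 0 a) * (Real.pi * u₁ 0 a))) := by
  obtain ⟨C, hb, hb₁, -⟩ := h.decay
  have c0 := continuous_conj_of h.continuous_trace
  have c1 := continuous_conj_of h.continuous_trace₁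
  have c0' := continuous_conj_of (h.continuous_trace.comp (continuous_snd (X := ℝ)))
  have c1' := continuous_conj_of (h.continuous_trace₁.comp (continuous_snd (X := ℝ)))
  have cA : Continuous fun z : ℝ × ℝ => iter₁ u z.1 z.2 0 :=
    continuous_comp₃ (G := iter₁ u) (continuous_iter₁ h.cont hb) continuous_fst
      continuous_snd continuous_const
  have cA₁ : Continuous fun z : ℝ × ℝ => iter₁ u₁ z.1 z.2 0 :=
    continuous_comp₃ (G := iter₁ u₁) (continuous_iter₁ h.cont₁ hb₁) continuous_fst
      continuous_snd continuous_const
  refine .of_bounded (continuous_comp₃ (G := iter₂ u) (continuous_iter₂ h.cont hb) continuous_id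
    continuous_const continuous_const) (fun k => norm_iter₂_le hb k t 0) ?_
  have e : ∀ k, iter₂ u k t 0 = ∫ a in (0 : ℝ)..t, I * (conj (u₁ 0 a) * iter₁ u k a 0
      - conj (u 0 a) * iter₁ u₁ k a 0) := fun k => h.iter₂_eq_integral_phase k ⟨ht, le_rfl⟩
  have bd : ∀ {X K : ℝ} {a b x y : ℂ}, ‖a‖ ≤ K → ‖b‖ ≤ K → ‖x‖ ≤ X → ‖y‖ ≤ X →
      ‖I * (a * x - b * y)‖ ≤ K * X + K * X := by
    intro X K a b x y ha hb hx hy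
    rw [norm_mul, Complex.norm_I, one_mul]
    refine norm_sub_le_of_le ?_ ?_ <;> rw [norm_mul]
    · exact mul_le_mul ha hx (norm_nonneg _) ((norm_nonneg _).trans ha)
    · exact mul_le_mul hb hy (norm_nonneg _) ((norm_nonneg _).trans ha)
  have n0 : ∀ a, ‖conj (u 0 a)‖ ≤ C := fun a => by
    rw [RCLike.norm_conj]; exact bound_of_decay (hb 0 a)
  have n1 : ∀ a, ‖conj (u₁ 0 a)‖ ≤ C := fun a => by
    rw [RCLike.norm_conj]; exact bound_of_decay (hb₁ 0 a)
  have key : Tendsto (fun δ => ∫ a in (0 : ℝ)..t,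
      I * (conj (u₁ 0 a) * smooth δ (fun k => iter₁ u k a 0)
        - conj (u 0 a) * smooth δ (fun k => iter₁ u₁ k a 0))) (𝓝[>] 0)
      (𝓝 (∫ a in (0 : ℝ)..t,
        I * (conj (u₁ 0 a) * (Real.pi * u 0 a) - conj (u 0 a) * (Real.pi * u₁ 0 a)))) := by
    refine intervalIntegral.tendsto_integral_filter_of_dominated_convergence
      (fun _ => C * (2 * Real.pi * C) + C * (2 * Real.pi * C)) ?_ ?_ (by simp)
      (ae_of_all _ fun a _ => ?_)
    · filter_upwards [self_mem_nhdsWithin] with δ hδ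
      have s0 : Continuous fun a => smooth δ (fun k => iter₁ u k a 0) :=
        continuous_smooth hδ (F := fun k a => iter₁ u k a 0) cA fun k a => norm_iter₁_le hb k a 0
      have s1 : Continuous fun a => smooth δ (fun k => iter₁ u₁ k a 0) :=
        continuous_smooth hδ (F := fun k a => iter₁ u₁ k a 0) cA₁
          fun k a => norm_iter₁_le hb₁ k a 0
      exact Continuous.aestronglyMeasurable (by fun_prop)
    · filter_upwards [self_mem_nhdsWithin] with δ hδ
      exact ae_of_all _ fun a _ => bd (n1 a) (n0 a) (norm_smooth_iter₁_le hδ h.cont hb a)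
        (norm_smooth_iter₁_le hδ h.cont₁ hb₁ a)
    · exact (((hasSmoothLimit_iter₁ h.cont hb a).2.const_mul _).sub
        ((hasSmoothLimit_iter₁ h.cont₁ hb₁ a).2.const_mul _)).const_mul I
  refine key.congr' ?_
  filter_upwards [self_mem_nhdsWithin] with δ hδ
  simp_rw [e]
  rw [smooth, integral_weight_interval_swap (integrable_gauss hδ)
    (F := fun k a => I * (conj (u₁ 0 a) * iter₁ u k a 0 - conj (u 0 a) * iter₁ u₁ k a 0))
    (by unfold Function.uncurry; simp only [Function.comp_def] at c0' c1'; fun_prop) ht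
    (fun a _ k => bd (n1 a) (n0 a) (norm_iter₁_le hb k a 0) (norm_iter₁_le hb₁ k a 0))]
  refine intervalIntegral.integral_congr fun a _ => ?_
  have cAa : Continuous fun k => iter₁ u k a 0 :=
    continuous_comp₃ (G := iter₁ u) (continuous_iter₁ h.cont hb) continuous_id
      continuous_const continuous_const
  have cA₁a : Continuous fun k => iter₁ u₁ k a 0 :=
    continuous_comp₃ (G := iter₁ u₁) (continuous_iter₁ h.cont₁ hb₁) continuous_id
      continuous_const continuous_const
  have i0 := (integrable_gauss_mul hδ cAa fun k => norm_iter₁_le hb k a 0).const_mul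
    (I * conj (u₁ 0 a))
  have i1 := (integrable_gauss_mul hδ cA₁a fun k => norm_iter₁_le hb₁ k a 0).const_mul
    (I * conj (u 0 a))
  have := integral_sub i0 i1
  rw [integral_const_mul, integral_const_mul] at this
  simp only [smooth]
  rw [mul_sub, ← mul_assoc, ← mul_assoc, ← this]
  congr 1; funext k; ring

theorem hasSmoothLimit_interiorTerm (ht : 0 ≤ t) (hu : DecayingWave t u u₁ u₂ fun _ _ => 0)
    (hz : DecayingWave t z z₁ z₂ F) (lam : ℂ) :
    HasSmoothLimit (interiorTerm lam u u₁ z₁ t) (I * (Real.pi * z₁ 0 t)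
      + lam * (I * u 0 t * (∫ a in (0 : ℝ)..t,
        I * (conj (u₁ 0 a) * (Real.pi * u 0 a) - conj (u 0 a) * (Real.pi * u₁ 0 a))) + I * 0)) := by
  obtain ⟨C, hb, hb₁, -⟩ := hu.decay
  obtain ⟨C', -, hb₁', -⟩ := hz.decay
  have cu : Continuous fun p : ℝ × ℝ => u p.2 t :=
    continuous_comp₂ hu.cont (by fun_prop) (by fun_prop)
  have cub := continuous_conj_of cu
  have cu₁ : Continuous fun p : ℝ × ℝ => u₁ p.2 t :=
    continuous_comp₂ hu.cont₁ (by fun_prop) (by fun_prop)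
  have cA : Continuous fun p : ℝ × ℝ => iter₁ u p.1 t p.2 :=
    continuous_comp₃ (G := iter₁ u) (continuous_iter₁ hu.cont hb) continuous_fst
      continuous_const continuous_snd
  have cB : Continuous fun p : ℝ × ℝ => iter₂ u p.1 t p.2 :=
    continuous_comp₃ (G := iter₂ u) (continuous_iter₂ hu.cont hb) continuous_fst
      continuous_const continuous_snd
  have bT := fun k y => decay_sub
    (decay_mul (a := phase k y * u₁ y t) (by rw [norm_phase_mul]; exact hb₁ y t)
      (norm_iter₂_le hb k t y))
    (decay_mul (decay_mul (a := conj (u y t)) (by rw [RCLike.norm_conj]; exact hb y t)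
      (bound_of_decay (hb y t))) (norm_iter₁_le hb k t y))
  have cT : Continuous fun k => ∫ y in Ioi 0, (phase k y * u₁ y t * iter₂ u k t y
      - conj (u y t) * u y t * iter₁ u k t y) :=
    (continuous_tail (P := ℝ) (f := fun k y => phase k y * u₁ y t * iter₂ u k t y
      - conj (u y t) * u y t * iter₁ u k t y)
      ((((Continuous.phase continuous_fst continuous_snd).mul cu₁).mul cB).sub
        ((cub.mul cu).mul cA)) bT).comp
      (by fun_prop : Continuous fun k : ℝ => (k, (0 : ℝ)))
  have hT := HasSmoothLimit.of_bounded cT (fun k => norm_tail_le (bT k) 0)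
    (tendsto_smooth_remainder hu.cont hu.cont₁ hb hb₁ t)
  exact ((hasSmoothLimit_iter₁ hz.cont₁ hb₁' t).const_mul I).add
    ((((hu.hasSmoothLimit_iter₂ ht).const_mul (I * u 0 t)).add (hT.const_mul I)).const_mul lam)

end DecayingWave

/-! ### Time kernels generated by weights in `k`. -/

/-- The kernel `∫ w(k) e^{-ik²τ} dk` generated by a spectral weight. -/
def propKernel (w : ℝ → ℂ) (τ : ℝ) : ℂ := ∫ k, w k * prop k τ

theorem continuous_propKernel {w : ℝ → ℂ} (hw : Integrable w) : Continuous (propKernel w) := by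
  refine continuous_of_dominated (bound := fun k => ‖w k‖)
    (fun τ => hw.aestronglyMeasurable.mul
      (by fun_prop : Continuous fun k => prop k τ).aestronglyMeasurable)
    (fun τ => ae_of_all _ fun k => ?_) hw.norm (ae_of_all _ fun k => by fun_prop)
  rw [norm_mul, norm_prop, mul_one]

/-- The middle level of the nested boundary integrals. -/
def mid (k : ℝ) (g h : ℝ → ℂ) (s : ℝ) : ℂ := ∫ a in (0 : ℝ)..s, conj (g a) * duh k h a

theorem continuous_duh₂ {h : ℝ → ℂ} (hh : Continuous h) :
    Continuous (Function.uncurry fun k s => duh k h s) :=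
  continuous_duh (g := fun _ => h) (hh.comp continuous_snd)

theorem continuous_mid {g h : ℝ → ℂ} (hg : Continuous g) (hh : Continuous h) :
    Continuous (Function.uncurry fun k s => mid k g h s) := by
  refine intervalIntegral.continuous_parametric_intervalIntegral_of_continuous
    (f := fun (z : ℝ × ℝ) a => conj (g a) * duh z.1 h a) ?_ continuous_snd
  exact (continuous_conj_of (hg.comp continuous_snd)).mul
    (continuous_comp₂ (X := (ℝ × ℝ) × ℝ) (u := fun k s => duh k h s) (continuous_duh₂ hh)
      (f := fun z => z.1.1) (g := fun z => z.2) (by fun_prop) (by fun_prop))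

theorem norm_duh_le {h : ℝ → ℝ → ℂ} {M s : ℝ} (hs : 0 ≤ s) (k : ℝ)
    (hM : ∀ a ∈ Icc 0 s, ‖h k a‖ ≤ M) : ‖duh k (h k) s‖ ≤ M * s := by
  have := intervalIntegral.norm_integral_le_of_norm_le_const (a := 0) (b := s) (C := M)
    (f := fun a => prop k (s - a) * h k a) (fun a ha => by
      rw [uIoc_of_le hs] at ha
      rw [norm_mul, norm_prop, one_mul]; exact hM a ⟨ha.1.le, ha.2⟩)
  rwa [sub_zero, abs_of_nonneg hs] at this

theorem norm_mid_le {g h : ℝ → ℂ} {A B t s : ℝ} (hA : ∀ a, ‖g a‖ ≤ A) (hB : ∀ a, ‖h a‖ ≤ B)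
    (hs : s ∈ Icc 0 t) (k : ℝ) : ‖mid k g h s‖ ≤ A * (B * t) * t := by
  have hA0 : 0 ≤ A := (norm_nonneg _).trans (hA 0)
  have hB0 : 0 ≤ B := (norm_nonneg _).trans (hB 0)
  have ht : 0 ≤ t := hs.1.trans hs.2
  have := intervalIntegral.norm_integral_le_of_norm_le_const (a := 0) (b := s) (C := A * (B * t))
    (f := fun a => conj (g a) * duh k h a) (fun a ha => by
      rw [uIoc_of_le hs.1] at ha
      rw [norm_mul, RCLike.norm_conj]
      refine mul_le_mul (hA a) ?_ (norm_nonneg _) hA0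
      refine (norm_duh_le (h := fun _ => h) ha.1.le k fun a _ => hB a).trans ?_
      exact mul_le_mul_of_nonneg_left (ha.2.trans hs.2) hB0)
  rw [sub_zero, abs_of_nonneg hs.1] at this
  exact this.trans (mul_le_mul_of_nonneg_left hs.2 (by positivity))

section Weighted

variable {w : ℝ → ℂ} {f g h : ℝ → ℂ} {A B C t s : ℝ}

theorem integral_weight_const_mul (w : ℝ → ℂ) (c : ℂ) (F : ℝ → ℂ) :
    ∫ k, w k * (c * F k) = c * ∫ k, w k * F k := by
  rw [← integral_const_mul]; congr 1; funext k; ring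

/-- The propagators multiply to one propagator at the summed time lag, so Fubini leaves a single
kernel. The extra lag `τ` lets the next nesting level reuse the formula. -/
theorem weight_prop_mul_duh (hw : Integrable w) (hh : Continuous h) (hB : ∀ a, ‖h a‖ ≤ B)
    (hs : 0 ≤ s) (τ : ℝ) : ∫ k, w k * (prop k τ * duh k h s)
      = ∫ r in (0 : ℝ)..s, h r * propKernel w (τ + (s - r)) := by
  have e : ∀ k, prop k τ * duh k h s = ∫ r in (0 : ℝ)..s, h r * prop k (τ + (s - r)) := fun k => by
    rw [duh, ← intervalIntegral.integral_const_mul]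
    congr 1; funext r; rw [prop_add k τ]; ring
  simp_rw [e]
  rw [integral_weight_interval_swap hw (F := fun k r => h r * prop k (τ + (s - r)))
    (by unfold Function.uncurry; fun_prop) hs
    (fun r _ k => by rw [norm_mul, norm_prop, mul_one]; exact hB r)]
  simp_rw [integral_weight_const_mul]
  rfl

theorem weight_prop_mul_mid (hw : Integrable w) (hg : Continuous g) (hh : Continuous h)
    (hA : ∀ a, ‖g a‖ ≤ A) (hB : ∀ a, ‖h a‖ ≤ B) (hs : 0 ≤ s) (τ : ℝ) :
    ∫ k, w k * (prop k τ * mid k g h s) = ∫ a in (0 : ℝ)..s, conj (g a) *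
      ∫ r in (0 : ℝ)..a, h r * propKernel w (τ + (a - r)) := by
  have hA0 : 0 ≤ A := (norm_nonneg _).trans (hA 0)
  have hB0 : 0 ≤ B := (norm_nonneg _).trans (hB 0)
  have e : ∀ k, prop k τ * mid k g h s
      = ∫ a in (0 : ℝ)..s, conj (g a) * (prop k τ * duh k h a) := fun k => by
    rw [mid, ← intervalIntegral.integral_const_mul]
    congr 1; funext r; ring
  have cd := continuous_duh₂ hh
  have cg := continuous_conj_of (hg.comp (continuous_snd (X := ℝ)))
  simp_rw [e]
  rw [integral_weight_interval_swap hw (F := fun k a => conj (g a) * (prop k τ * duh k h a))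
    (cg.mul ((by fun_prop : Continuous fun z : ℝ × ℝ => prop z.1 τ).mul cd)) hs
    (B := A * (B * s)) (fun a ha k => by
      rw [norm_mul, norm_mul, RCLike.norm_conj, norm_prop, one_mul]
      refine mul_le_mul (hA a) ?_ (norm_nonneg _) hA0
      refine (norm_duh_le (h := fun _ => h) ha.1 k fun a _ => hB a).trans ?_
      exact mul_le_mul_of_nonneg_left ha.2 hB0)]
  refine intervalIntegral.integral_congr fun a ha => ?_
  rw [uIcc_of_le hs] at ha
  simp only [integral_weight_const_mul]
  rw [weight_prop_mul_duh hw hh hB ha.1]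

theorem weight_duh_mul_mid (hw : Integrable w) (hf : Continuous f) (hg : Continuous g)
    (hh : Continuous h) (hC : ∀ a, ‖f a‖ ≤ C) (hA : ∀ a, ‖g a‖ ≤ A) (hB : ∀ a, ‖h a‖ ≤ B)
    (ht : 0 ≤ t) :
    ∫ k, w k * duh k (fun s => f s * mid k g h s) t
      = ∫ s in (0 : ℝ)..t, f s * ∫ a in (0 : ℝ)..s, conj (g a) *
        ∫ r in (0 : ℝ)..a, h r * propKernel w ((t - s) + (a - r)) := by
  have hC0 : 0 ≤ C := (norm_nonneg _).trans (hC 0)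
  have e : ∀ k, duh k (fun s => f s * mid k g h s) t
      = ∫ s in (0 : ℝ)..t, f s * (prop k (t - s) * mid k g h s) := fun k => by
    rw [duh]; congr 1; funext r; ring
  have cm := continuous_mid hg hh
  simp_rw [e]
  rw [integral_weight_interval_swap hw (F := fun k s => f s * (prop k (t - s) * mid k g h s))
    ((hf.comp continuous_snd).mul
      ((by fun_prop : Continuous fun z : ℝ × ℝ => prop z.1 (t - z.2)).mul cm)) ht
    (B := C * (A * (B * t) * t)) (fun a ha k => by
      rw [norm_mul, norm_mul, norm_prop, one_mul]
      exact mul_le_mul (hC a) (norm_mid_le hA hB ha k) (norm_nonneg _) hC0)]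
  refine intervalIntegral.integral_congr fun a ha => ?_
  rw [uIcc_of_le ht] at ha
  simp only [integral_weight_const_mul]
  rw [weight_prop_mul_mid hw hg hh hA hB ha.1]

theorem weight_duh_mul_duh (hw : Integrable w) (hf : Continuous f)
    (hh : Continuous h) (hC : ∀ a, ‖f a‖ ≤ C) (hB : ∀ a, ‖h a‖ ≤ B) (ht : 0 ≤ t) :
    ∫ k, w k * duh k (fun s => f s * duh k h s) t
      = ∫ s in (0 : ℝ)..t, f s * ∫ r in (0 : ℝ)..s, h r * propKernel w ((t - s) + (s - r)) := by
  have hC0 : 0 ≤ C := (norm_nonneg _).trans (hC 0)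
  have hB0 : 0 ≤ B := (norm_nonneg _).trans (hB 0)
  have e : ∀ k, duh k (fun s => f s * duh k h s) t
      = ∫ s in (0 : ℝ)..t, f s * (prop k (t - s) * duh k h s) := fun k => by
    rw [duh]; congr 1; funext r; ring
  have cm := continuous_duh₂ hh
  simp_rw [e]
  rw [integral_weight_interval_swap hw (F := fun k s => f s * (prop k (t - s) * duh k h s))
    ((hf.comp continuous_snd).mul
      ((by fun_prop : Continuous fun z : ℝ × ℝ => prop z.1 (t - z.2)).mul cm)) ht
    (B := C * (B * t)) (fun a ha k => by
      rw [norm_mul, norm_mul, norm_prop, one_mul]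
      refine mul_le_mul (hC a) ?_ (norm_nonneg _) hC0
      refine (norm_duh_le (h := fun _ => h) ha.1 k fun a _ => hB a).trans ?_
      exact mul_le_mul_of_nonneg_left ha.2 hB0)]
  refine intervalIntegral.integral_congr fun a ha => ?_
  rw [uIcc_of_le ht] at ha
  simp only [integral_weight_const_mul]
  rw [weight_prop_mul_duh hw hh hB ha.1]

end Weighted

/-! Gaussian evaluation of the kernels. -/

theorem gauss_mul_prop (δ τ k : ℝ) :
    gauss δ k * prop k τ = Complex.exp (-((δ : ℂ) + I * τ) * (k : ℂ) ^ 2) := by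
  rw [gauss, prop, ← Complex.exp_add]; ring_nf

theorem re_add_I_mul (δ τ : ℝ) : ((δ : ℂ) + I * τ).re = δ := by simp

theorem propKernel_gauss {δ : ℝ} (hδ : 0 < δ) (τ : ℝ) :
    propKernel (gauss δ) τ = (Real.pi / ((δ : ℂ) + I * τ)) ^ (1 / 2 : ℂ) := by
  simp only [propKernel, gauss_mul_prop]
  exact integral_gaussian_complex (by rwa [re_add_I_mul])

theorem integrable_sq_mul_cexp {b : ℂ} (hb : 0 < b.re) :
    Integrable fun k : ℝ => (k : ℂ) ^ 2 * Complex.exp (-b * (k : ℂ) ^ 2) := by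
  have h := integrable_rpow_mul_exp_neg_mul_sq hb (s := 2) (by norm_num)
  refine h.mono' (by fun_prop) (ae_of_all _ fun k => ?_)
  rw [norm_mul, norm_cexp_neg_mul_sq, Real.rpow_two, norm_pow, Complex.norm_real, Real.norm_eq_abs,
    sq_abs]

/-- The derivative of `k e^{-bk²}` integrates to zero over the line, which reduces the second moment
to the Gaussian integral. -/
theorem integral_sq_mul_cexp {b : ℂ} (hb : 0 < b.re) :
    ∫ k : ℝ, (k : ℂ) ^ 2 * Complex.exp (-b * (k : ℂ) ^ 2)
      = (2 * b)⁻¹ * (Real.pi / b) ^ (1 / 2 : ℂ) := by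
  have hb0 : b ≠ 0 := fun h => by simp [h] at hb
  have hd : ∀ k : ℝ, HasDerivAt (fun k : ℝ => (k : ℂ) * Complex.exp (-b * (k : ℂ) ^ 2))
      (Complex.exp (-b * (k : ℂ) ^ 2) - 2 * b * ((k : ℂ) ^ 2 * Complex.exp (-b * (k : ℂ) ^ 2)))
      k := fun k => by
    have h1 : HasDerivAt (fun k : ℝ => (k : ℂ)) 1 k := Complex.ofRealCLM.hasDerivAt
    refine (h1.mul (((h1.pow 2).const_mul (-b)).cexp)).congr_deriv ?_
    simp only [Pi.pow_apply]
    push_cast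
    ring
  have i1 := integrable_cexp_neg_mul_sq hb
  have i2 := (integrable_sq_mul_cexp hb).const_mul (2 * b)
  have h0 := integral_eq_zero_of_hasDerivAt_of_integrable hd (i1.sub i2)
    (integrable_mul_cexp_neg_mul_sq hb)
  rw [integral_sub i1 i2, integral_const_mul, integral_gaussian_complex hb, sub_eq_zero] at h0
  rw [h0, inv_mul_cancel_left₀ (by simpa using hb0)]

/-- The weight `k² e^{-δk²}`. -/
def sqGauss (δ k : ℝ) : ℂ := gauss δ k * (k : ℂ) ^ 2

theorem integrable_sqGauss {δ : ℝ} (hδ : 0 < δ) : Integrable (sqGauss δ) := by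
  have := integrable_sq_mul_cexp (b := (δ : ℂ)) (by simpa using hδ)
  refine this.congr (ae_of_all _ fun k => ?_)
  simp only [sqGauss, gauss]; ring

theorem propKernel_sqGauss {δ : ℝ} (hδ : 0 < δ) (τ : ℝ) :
    propKernel (sqGauss δ) τ
      = (2 * ((δ : ℂ) + I * τ))⁻¹ * (Real.pi / ((δ : ℂ) + I * τ)) ^ (1 / 2 : ℂ) := by
  rw [← integral_sq_mul_cexp (by rwa [re_add_I_mul]), propKernel]
  congr 1; funext k
  rw [← gauss_mul_prop, sqGauss]; ring

theorem le_norm_add_I_mul (δ τ : ℝ) : τ ≤ ‖(δ : ℂ) + I * τ‖ := by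
  have := Complex.abs_im_le_norm ((δ : ℂ) + I * τ)
  simp only [Complex.add_im, Complex.ofReal_im, Complex.mul_im, Complex.I_re, Complex.I_im,
    Complex.ofReal_re, zero_mul, one_mul, zero_add] at this
  exact (le_abs_self τ).trans this

/-- Since `|δ + iτ| ≥ τ`, the bound does not depend on `δ`; this supplies the majorants for `δ → 0`.
-/
theorem norm_sqrt_div_le (δ : ℝ) {τ : ℝ} (hτ : 0 < τ) :
    ‖((Real.pi : ℂ) / ((δ : ℂ) + I * τ)) ^ (1 / 2 : ℂ)‖ ≤ √Real.pi * τ ^ (-(1 / 2) : ℝ) := by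
  have e : (1 / 2 : ℂ) = ((1 / 2 : ℝ) : ℂ) := by push_cast; rfl
  rw [e, Complex.norm_cpow_real, norm_div, Complex.norm_real, Real.norm_of_nonneg Real.pi_pos.le,
    Real.rpow_neg hτ.le, ← Real.sqrt_eq_rpow, ← Real.sqrt_eq_rpow, ← div_eq_mul_inv,
    ← Real.sqrt_div Real.pi_pos.le]
  exact Real.sqrt_le_sqrt (div_le_div_of_nonneg_left Real.pi_pos.le hτ (le_norm_add_I_mul δ τ))

theorem norm_propKernel_gauss_le {δ τ : ℝ} (hδ : 0 < δ) (hτ : 0 < τ) :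
    ‖propKernel (gauss δ) τ‖ ≤ √Real.pi * τ ^ (-(1 / 2) : ℝ) := by
  rw [propKernel_gauss hδ]; exact norm_sqrt_div_le δ hτ

theorem norm_propKernel_sqGauss_le {δ τ : ℝ} (hδ : 0 < δ) (hτ : 0 < τ) :
    ‖propKernel (sqGauss δ) τ‖ ≤ √Real.pi * τ ^ (-(3 / 2) : ℝ) := by
  rw [propKernel_sqGauss hδ, norm_mul, norm_inv, norm_mul]
  have h1 : (‖(2 : ℂ)‖ * ‖(δ : ℂ) + I * τ‖)⁻¹ ≤ τ⁻¹ := by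
    refine inv_anti₀ hτ ?_
    have := le_norm_add_I_mul δ τ
    simp only [Complex.norm_ofNat]; linarith
  have h2 : τ ^ (-(3 / 2) : ℝ) = τ⁻¹ * τ ^ (-(1 / 2) : ℝ) := by
    rw [← Real.rpow_neg_one, ← Real.rpow_add hτ]; norm_num
  rw [h2, mul_left_comm]
  exact mul_le_mul h1 (norm_sqrt_div_le δ hτ) (norm_nonneg _) (inv_nonneg.2 hτ.le)

theorem pi_div_I_mul {τ : ℝ} (hτ : 0 < τ) :
    (Real.pi : ℂ) / (I * τ) = ((Real.pi / τ : ℝ) : ℂ) * (-I) := by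
  have : (τ : ℂ) ≠ 0 := by exact_mod_cast hτ.ne'
  push_cast
  field_simp
  rw [Complex.I_sq]; ring

/-- Here the constant `c` arises: `1/i = -i`, whose principal square root is `e^{-iπ/4}`. -/
theorem sqrt_div_I_mul {τ : ℝ} (hτ : 0 < τ) :
    ((Real.pi : ℂ) / (I * τ)) ^ (1 / 2 : ℂ) = 2 * c / ((√τ : ℝ) : ℂ) := by
  have hr : 0 < Real.pi / τ := div_pos Real.pi_pos hτ
  have h1 : ((√(Real.pi / τ) : ℝ) : ℂ) = Complex.exp (Real.log (Real.pi / τ) * (1 / 2)) := by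
    rw [Real.sqrt_eq_rpow, Real.rpow_def_of_pos hr]; push_cast; rfl
  rw [pi_div_I_mul hτ, Complex.cpow_def_of_ne_zero (by
    refine mul_ne_zero ?_ (by simp)
    exact_mod_cast hr.ne'), Complex.log_ofReal_mul hr (by simp), Complex.log_neg_I, add_mul,
    Complex.exp_add, ← h1, c, Real.sqrt_div Real.pi_pos.le]
  have h2 : -((Real.pi : ℂ) / 2) * I * (1 / 2) = -(I * Real.pi / 4) := by ring
  push_cast
  rw [h2]; ring

theorem tendsto_add_I_mul (τ : ℝ) :
    Tendsto (fun δ : ℝ => (δ : ℂ) + I * τ) (𝓝[>] 0) (𝓝 (I * τ)) := by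
  have h : Continuous fun δ : ℝ => (δ : ℂ) + I * τ := by fun_prop
  simpa using (h.tendsto 0).mono_left (nhdsWithin_le_nhds (s := Ioi 0))

theorem tendsto_sqrt_div {τ : ℝ} (hτ : 0 < τ) :
    Tendsto (fun δ : ℝ => ((Real.pi : ℂ) / ((δ : ℂ) + I * τ)) ^ (1 / 2 : ℂ)) (𝓝[>] 0)
      (𝓝 (2 * c / ((√τ : ℝ) : ℂ))) := by
  rw [← sqrt_div_I_mul hτ]
  have hne : I * (τ : ℂ) ≠ 0 := mul_ne_zero Complex.I_ne_zero (by exact_mod_cast hτ.ne')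
  refine ((continuousAt_cpow_const ?_).tendsto).comp
    (tendsto_const_nhds.div (tendsto_add_I_mul τ) hne)
  rw [pi_div_I_mul hτ]
  right
  have : 0 < Real.pi / τ := div_pos Real.pi_pos hτ
  simp [Real.pi_pos.ne', hτ.ne']

/-! ### Passing to the limit in singular time kernels. -/

/-- A family of kernels on `(0, ∞)` converging pointwise under a power-law majorant. -/
structure KernelLimit (K : ℝ → ℝ → ℂ) (K₀ : ℝ → ℂ) (A p : ℝ) : Prop where
  cont : ∀ δ > 0, Continuous (K δ)
  nonneg : 0 ≤ A
  bound : ∀ δ > 0, ∀ τ > 0, ‖K δ τ‖ ≤ A * τ ^ p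
  tendsto : ∀ τ > 0, Tendsto (fun δ => K δ τ) (𝓝[>] 0) (𝓝 (K₀ τ))

theorem kernelLimit_gauss : KernelLimit (fun δ => propKernel (gauss δ))
    (fun τ => 2 * c / ((√τ : ℝ) : ℂ)) (√Real.pi) (-(1 / 2)) where
  cont δ hδ := continuous_propKernel (integrable_gauss hδ)
  nonneg := Real.sqrt_nonneg _
  bound δ hδ τ hτ := norm_propKernel_gauss_le hδ hτ
  tendsto τ hτ := by
    refine (tendsto_sqrt_div hτ).congr' ?_
    filter_upwards [self_mem_nhdsWithin] with δ hδ
    exact (propKernel_gauss hδ τ).symm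

theorem kernelLimit_sqGauss : KernelLimit (fun δ => propKernel (sqGauss δ))
    (fun τ => -I * c / ((τ ^ (3 / 2 : ℝ) : ℝ) : ℂ)) (√Real.pi) (-(3 / 2)) where
  cont δ hδ := continuous_propKernel (integrable_sqGauss hδ)
  nonneg := Real.sqrt_nonneg _
  bound δ hδ τ hτ := norm_propKernel_sqGauss_le hδ hτ
  tendsto τ hτ := by
    have hne : 2 * (I * (τ : ℂ)) ≠ 0 :=
      mul_ne_zero two_ne_zero (mul_ne_zero Complex.I_ne_zero (by exact_mod_cast hτ.ne'))
    have h := ((tendsto_const_nhds (x := (2 : ℂ))).mul (tendsto_add_I_mul τ)).inv₀ hne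
    have h2 := h.mul (tendsto_sqrt_div hτ)
    have e : (2 * (I * (τ : ℂ)))⁻¹ * (2 * c / ((√τ : ℝ) : ℂ))
        = -I * c / ((τ ^ (3 / 2 : ℝ) : ℝ) : ℂ) := by
      have e1 : τ ^ (3 / 2 : ℝ) = τ * √τ := by
        rw [Real.sqrt_eq_rpow, ← Real.rpow_one_add' hτ.le (by norm_num)]; norm_num
      have h1 : (τ : ℂ) ≠ 0 := by exact_mod_cast hτ.ne'
      have h2 : ((√τ : ℝ) : ℂ) ≠ 0 := by exact_mod_cast (Real.sqrt_pos.2 hτ).ne'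
      rw [e1]
      push_cast
      have hI : (I : ℂ) ≠ 0 := Complex.I_ne_zero
      field_simp
      rw [Complex.I_sq]; ring
    rw [e] at h2
    refine h2.congr' ?_
    filter_upwards [self_mem_nhdsWithin] with δ hδ
    exact (propKernel_sqGauss hδ τ).symm

theorem intervalIntegrable_rpow_shift {τ s p : ℝ} (h : -1 < p ∨ 0 < τ) (hs : 0 ≤ s) :
    IntervalIntegrable (fun r => (τ + (s - r)) ^ p) volume 0 s := by
  have h1 : IntervalIntegrable (fun x : ℝ => x ^ p) volume (τ + s) τ := by
    rcases h with h | h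
    · exact intervalIntegral.intervalIntegrable_rpow' h
    · refine intervalIntegral.intervalIntegrable_rpow (Or.inr ?_)
      rw [uIcc_of_ge (by linarith)]
      exact fun h0 => h.not_ge h0.1
  have h2 := h1.comp_sub_left (τ + s)
  rw [sub_self, add_sub_cancel_left] at h2
  simpa only [add_sub_assoc] using h2

theorem integral_rpow_shift (τ s p : ℝ) :
    ∫ r in (0 : ℝ)..s, (τ + (s - r)) ^ p = ∫ x in τ..(τ + s), x ^ p := by
  have := intervalIntegral.integral_comp_sub_left (a := 0) (b := s) (fun x : ℝ => x ^ p) (τ + s)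
  rw [sub_zero, add_sub_cancel_right] at this
  simpa only [add_sub_assoc] using this

theorem integral_rpow_neg_half_le {τ s : ℝ} (hτ : 0 ≤ τ) :
    ∫ r in (0 : ℝ)..s, (τ + (s - r)) ^ (-(1 / 2) : ℝ) ≤ 2 * (τ + s) ^ (1 / 2 : ℝ) := by
  rw [integral_rpow_shift, integral_rpow (Or.inl (by norm_num))]
  have h1 : (-(1 / 2) + 1 : ℝ) = 1 / 2 := by norm_num
  rw [h1]
  have := Real.rpow_nonneg hτ (1 / 2)
  linarith

/-- Integrating the non-integrable power `-3/2` away from the origin leaves the integrable power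
`-1/2` of the lag, uniformly in `s`. This makes the triple integrals converge. -/
theorem integral_rpow_neg_three_halves_le {τ s : ℝ} (hτ : 0 < τ) (hs : 0 ≤ s) :
    ∫ r in (0 : ℝ)..s, (τ + (s - r)) ^ (-(3 / 2) : ℝ) ≤ 2 * τ ^ (-(1 / 2) : ℝ) := by
  rw [integral_rpow_shift, integral_rpow (Or.inr ⟨by norm_num, by
    rw [uIcc_of_le (by linarith)]; exact fun h0 => hτ.not_ge h0.1⟩)]
  have h1 : (-(3 / 2) + 1 : ℝ) = -(1 / 2) := by norm_num
  rw [h1]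
  have := Real.rpow_nonneg (by linarith : 0 ≤ τ + s) (-(1 / 2))
  linarith

namespace KernelLimit

variable {K : ℝ → ℝ → ℂ} {K₀ : ℝ → ℂ} {A p : ℝ}

theorem continuous_inner (hK : KernelLimit K K₀ A p) {δ : ℝ} (hδ : 0 < δ) {h : ℝ → ℂ}
    (hh : Continuous h) :
    Continuous fun z : ℝ × ℝ => ∫ r in (0 : ℝ)..z.2, h r * K δ (z.1 + (z.2 - r)) := by
  have := hK.cont δ hδ
  exact intervalIntegral.continuous_parametric_intervalIntegral_of_continuous
    (f := fun (z : ℝ × ℝ) r => h r * K δ (z.1 + (z.2 - r)))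
    (by unfold Function.uncurry; fun_prop) continuous_snd

theorem ae_norm_le (hK : KernelLimit K K₀ A p) {δ : ℝ} (hδ : 0 < δ) {h : ℝ → ℂ} {B τ s : ℝ}
    (hB : ∀ a, ‖h a‖ ≤ B) (hτ : 0 ≤ τ) (hs : 0 ≤ s) :
    ∀ᵐ r, r ∈ uIoc 0 s → ‖h r * K δ (τ + (s - r))‖ ≤ B * A * (τ + (s - r)) ^ p := by
  -- When `τ = 0` the lag vanishes at `r = s`, where the kernel bound is not available; this null
  -- set is discarded.
  filter_upwards [compl_mem_ae_iff.2 (measure_singleton s)] with r (hr : r ≠ s) hrs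
  rw [uIoc_of_le hs] at hrs
  have hlt : r < s := lt_of_le_of_ne hrs.2 hr
  rw [norm_mul, mul_assoc]
  exact mul_le_mul (hB r) (hK.bound δ hδ _ (by linarith)) (norm_nonneg _)
    ((norm_nonneg _).trans (hB 0))

theorem tendsto_inner (hK : KernelLimit K K₀ A p) {h : ℝ → ℂ} (hh : Continuous h) {B τ s : ℝ}
    (hB : ∀ a, ‖h a‖ ≤ B) (hτ : 0 ≤ τ) (hs : 0 ≤ s) (hp : -1 < p ∨ 0 < τ) :
    Tendsto (fun δ => ∫ r in (0 : ℝ)..s, h r * K δ (τ + (s - r))) (𝓝[>] 0)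
      (𝓝 (∫ r in (0 : ℝ)..s, h r * K₀ (τ + (s - r)))) := by
  refine intervalIntegral.tendsto_integral_filter_of_dominated_convergence
    (fun r => B * A * (τ + (s - r)) ^ p) ?_ ?_
    ((intervalIntegrable_rpow_shift hp hs).const_mul _) ?_
  · filter_upwards [self_mem_nhdsWithin] with δ hδ
    have := hK.cont δ hδ
    exact Continuous.aestronglyMeasurable (by fun_prop)
  · filter_upwards [self_mem_nhdsWithin] with δ hδ
    exact hK.ae_norm_le hδ hB hτ hs
  · filter_upwards [compl_mem_ae_iff.2 (measure_singleton s)] with r (hr : r ≠ s) hrs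
    rw [uIoc_of_le hs] at hrs
    have hlt : r < s := lt_of_le_of_ne hrs.2 hr
    exact (hK.tendsto _ (by linarith)).const_mul _

theorem norm_inner_le (hK : KernelLimit K K₀ A p) {δ : ℝ} (hδ : 0 < δ) {h : ℝ → ℂ}
    {B τ s : ℝ} (hB : ∀ a, ‖h a‖ ≤ B) (hτ : 0 ≤ τ) (hs : 0 ≤ s) (hp : -1 < p ∨ 0 < τ) :
    ‖∫ r in (0 : ℝ)..s, h r * K δ (τ + (s - r))‖
      ≤ B * A * ∫ r in (0 : ℝ)..s, (τ + (s - r)) ^ p := by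
  rw [← intervalIntegral.integral_const_mul]
  refine intervalIntegral.norm_integral_le_of_norm_le hs ?_
    ((intervalIntegrable_rpow_shift hp hs).const_mul _)
  have := hK.ae_norm_le hδ hB hτ hs
  rwa [uIoc_of_le hs] at this

end KernelLimit

theorem prop_zero_mul_duh (k : ℝ) (h : ℝ → ℂ) (s : ℝ) : prop k 0 * duh k h s = duh k h s := by
  rw [prop_zero, one_mul]

section Limits

variable {f g h : ℝ → ℂ} {A B C t : ℝ}

theorem continuous_duh_left {g : ℝ → ℝ → ℂ} (hg : Continuous (Function.uncurry g)) (t : ℝ) :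
    Continuous fun k => duh k (g k) t := by
  have h : Continuous (Function.uncurry fun k s => duh k (g k) s) := continuous_duh hg
  exact h.uncurry_right t

theorem hasSmoothLimit_duh (hh : Continuous h) (hB : ∀ a, ‖h a‖ ≤ B) (ht : 0 ≤ t) :
    HasSmoothLimit (fun k => duh k h t)
      (∫ r in (0 : ℝ)..t, h r * (2 * c / ((√(t - r) : ℝ) : ℂ))) := by
  refine .of_bounded (continuous_duh_left (g := fun _ => h) (hh.comp continuous_snd) t)
    (fun k => norm_duh_le (h := fun _ => h) ht k fun a _ => hB a) ?_
  have key := kernelLimit_gauss.tendsto_inner hh hB le_rfl ht (Or.inl (by norm_num))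
  simp only [zero_add] at key
  refine key.congr' ?_
  filter_upwards [self_mem_nhdsWithin] with δ hδ
  have e := weight_prop_mul_duh (integrable_gauss hδ) hh hB ht 0
  simp only [prop_zero_mul_duh, zero_add] at e
  exact e.symm

theorem hasSmoothLimit_duh_mul_duh (hf : Continuous f) (hh : Continuous h) (hC : ∀ a, ‖f a‖ ≤ C)
    (hB : ∀ a, ‖h a‖ ≤ B) (ht : 0 ≤ t) :
    HasSmoothLimit (fun k => duh k (fun s => f s * duh k h s) t)
      (∫ s in (0 : ℝ)..t, f s *
        ∫ r in (0 : ℝ)..s, h r * (2 * c / ((√((t - s) + (s - r)) : ℝ) : ℂ))) := by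
  have hC0 : 0 ≤ C := (norm_nonneg _).trans (hC 0)
  have hB0 : 0 ≤ B := (norm_nonneg _).trans (hB 0)
  have cF : Continuous (Function.uncurry fun k s => f s * duh k h s) :=
    (hf.comp continuous_snd).mul (continuous_duh₂ hh)
  refine .of_bounded (B := C * (B * t) * t)
    (continuous_duh_left (g := fun k s => f s * duh k h s) cF t)
    (fun k => norm_duh_le (h := fun k s => f s * duh k h s) ht k fun a ha => by
      rw [norm_mul]
      refine mul_le_mul (hC a) ?_ (norm_nonneg _) hC0
      refine (norm_duh_le (h := fun _ => h) ha.1 k fun a _ => hB a).trans ?_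
      exact mul_le_mul_of_nonneg_left ha.2 hB0) ?_
  have key : Tendsto (fun δ => ∫ s in (0 : ℝ)..t, f s *
      ∫ r in (0 : ℝ)..s, h r * propKernel (gauss δ) ((t - s) + (s - r))) (𝓝[>] 0)
      (𝓝 (∫ s in (0 : ℝ)..t, f s *
        ∫ r in (0 : ℝ)..s, h r * (2 * c / ((√((t - s) + (s - r)) : ℝ) : ℂ)))) := by
    refine intervalIntegral.tendsto_integral_filter_of_dominated_convergence
      (fun _ => C * (B * √Real.pi * (2 * t ^ (1 / 2 : ℝ)))) ?_ ?_ (by simp)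
      (ae_of_all _ fun s hs => ?_)
    · filter_upwards [self_mem_nhdsWithin] with δ hδ
      have c1 : Continuous fun s =>
          ∫ r in (0 : ℝ)..s, h r * propKernel (gauss δ) ((t - s) + (s - r)) :=
        (kernelLimit_gauss.continuous_inner hδ hh).comp
          (by fun_prop : Continuous fun s : ℝ => (t - s, s))
      exact (hf.mul c1).aestronglyMeasurable
    · filter_upwards [self_mem_nhdsWithin] with δ hδ
      refine ae_of_all _ fun s hs => ?_
      rw [uIoc_of_le ht] at hs
      have hts : 0 ≤ t - s := sub_nonneg.2 hs.2
      rw [norm_mul]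
      refine mul_le_mul (hC s) ?_ (norm_nonneg _) hC0
      refine (kernelLimit_gauss.norm_inner_le hδ hB hts hs.1.le (Or.inl (by norm_num))).trans ?_
      refine mul_le_mul_of_nonneg_left ?_ (by positivity)
      simpa using integral_rpow_neg_half_le (s := s) hts
    · rw [uIoc_of_le ht] at hs
      exact (kernelLimit_gauss.tendsto_inner hh hB (sub_nonneg.2 hs.2) hs.1.le
        (Or.inl (by norm_num))).const_mul _
  refine key.congr' ?_
  filter_upwards [self_mem_nhdsWithin] with δ hδ
  exact (weight_duh_mul_duh (integrable_gauss hδ) hf hh hC hB ht).symm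

/-- Dominated convergence at each of the three levels. For `s < t` the lag is at least `t - s > 0`,
so the two inner integrals are regular; the innermost integration bounds them by a multiple of `(t -
s)^{-1/2}`, which is integrable in the outer variable. -/
theorem hasSmoothLimit_sq_mul_duh_mul_mid (hf : Continuous f) (hg : Continuous g)
    (hh : Continuous h) (hC : ∀ a, ‖f a‖ ≤ C) (hA : ∀ a, ‖g a‖ ≤ A) (hB : ∀ a, ‖h a‖ ≤ B)
    (ht : 0 ≤ t) :
    HasSmoothLimit (fun k => (k : ℂ) ^ 2 * duh k (fun s => f s * mid k g h s) t)
      (∫ s in (0 : ℝ)..t, f s * ∫ a in (0 : ℝ)..s, conj (g a) * ∫ r in (0 : ℝ)..a,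
        h r * (-I * c / ((((t - s) + (a - r)) ^ (3 / 2 : ℝ) : ℝ) : ℂ))) := by
  have hC0 : 0 ≤ C := (norm_nonneg _).trans (hC 0)
  have hB0 : 0 ≤ B := (norm_nonneg _).trans (hB 0)
  have hA0 : 0 ≤ A := (norm_nonneg _).trans (hA 0)
  have cF : Continuous (Function.uncurry fun k s => f s * mid k g h s) :=
    (hf.comp continuous_snd).mul (continuous_mid hg hh)
  have cD := continuous_duh_left (g := fun k s => f s * mid k g h s) cF t
  have bD : ∀ k, ‖duh k (fun s => f s * mid k g h s) t‖ ≤ C * (A * (B * t) * t) * t := fun k =>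
    norm_duh_le (h := fun k s => f s * mid k g h s) ht k fun a ha => by
      rw [norm_mul]
      exact mul_le_mul (hC a) (norm_mid_le hA hB ha k) (norm_nonneg _) hC0
  -- The unbounded factor `k²` is moved into the weight, leaving a function of `k` that is uniformly
  -- bounded.
  have e : ∀ (δ k : ℝ), gauss δ k * ((k : ℂ) ^ 2 * duh k (fun s => f s * mid k g h s) t)
      = sqGauss δ k * duh k (fun s => f s * mid k g h s) t := fun δ k => by
    rw [sqGauss]; ring
  refine ⟨fun δ hδ => ?_, ?_⟩
  · simp_rw [e]
    exact (integrable_sqGauss hδ).mul_bdd (c := C * (A * (B * t) * t) * t)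
      cD.aestronglyMeasurable (ae_of_all _ bD)
  have middle : ∀ s ∈ Ioo 0 t, ∀ δ > 0, ∀ a ∈ Icc 0 s, ‖conj (g a) * ∫ r in (0 : ℝ)..a,
      h r * propKernel (sqGauss δ) ((t - s) + (a - r))‖
        ≤ A * (B * √Real.pi * (2 * (t - s) ^ (-(1 / 2) : ℝ))) := by
    intro s hs δ hδ a ha
    have hts : 0 < t - s := sub_pos.2 hs.2
    rw [norm_mul, RCLike.norm_conj]
    refine mul_le_mul (hA a) ?_ (norm_nonneg _) hA0
    refine (kernelLimit_sqGauss.norm_inner_le hδ hB hts.le ha.1 (Or.inr hts)).trans ?_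
    exact mul_le_mul_of_nonneg_left (integral_rpow_neg_three_halves_le hts ha.1) (by positivity)
  have cin : ∀ δ > 0, Continuous fun z : ℝ × ℝ => conj (g z.2) *
      ∫ r in (0 : ℝ)..z.2, h r * propKernel (sqGauss δ) ((t - z.1) + (z.2 - r)) := fun δ hδ =>
    (continuous_conj_of (hg.comp continuous_snd)).mul
      ((kernelLimit_sqGauss.continuous_inner hδ hh).comp
        (by fun_prop : Continuous fun z : ℝ × ℝ => (t - z.1, z.2)))
  have aet : ∀ᵐ s : ℝ, s ≠ t := compl_mem_ae_iff.2 (measure_singleton t)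
  have key : Tendsto (fun δ => ∫ s in (0 : ℝ)..t, f s * ∫ a in (0 : ℝ)..s, conj (g a) *
      ∫ r in (0 : ℝ)..a, h r * propKernel (sqGauss δ) ((t - s) + (a - r))) (𝓝[>] 0)
      (𝓝 (∫ s in (0 : ℝ)..t, f s * ∫ a in (0 : ℝ)..s, conj (g a) * ∫ r in (0 : ℝ)..a,
        h r * (-I * c / ((((t - s) + (a - r)) ^ (3 / 2 : ℝ) : ℝ) : ℂ)))) := by
    refine intervalIntegral.tendsto_integral_filter_of_dominated_convergence
      (fun s => C * (A * (B * √Real.pi * 2) * t) * (0 + (t - s)) ^ (-(1 / 2) : ℝ)) ?_ ?_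
      ((intervalIntegrable_rpow_shift (Or.inl (by norm_num)) ht).const_mul _) ?_
    · filter_upwards [self_mem_nhdsWithin] with δ hδ
      have c1 : Continuous fun s => ∫ a in (0 : ℝ)..s, conj (g a) *
          ∫ r in (0 : ℝ)..a, h r * propKernel (sqGauss δ) ((t - s) + (a - r)) :=
        intervalIntegral.continuous_parametric_intervalIntegral_of_continuous
          (f := fun s a => conj (g a) *
            ∫ r in (0 : ℝ)..a, h r * propKernel (sqGauss δ) ((t - s) + (a - r)))
          (cin δ hδ) continuous_id
      exact (hf.mul c1).aestronglyMeasurable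
    · filter_upwards [self_mem_nhdsWithin] with δ hδ
      filter_upwards [aet] with s hst hs
      rw [uIoc_of_le ht] at hs
      have hs' : s ∈ Ioo 0 t := ⟨hs.1, lt_of_le_of_ne hs.2 hst⟩
      have hts : 0 < t - s := sub_pos.2 hs'.2
      have hb := intervalIntegral.norm_integral_le_of_norm_le_const (a := 0) (b := s)
        fun a ha => middle s hs' δ hδ a (by
          rw [uIoc_of_le hs.1.le] at ha; exact ⟨ha.1.le, ha.2⟩)
      rw [sub_zero, abs_of_pos hs.1] at hb
      rw [norm_mul, zero_add]
      have hrp := Real.rpow_nonneg hts.le (-(1 / 2))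
      calc _ ≤ C * (A * (B * √Real.pi * (2 * (t - s) ^ (-(1 / 2) : ℝ))) * t) := by
            refine mul_le_mul (hC s) (hb.trans ?_) (norm_nonneg _) hC0
            exact mul_le_mul_of_nonneg_left hs.2 (by positivity)
        _ = _ := by ring
    · filter_upwards [aet] with s hst hs
      rw [uIoc_of_le ht] at hs
      have hs' : s ∈ Ioo 0 t := ⟨hs.1, lt_of_le_of_ne hs.2 hst⟩
      have hts : 0 < t - s := sub_pos.2 hs'.2
      refine Tendsto.const_mul _ ?_
      refine intervalIntegral.tendsto_integral_filter_of_dominated_convergence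
        (fun _ => A * (B * √Real.pi * (2 * (t - s) ^ (-(1 / 2) : ℝ)))) ?_ ?_ (by simp)
        (ae_of_all _ fun a ha => ?_)
      · filter_upwards [self_mem_nhdsWithin] with δ hδ
        exact ((cin δ hδ).comp (by fun_prop : Continuous fun a : ℝ => (s, a))).aestronglyMeasurable
      · filter_upwards [self_mem_nhdsWithin] with δ hδ
        refine ae_of_all _ fun a ha => middle s hs' δ hδ a ?_
        rw [uIoc_of_le hs.1.le] at ha; exact ⟨ha.1.le, ha.2⟩
      · rw [uIoc_of_le hs.1.le] at ha
        exact (kernelLimit_sqGauss.tendsto_inner hh hB hts.le ha.1.le (Or.inr hts)).const_mul _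
  refine key.congr' ?_
  filter_upwards [self_mem_nhdsWithin] with δ hδ
  simp only [smooth, e]
  exact (weight_duh_mul_mid (integrable_sqGauss hδ) hf hg hh hC hA hB ht).symm

end Limits

/-! ### Limit of the boundary term and the formula for the Neumann trace. -/

/-- The Abel integral `∫₀ᵗ h(r) / √(t - r) dr`. -/
def abel (h : ℝ → ℂ) (t : ℝ) : ℂ := ∫ r in (0 : ℝ)..t, h r / (√(t - r) : ℝ)

/-- The iterated Abel integral `∫₀ᵗ f(s) ∫₀ˢ h(r) / √(t - r) dr ds`. -/
def abel₂ (f h : ℝ → ℂ) (t : ℝ) : ℂ :=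
  ∫ s in (0 : ℝ)..t, f s * ∫ r in (0 : ℝ)..s, h r / (√(t - r) : ℝ)

theorem abel_eq (h : ℝ → ℂ) (t : ℝ) :
    ∫ r in (0 : ℝ)..t, h r * (2 * c / ((√(t - r) : ℝ) : ℂ)) = 2 * c * abel h t := by
  rw [abel, ← intervalIntegral.integral_const_mul]
  congr 1; funext r; ring

theorem abel₂_eq (f h : ℝ → ℂ) (t : ℝ) :
    ∫ s in (0 : ℝ)..t, f s * ∫ r in (0 : ℝ)..s, h r * (2 * c / ((√((t - s) + (s - r)) : ℝ) : ℂ))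
      = 2 * c * abel₂ f h t := by
  rw [abel₂, ← intervalIntegral.integral_const_mul]
  congr 1; funext s
  rw [mul_left_comm (2 * c), ← intervalIntegral.integral_const_mul (2 * c)]
  congr 1
  congr 1; funext r
  rw [sub_add_sub_cancel]; ring

theorem nested_eq (f g h : ℝ → ℂ) (t : ℝ) :
    ∫ s in (0 : ℝ)..t, f s * ∫ a in (0 : ℝ)..s, conj (g a) * ∫ r in (0 : ℝ)..a,
        h r * (-I * c / ((((t - s) + (a - r)) ^ (3 / 2 : ℝ) : ℝ) : ℂ))
      = -I * c * nested f g h t := by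
  rw [nested, ← intervalIntegral.integral_const_mul]
  congr 1; funext s
  rw [mul_left_comm (-I * c), ← intervalIntegral.integral_const_mul (-I * c)]
  congr 1
  congr 1; funext a
  rw [mul_left_comm (-I * c), ← intervalIntegral.integral_const_mul (-I * c)]
  congr 1
  congr 1; funext r
  rw [add_sub_assoc]; ring

theorem abel_congr {h h' : ℝ → ℂ} {t : ℝ} (ht : 0 ≤ t) (hh : EqOn h h' (Icc 0 t)) :
    abel h t = abel h' t := by
  refine intervalIntegral.integral_congr fun r hr => ?_
  rw [uIcc_of_le ht] at hr
  simp only [hh hr]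

theorem abel₂_congr {f f' h h' : ℝ → ℂ} {t : ℝ} (ht : 0 ≤ t) (hf : EqOn f f' (Icc 0 t))
    (hh : EqOn h h' (Icc 0 t)) : abel₂ f h t = abel₂ f' h' t := by
  refine intervalIntegral.integral_congr fun s hs => ?_
  rw [uIcc_of_le ht] at hs
  simp only [hf hs]
  congr 1
  refine intervalIntegral.integral_congr fun r hr => ?_
  rw [uIcc_of_le hs.1] at hr
  simp only [hh ⟨hr.1, hr.2.trans hs.2⟩]

theorem nested_congr {f f' g g' h h' : ℝ → ℂ} {t : ℝ} (ht : 0 ≤ t) (hf : EqOn f f' (Icc 0 t))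
    (hg : EqOn g g' (Icc 0 t)) (hh : EqOn h h' (Icc 0 t)) :
    nested f g h t = nested f' g' h' t := by
  refine intervalIntegral.integral_congr fun s hs => ?_
  rw [uIcc_of_le ht] at hs
  simp only [hf hs]
  congr 1
  refine intervalIntegral.integral_congr fun a ha => ?_
  rw [uIcc_of_le hs.1] at ha
  simp only [hg ⟨ha.1, ha.2.trans hs.2⟩]
  congr 1
  refine intervalIntegral.integral_congr fun r hr => ?_
  rw [uIcc_of_le ha.1] at hr
  simp only [hh ⟨hr.1, hr.2.trans (ha.2.trans hs.2)⟩]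

theorem evenTrace_eq_mid {g₀ g₁ dg₀ : ℝ → ℂ} (hg₀ : Continuous g₀) (hg₁ : Continuous g₁)
    (hdg₀ : Continuous dg₀) (k s : ℝ) :
    evenTrace g₀ g₁ dg₀ k s = mid k g₁ g₁ s + I * mid k g₀ dg₀ s := by
  have := continuous_duh_right hg₁ k
  have := continuous_duh_right hdg₀ k
  have := continuous_conj_of hg₀
  have := continuous_conj_of hg₁
  rw [evenTrace, mid, mid, ← intervalIntegral.integral_const_mul,
    ← intervalIntegral.integral_add (Continuous.intervalIntegrable (by fun_prop) _ _)
      (Continuous.intervalIntegrable (by fun_prop) _ _)]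

theorem oddTrace_eq_mid {g₀ g₁ : ℝ → ℂ} (hg₀ : Continuous g₀) (hg₁ : Continuous g₁) (k s : ℝ) :
    oddTrace g₀ g₁ k s = I * mid k g₀ g₁ s - I * mid k g₁ g₀ s := by
  have := continuous_duh_right hg₁ k
  have := continuous_duh_right hg₀ k
  have := continuous_conj_of hg₀
  have := continuous_conj_of hg₁
  rw [oddTrace, mid, mid, ← intervalIntegral.integral_const_mul,
    ← intervalIntegral.integral_const_mul,
    ← intervalIntegral.integral_sub (Continuous.intervalIntegrable (by fun_prop) _ _)
      (Continuous.intervalIntegrable (by fun_prop) _ _)]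

/-- Expansion into seven elementary Duhamel expressions, one for each Abel or nested integral of the
final formula, so that limits can be taken term by term. -/
theorem boundaryTerm_eq {g₀ g₁ dg₀ : ℝ → ℂ} (hg₀ : Continuous g₀) (hg₁ : Continuous g₁)
    (hdg₀ : Continuous dg₀) (lam : ℂ) (dG₀ : ℝ → ℂ) (t k : ℝ) :
    boundaryTerm lam g₀ g₁ dg₀ dG₀ t k = -I * duh k dG₀ t
      + lam * ((k ^ 2 * duh k (fun s => g₁ s * mid k g₀ g₁ s) t
          + (-1) * (k ^ 2 * duh k (fun s => g₁ s * mid k g₁ g₀ s) t))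
        + ((-1) * (k ^ 2 * duh k (fun s => g₀ s * mid k g₁ g₁ s) t)
          + (-I) * (k ^ 2 * duh k (fun s => g₀ s * mid k g₀ dg₀ s) t)))
      + lam * (duh k (fun s => conj (g₀ s) * g₀ s * g₀ s) t
        + (-1) * duh k (fun s => conj (g₀ s) * g₀ s * duh k dg₀ s) t) := by
  have cm : ∀ {g h : ℝ → ℂ}, Continuous g → Continuous h → Continuous fun s => mid k g h s :=
    fun hg hh => (continuous_mid hg hh).uncurry_left k
  have m1 := cm hg₀ hg₁
  have m2 := cm hg₁ hg₀
  have m3 := cm hg₁ hg₁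
  have m4 := cm hg₀ hdg₀
  have d1 := continuous_duh_right hdg₀ k
  have cc := continuous_conj_of hg₀
  have e1 : ∀ s, -I * (g₁ s * oddTrace g₀ g₁ k s) - g₀ s * evenTrace g₀ g₁ dg₀ k s
      = 1 * (1 * (g₁ s * mid k g₀ g₁ s) + (-1) * (g₁ s * mid k g₁ g₀ s))
        + 1 * ((-1) * (g₀ s * mid k g₁ g₁ s) + (-I) * (g₀ s * mid k g₀ dg₀ s)) := fun s => by
    rw [evenTrace_eq_mid hg₀ hg₁ hdg₀, oddTrace_eq_mid hg₀ hg₁]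
    linear_combination (-g₁ s * mid k g₀ g₁ s + g₁ s * mid k g₁ g₀ s) * Complex.I_sq
  have e2 : ∀ s, conj (g₀ s) * g₀ s * (g₀ s - duh k dg₀ s)
      = 1 * (conj (g₀ s) * g₀ s * g₀ s) + (-1) * (conj (g₀ s) * g₀ s * duh k dg₀ s) :=
    fun s => by ring
  rw [boundaryTerm]
  simp_rw [e1, e2]
  rw [duh_lin₂ (by fun_prop) (by fun_prop), duh_lin₂ (by fun_prop) (by fun_prop),
    duh_lin₂ (by fun_prop) (by fun_prop), duh_lin₂ (by fun_prop) (by fun_prop)]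
  ring

theorem hasSmoothLimit_boundaryTerm {g₀ g₁ dg₀ dG₀ : ℝ → ℂ} {B t : ℝ} (hg₀ : Continuous g₀)
    (hg₁ : Continuous g₁) (hdg₀ : Continuous dg₀) (hdG₀ : Continuous dG₀)
    (b₀ : ∀ a, ‖g₀ a‖ ≤ B) (b₁ : ∀ a, ‖g₁ a‖ ≤ B) (bd : ∀ a, ‖dg₀ a‖ ≤ B)
    (bD : ∀ a, ‖dG₀ a‖ ≤ B) (ht : 0 ≤ t) (lam : ℂ) :
    HasSmoothLimit (boundaryTerm lam g₀ g₁ dg₀ dG₀ t) (-I * (2 * c * abel dG₀ t)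
      + lam * ((-I * c * nested g₁ g₀ g₁ t + (-1) * (-I * c * nested g₁ g₁ g₀ t))
        + ((-1) * (-I * c * nested g₀ g₁ g₁ t) + (-I) * (-I * c * nested g₀ g₀ dg₀ t)))
      + lam * (2 * c * abel (fun s => conj (g₀ s) * g₀ s * g₀ s) t
        + (-1) * (2 * c * abel₂ (fun s => conj (g₀ s) * g₀ s) dg₀ t))) := by
  have cc := continuous_conj_of hg₀
  have hB : 0 ≤ B := (norm_nonneg _).trans (b₀ 0)
  have bb : ∀ a, ‖conj (g₀ a) * g₀ a‖ ≤ B * B := fun a => by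
    rw [norm_mul, RCLike.norm_conj]
    exact mul_le_mul (b₀ a) (b₀ a) (norm_nonneg _) hB
  have bbb : ∀ a, ‖conj (g₀ a) * g₀ a * g₀ a‖ ≤ B * B * B := fun a => by
    rw [norm_mul]
    exact mul_le_mul (bb a) (b₀ a) (norm_nonneg _) (by positivity)
  rw [funext (boundaryTerm_eq hg₀ hg₁ hdg₀ lam dG₀ t)]
  simp_rw [← abel_eq, ← abel₂_eq, ← nested_eq]
  have N := fun {f g h : ℝ → ℂ} (hf : Continuous f) (hg : Continuous g) (hh : Continuous h)
    (bf : ∀ a, ‖f a‖ ≤ B) (bg : ∀ a, ‖g a‖ ≤ B) (bh : ∀ a, ‖h a‖ ≤ B) =>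
    hasSmoothLimit_sq_mul_duh_mul_mid hf hg hh bf bg bh ht
  exact (((hasSmoothLimit_duh hdG₀ bD ht).const_mul _).add
    ((((N hg₁ hg₀ hg₁ b₁ b₀ b₁).add ((N hg₁ hg₁ hg₀ b₁ b₁ b₀).const_mul _)).add
      (((N hg₀ hg₁ hg₁ b₀ b₁ b₁).const_mul _).add
        ((N hg₀ hg₀ hdg₀ b₀ b₀ bd).const_mul _))).const_mul _)).add
    (((hasSmoothLimit_duh (by fun_prop) bbb ht).add
      ((hasSmoothLimit_duh_mul_duh (by fun_prop) hdg₀ bb bd ht).const_mul _)).const_mul _)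

/-- The Neumann trace of a forced wave, with cubic forcing by a free wave, in terms of the boundary
traces. -/
theorem DecayingWave.neumann_trace {t B : ℝ} {u u₁ u₂ z z₁ z₂ : ℝ → ℝ → ℂ} {lam : ℂ}
    {dg₀ dG₀ : ℝ → ℂ} (ht : 0 ≤ t) (hu : DecayingWave t u u₁ u₂ fun _ _ => 0)
    (hz : DecayingWave t z z₁ z₂ fun x s => 2 * lam * (conj (u x s) * u x s * u x s))
    (hdg₀ : Continuous dg₀) (hdG₀ : Continuous dG₀)
    (hd : ∀ s ∈ Ioo 0 t, HasDerivAt (u 0) (dg₀ s) s)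
    (hD : ∀ s ∈ Ioo 0 t, HasDerivAt (z 0) (dG₀ s) s)
    (bd : ∀ a, ‖dg₀ a‖ ≤ B) (bD : ∀ a, ‖dG₀ a‖ ≤ B) :
    z₁ 0 t = 2 * lam * c / (Real.pi * I) * abel (fun s => conj (u 0 s) * u 0 s * u 0 s) t
      - 2 * lam * c / (Real.pi * I) * abel₂ (fun s => conj (u 0 s) * u 0 s) dg₀ t
      - 2 * c / Real.pi * abel dG₀ t
      - lam * c / (Real.pi * I) * nested (u 0) (u 0) dg₀ t
      + lam * c / Real.pi * nested (u 0) (u₁ 0) (u₁ 0) t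
      - lam * c / Real.pi * nested (u₁ 0) (u 0) (u₁ 0) t
      + lam * c / Real.pi * nested (u₁ 0) (u₁ 0) (u 0) t
      + I * lam * u 0 t * ∫ s in (0 : ℝ)..t, (conj (u 0 s) * u₁ 0 s - conj (u₁ 0 s) * u 0 s) := by
  obtain ⟨C, hb, hb₁, -⟩ := hu.decay
  have b₀ : ∀ a, ‖u 0 a‖ ≤ max B C := fun a => (bound_of_decay (hb 0 a)).trans (le_max_right _ _)
  have b₁ : ∀ a, ‖u₁ 0 a‖ ≤ max B C := fun a => (bound_of_decay (hb₁ 0 a)).trans (le_max_right _ _)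
  have hi := hu.hasSmoothLimit_interiorTerm ht hz lam
  have hbd := hasSmoothLimit_boundaryTerm hu.continuous_trace hu.continuous_trace₁ hdg₀ hdG₀ b₀ b₁
    (fun a => (bd a).trans (le_max_left _ _)) (fun a => (bD a).trans (le_max_left _ _)) ht lam
  -- The Gaussian weight is even, so reflection in `k` preserves the limit, and the symmetrized
  -- interior term tends to twice the limit at `k`.
  have hsym := hi.add hi.comp_neg
  simp_rw [hu.interiorTerm_add_neg ht hz hdg₀ hdG₀ hd hD] at hsym
  have key := hsym.unique (hbd.const_mul 2)
  have ei : ∫ a in (0 : ℝ)..t,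
      I * (conj (u₁ 0 a) * (Real.pi * u 0 a) - conj (u 0 a) * (Real.pi * u₁ 0 a))
      = -(I * Real.pi) * ∫ s in (0 : ℝ)..t, (conj (u 0 s) * u₁ 0 s - conj (u₁ 0 s) * u 0 s) := by
    rw [← intervalIntegral.integral_const_mul]
    congr 1; funext s; ring
  rw [ei] at key
  have hpi : (Real.pi : ℂ) ≠ 0 := by exact_mod_cast Real.pi_ne_zero
  have hI := Complex.I_ne_zero
  have hinv : (I : ℂ)⁻¹ = -I := Complex.inv_I
  simp only [div_eq_mul_inv, mul_inv, hinv]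
  -- In `key` the unknown `z₁ 0 t` carries the factor `2iπ`: `iπ` from endpoint inversion, doubled
  -- by symmetrization.
  refine mul_left_cancel₀ (mul_ne_zero two_ne_zero (mul_ne_zero hI hpi)) ?_
  have hp : (Real.pi : ℂ) * (Real.pi : ℂ)⁻¹ = 1 := mul_inv_cancel₀ hpi
  generalize (Real.pi : ℂ)⁻¹ = p at hp ⊢
  set a₁ := abel (fun s => conj (u 0 s) * u 0 s * u 0 s) t
  set a₂ := abel₂ (fun s => conj (u 0 s) * u 0 s) dg₀ t
  linear_combination key - 2 * I * (2 * lam * c * (-I) * a₁ - 2 * lam * c * (-I) * a₂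
    - 2 * c * abel dG₀ t + lam * c * I * nested (u 0) (u 0) dg₀ t
    + lam * c * nested (u 0) (u₁ 0) (u₁ 0) t - lam * c * nested (u₁ 0) (u 0) (u₁ 0) t
    + lam * c * nested (u₁ 0) (u₁ 0) (u 0) t) * hp + 4 * c * lam * (a₁ - a₂) * Complex.I_sq

/-! ### Extension of classical coefficients and data from the quarter plane. -/

/-- Truncation of the time variable to `[0, t]`. -/
def clamp (t s : ℝ) : ℝ := max 0 (min t s)

theorem clamp_mem {t : ℝ} (ht : 0 ≤ t) (s : ℝ) : clamp t s ∈ Icc 0 t :=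
  ⟨le_max_left _ _, max_le ht (min_le_left _ _)⟩

theorem clamp_of_mem {t s : ℝ} (hs : s ∈ Icc 0 t) : clamp t s = s := by
  rw [clamp, min_eq_right hs.2, max_eq_right hs.1]

@[fun_prop]
theorem continuous_clamp (t : ℝ) : Continuous (clamp t) := by unfold clamp; fun_prop

/-- Extension of a function on the quarter plane to the plane: even in space, clamped in time. -/
def extend (t : ℝ) (u : ℝ → ℝ → ℂ) (x s : ℝ) : ℂ := u |x| (clamp t s)

theorem extend_of_mem {t x s : ℝ} (u : ℝ → ℝ → ℂ) (hx : 0 ≤ x) (hs : s ∈ Icc 0 t) :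
    extend t u x s = u x s := by
  rw [extend, abs_of_nonneg hx, clamp_of_mem hs]

theorem continuous_extend {T t : ℝ} {u : ℝ → ℝ → ℂ} (ht : t ∈ Ico 0 T)
    (hu : ContinuousOn (fun p : ℝ × ℝ => u p.1 p.2) (Ici 0 ×ˢ Ico 0 T)) :
    Continuous (Function.uncurry (extend t u)) :=
  hu.comp_continuous (f := fun p : ℝ × ℝ => (|p.1|, clamp t p.2)) (by fun_prop) fun p =>
    ⟨mem_Ici.2 (abs_nonneg p.1), (clamp_mem ht.1 _).1, (clamp_mem ht.1 _).2.trans_lt ht.2⟩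

theorem hasDerivAt_extend_space {T t : ℝ} {u : ℝ → ℝ → ℂ} (ht : t ∈ Ico 0 T)
    (hu : ∀ x ∈ Ici (0 : ℝ), ∀ t ∈ Ico 0 T, DifferentiableWithinAt ℝ (fun y => u y t) (Ici 0) x)
    {x : ℝ} (hx : 0 < x) (s : ℝ) :
    HasDerivAt (fun y => extend t u y s) (extend t (dx u) x s) x := by
  have hc : clamp t s ∈ Ico 0 T :=
    ⟨(clamp_mem ht.1 s).1, (clamp_mem ht.1 s).2.trans_lt ht.2⟩
  have h := ((hu x hx.le _ hc).hasDerivWithinAt).hasDerivAt (Ici_mem_nhds hx)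
  have e : extend t (dx u) x s = derivWithin (fun y => u y (clamp t s)) (Ici 0) x := by
    rw [extend, abs_of_pos hx, dx]
  rw [e]
  refine h.congr_of_eventuallyEq ?_
  filter_upwards [Ioi_mem_nhds hx] with y hy
  rw [extend, abs_of_pos hy]

theorem hasDerivAt_extend_time {T t : ℝ} {u : ℝ → ℝ → ℂ} (ht : t ∈ Ico 0 T)
    {x s : ℝ} (hx : 0 < x) (hs : s ∈ Ioo 0 t)
    (hu : DifferentiableWithinAt ℝ (fun s => u x s) (Ico 0 T) s) :
    HasDerivAt (fun r => extend t u x r) (dt T u x s) s := by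
  have h := hu.hasDerivWithinAt.hasDerivAt (Ico_mem_nhds hs.1 (hs.2.trans ht.2))
  refine h.congr_of_eventuallyEq ?_
  filter_upwards [Ioo_mem_nhds hs.1 hs.2] with r hr
  rw [extend, abs_of_pos hx, clamp_of_mem ⟨hr.1.le, hr.2.le⟩]

theorem decay_of_weighted {a : ℂ} {C x : ℝ} (hx : 0 ≤ x) (h : (1 + x) ^ 2 * ‖a‖ ≤ C) :
    ‖a‖ ≤ C * (1 + x ^ 2)⁻¹ := by
  rw [← div_eq_mul_inv, le_div_iff₀ (by positivity), mul_comm]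
  refine le_trans (mul_le_mul_of_nonneg_right ?_ (norm_nonneg a)) h
  nlinarith

theorem decay_mono {a : ℂ} {C D y : ℝ} (h : ‖a‖ ≤ C * (1 + y ^ 2)⁻¹) (hCD : C ≤ D) :
    ‖a‖ ≤ D * (1 + y ^ 2)⁻¹ :=
  h.trans (mul_le_mul_of_nonneg_right hCD (by positivity))

/-- The extension of a classical solution is a decaying wave. -/
theorem decayingWave_extend {T t : ℝ} {u F : ℝ → ℝ → ℂ} (ht : t ∈ Ico 0 T) (hc : IsClassical T u)
    (hv : VanishesAtInfinity T u) (hF : Continuous (Function.uncurry F))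
    (hFd : ∃ C, ∀ x s, ‖F x s‖ ≤ C * (1 + x ^ 2)⁻¹)
    (heq : ∀ x ∈ Ioi (0 : ℝ), ∀ s ∈ Ioo 0 t, I * dt T u x s + dx (dx u) x s = F x s)
    (hini : ∀ x ∈ Ici (0 : ℝ), u x 0 = 0) :
    DecayingWave t (extend t u) (extend t (dx u)) (extend t (dx (dx u))) F where
  cont := continuous_extend ht hc.cont
  cont₁ := continuous_extend ht hc.cont_x
  cont₂ := continuous_extend ht hc.cont_xx
  contF := hF
  hasDeriv_x x hx s := hasDerivAt_extend_space ht hc.diff_x hx s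
  hasDeriv_xx x hx s := hasDerivAt_extend_space ht hc.diff_xx hx s
  hasDeriv_t x hx s hs := by
    have hsT : s ∈ Ico 0 T := ⟨hs.1.le, hs.2.trans ht.2⟩
    refine (hasDerivAt_extend_time ht hx hs (hc.diff_t x hx.le s hsT)).congr_deriv ?_
    rw [extend_of_mem _ hx.le ⟨hs.1.le, hs.2.le⟩, ← heq x hx s hs]
    linear_combination dt T u x s * Complex.I_sq
  initial x := by
    have : clamp t 0 = 0 := clamp_of_mem ⟨le_rfl, ht.1⟩
    rw [extend, this]; exact hini _ (abs_nonneg x)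
  decay := by
    obtain ⟨C, hC⟩ := hv t ht
    obtain ⟨C', hC'⟩ := hFd
    have h1 := fun x s => hC |x| (abs_nonneg x) (clamp t s) (clamp_mem ht.1 s)
    have hx : ∀ x : ℝ, |x| ^ 2 = x ^ 2 := sq_abs
    have k : ∀ {a : ℂ} {x : ℝ}, (1 + |x|) ^ 2 * ‖a‖ ≤ C → ‖a‖ ≤ max C C' * (1 + x ^ 2)⁻¹ :=
      fun {a x} h => decay_mono (hx x ▸ decay_of_weighted (abs_nonneg x) h) (le_max_left _ _)
    exact ⟨max C C', fun x s => k (h1 x s).1, fun x s => k (h1 x s).2.1,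
      fun x s => k (h1 x s).2.2, fun x s => decay_mono (hC' x s) (le_max_right _ _)⟩

/-- The time derivative of a flat datum, clamped to `[0, t]`. -/
def clampDeriv (T t : ℝ) (g : ℝ → ℂ) (s : ℝ) : ℂ := derivWithin g (Ico 0 T) (clamp t s)

theorem continuousOn_derivWithin_of_flat {T : ℝ} {g : ℝ → ℂ} (hg : IsFlatDatum T g) :
    ContinuousOn (derivWithin g (Ico 0 T)) (Ico 0 T) :=
  hg.1.continuousOn_derivWithin (uniqueDiffOn_Ico 0 T) (by simp)

theorem continuous_clampDeriv {T t : ℝ} (ht : t ∈ Ico 0 T) {g : ℝ → ℂ}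
    (hg : IsFlatDatum T g) : Continuous (clampDeriv T t g) :=
  (continuousOn_derivWithin_of_flat hg).comp_continuous (continuous_clamp t) fun s =>
    ⟨(clamp_mem ht.1 s).1, (clamp_mem ht.1 s).2.trans_lt ht.2⟩

theorem exists_bound_clampDeriv {T t : ℝ} (ht : t ∈ Ico 0 T) {g : ℝ → ℂ}
    (hg : IsFlatDatum T g) : ∃ B, ∀ s, ‖clampDeriv T t g s‖ ≤ B := by
  obtain ⟨B, hB⟩ := isCompact_Icc.exists_bound_of_continuousOn
    ((continuousOn_derivWithin_of_flat hg).mono (Icc_subset_Ico_right ht.2))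
  exact ⟨B, fun s => hB _ (clamp_mem ht.1 s)⟩

theorem eqOn_clampDeriv (T t : ℝ) (g : ℝ → ℂ) :
    EqOn (clampDeriv T t g) (derivWithin g (Ico 0 T)) (Icc 0 t) := fun s hs => by
  rw [clampDeriv, clamp_of_mem hs]

theorem hasDerivAt_clampDeriv {T t : ℝ} (ht : t ∈ Ico 0 T) {g : ℝ → ℂ} (hg : IsFlatDatum T g)
    {u : ℝ → ℝ → ℂ} (hug : ∀ s ∈ Ico 0 T, u 0 s = g s) :
    ∀ s ∈ Ioo 0 t, HasDerivAt (extend t u 0) (clampDeriv T t g s) s := by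
  intro s hs
  have hsT : s ∈ Ico 0 T := ⟨hs.1.le, hs.2.trans ht.2⟩
  have hd := ((hg.1.differentiableOn (by simp)) s hsT).hasDerivWithinAt.hasDerivAt
    (Ico_mem_nhds hs.1 (hs.2.trans ht.2))
  rw [clampDeriv, clamp_of_mem ⟨hs.1.le, hs.2.le⟩]
  refine hd.congr_of_eventuallyEq ?_
  filter_upwards [Ioo_mem_nhds hs.1 hs.2] with r hr
  rw [extend_of_mem _ le_rfl ⟨hr.1.le, hr.2.le⟩, hug r ⟨hr.1.le, hr.2.trans ht.2⟩]

/-! ### The equations at orders one, two and three. -/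

namespace IsPerturbativeSolution

variable {lam T : ℝ} {g₀ : ℕ → ℝ → ℂ} {q : ℕ → ℝ → ℝ → ℂ}

/-- The initial condition covers only `x > 0`; at the corner `x = 0` the value comes from the
Dirichlet datum, which vanishes at time zero by flatness of order zero. -/
theorem initial_eq_zero (hq : IsPerturbativeSolution lam T g₀ q) (hT : 0 < T) {n : ℕ} (hn : 1 ≤ n)
    (hg : IsFlatDatum T (g₀ n)) : ∀ x ∈ Ici (0 : ℝ), q n x 0 = 0 := by
  intro x hx
  rcases eq_or_lt_of_le (mem_Ici.1 hx) with h | h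
  · rw [← h, hq.dirichlet n hn 0 ⟨le_rfl, hT⟩]
    simpa using hg.2 0
  · exact hq.initial n hn x h

theorem coeff_nls (hq : IsPerturbativeSolution lam T g₀ q) {x s : ℝ} (hx : x ∈ Ioi (0 : ℝ))
    (hs : s ∈ Ioo 0 T) (n : ℕ) :
    I * dt T (q n) x s + dx (dx (q n)) x s = 2 * lam * PowerSeries.coeff n
      (series (fun n => q n x s) * conjSeries (series (fun n => q n x s)) *
        series (fun n => q n x s)) := by
  have h := congrArg (PowerSeries.coeff n) (hq.nls x hx s hs)
  simp only [map_sub, map_add, PowerSeries.coeff_C_mul, PowerSeries.coeff_mk, map_zero] at h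
  linear_combination h

/-- Three indices summing to at most two include a zero, so each product in the cubic coefficient
has a factor from `q 0 = 0`. -/
theorem free_equation (hq : IsPerturbativeSolution lam T g₀ q) {n : ℕ} (hn : n ≤ 2) {x s : ℝ}
    (hx : x ∈ Ioi (0 : ℝ)) (hs : s ∈ Ioo 0 T) :
    I * dt T (q n) x s + dx (dx (q n)) x s = 0 := by
  rw [hq.coeff_nls hx hs]
  have h0 := hq.order_zero x (mem_Ioi.1 hx).le s ⟨hs.1.le, hs.2⟩
  interval_cases n <;>
    simp [PowerSeries.coeff_mul, Finset.Nat.antidiagonal_succ, h0]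

/-- Among index triples of sum three, only `(1, 1, 1)` avoids the vanishing coefficient `q 0`. -/
theorem cubic_equation (hq : IsPerturbativeSolution lam T g₀ q) {x s : ℝ}
    (hx : x ∈ Ioi (0 : ℝ)) (hs : s ∈ Ioo 0 T) :
    I * dt T (q 3) x s + dx (dx (q 3)) x s
      = 2 * lam * (conj (q 1 x s) * q 1 x s * q 1 x s) := by
  rw [hq.coeff_nls hx hs]
  have h0 := hq.order_zero x (mem_Ioi.1 hx).le s ⟨hs.1.le, hs.2⟩
  simp [PowerSeries.coeff_mul, Finset.Nat.antidiagonal_succ, h0, mul_comm (q 1 x s)]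

theorem decayingWave_free (hq : IsPerturbativeSolution lam T g₀ q) (hT : 0 < T) {n : ℕ}
    (hn : 1 ≤ n) (hn2 : n ≤ 2) (hg : IsFlatDatum T (g₀ n)) {t : ℝ} (ht : t ∈ Ico 0 T) :
    DecayingWave t (extend t (q n)) (extend t (dx (q n))) (extend t (dx (dx (q n))))
      fun _ _ => 0 :=
  decayingWave_extend ht (hq.classical n hn) (hq.decay n hn) continuous_const
    ⟨0, fun x s => by simp⟩
    (fun x hx s hs => hq.free_equation hn2 hx ⟨hs.1, hs.2.trans ht.2⟩)
    (hq.initial_eq_zero hT hn hg)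

theorem decayingWave_cubic (hq : IsPerturbativeSolution lam T g₀ q) (hT : 0 < T)
    (hg₁ : IsFlatDatum T (g₀ 1)) (hg₃ : IsFlatDatum T (g₀ 3)) {t : ℝ} (ht : t ∈ Ico 0 T) :
    DecayingWave t (extend t (q 3)) (extend t (dx (q 3))) (extend t (dx (dx (q 3))))
      fun x s => 2 * (lam : ℂ) *
        (conj (extend t (q 1) x s) * extend t (q 1) x s * extend t (q 1) x s) := by
  have h1 := hq.decayingWave_free hT le_rfl one_le_two hg₁ ht
  obtain ⟨C, hb, -⟩ := h1.decay
  have cb := continuous_conj_of h1.cont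
  refine decayingWave_extend ht (hq.classical 3 (by norm_num)) (hq.decay 3 (by norm_num))
    (continuous_const.mul ((cb.mul h1.cont).mul h1.cont))
    ⟨_, fun x s => decay_const_mul (decay_mul (decay_mul
      (by rw [RCLike.norm_conj]; exact hb x s) (bound_of_decay (hb x s)))
      (bound_of_decay (hb x s)))⟩
    (fun x hx s hs => ?_) (hq.initial_eq_zero hT (by norm_num) hg₃)
  rw [hq.cubic_equation hx ⟨hs.1, hs.2.trans ht.2⟩,
    extend_of_mem _ (mem_Ioi.1 hx).le ⟨hs.1.le, hs.2.le⟩]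

theorem neumann_free (hq : IsPerturbativeSolution lam T g₀ q) (hT : 0 < T) {n : ℕ}
    (hn : 1 ≤ n) (hn2 : n ≤ 2) (hg : IsFlatDatum T (g₀ n)) {t : ℝ} (ht : t ∈ Ico 0 T) :
    neumann q n t = -(2 * c / Real.pi) * abel (derivWithin (g₀ n) (Ico 0 T)) t := by
  have hu := hq.decayingWave_free hT hn hn2 hg ht
  obtain ⟨B, hB⟩ := exists_bound_clampDeriv ht hg
  have cd := continuous_clampDeriv ht hg
  have hd := hasDerivAt_clampDeriv ht hg (hq.dirichlet n hn)
  -- With `lam = 0` the forcing vanishes, so the same free wave can play both roles and only the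
  -- Abel integral of its own datum survives.
  have key := hu.neumann_trace (lam := 0) ht.1 (by simpa using hu) cd cd hd hd hB hB
  rw [extend_of_mem _ le_rfl (right_mem_Icc.2 ht.1)] at key
  rw [neumann, key, abel_congr ht.1 (eqOn_clampDeriv T t (g₀ n))]
  ring

end IsPerturbativeSolution

theorem two_mul_c_div_pi :
    2 * c / Real.pi = Complex.exp (-(Complex.I * Real.pi / 4)) / (√Real.pi : ℝ) := by
  have h1 : ((√Real.pi : ℝ) : ℂ) ≠ 0 := by exact_mod_cast (Real.sqrt_pos.2 Real.pi_pos).ne'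
  have h2 : (Real.pi : ℂ) = (√Real.pi : ℝ) * (√Real.pi : ℝ) := by
    rw [← Complex.ofReal_mul, Real.mul_self_sqrt Real.pi_pos.le]
  rw [c]
  generalize Complex.exp (-(Complex.I * Real.pi / 4)) = E
  rw [h2]
  push_cast
  field_simp

end HalfLineNLS

end

theorem mainTheorem3 (lam : ℝ) (hlam : lam = 1 ∨ lam = -1) (T : ℝ) (hT : 0 < T)
    (g₀ : ℕ → ℝ → ℂ) (hg₀ : ∀ n, 1 ≤ n → HalfLineNLS.IsFlatDatum T (g₀ n))
    (q : ℕ → ℝ → ℝ → ℂ) (hq : HalfLineNLS.IsPerturbativeSolution lam T g₀ q)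
    (g₁ : ℕ → ℝ → ℂ) (hg₁ : g₁ = HalfLineNLS.neumann q)
    (dg₀ : ℕ → ℝ → ℂ) (hdg₀ : dg₀ = fun n => derivWithin (g₀ n) (Set.Ico 0 T)) :
    ∀ t ∈ Set.Ico 0 T,
      g₁ 1 t = -(Complex.exp (-(Complex.I * Real.pi / 4)) / (√Real.pi : ℝ)) *
        (∫ t₁ in (0 : ℝ)..t, dg₀ 1 t₁ / (√(t - t₁) : ℝ)) ∧
      g₁ 2 t = -(Complex.exp (-(Complex.I * Real.pi / 4)) / (√Real.pi : ℝ)) *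
        (∫ t₁ in (0 : ℝ)..t, dg₀ 2 t₁ / (√(t - t₁) : ℝ)) ∧
      g₁ 3 t =
        (2 * lam * HalfLineNLS.c / (Real.pi * Complex.I)) *
            (∫ t₁ in (0 : ℝ)..t, (‖g₀ 1 t₁‖ : ℂ) ^ 2 * g₀ 1 t₁ / (√(t - t₁) : ℝ))
        - (2 * lam * HalfLineNLS.c / (Real.pi * Complex.I)) *
            (∫ t₁ in (0 : ℝ)..t, (‖g₀ 1 t₁‖ : ℂ) ^ 2 *
              ∫ t₂ in (0 : ℝ)..t₁, dg₀ 1 t₂ / (√(t - t₂) : ℝ))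
        - (2 * HalfLineNLS.c / Real.pi) *
            (∫ t₁ in (0 : ℝ)..t, dg₀ 3 t₁ / (√(t - t₁) : ℝ))
        - (lam * HalfLineNLS.c / (Real.pi * Complex.I)) *
            HalfLineNLS.nested (g₀ 1) (g₀ 1) (dg₀ 1) t
        + (lam * HalfLineNLS.c / Real.pi) * HalfLineNLS.nested (g₀ 1) (g₁ 1) (g₁ 1) t
        - (lam * HalfLineNLS.c / Real.pi) * HalfLineNLS.nested (g₁ 1) (g₀ 1) (g₁ 1) t
        + (lam * HalfLineNLS.c / Real.pi) * HalfLineNLS.nested (g₁ 1) (g₁ 1) (g₀ 1) t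
        + Complex.I * lam * g₀ 1 t *
            (∫ t₁ in (0 : ℝ)..t, ((starRingEnd ℂ) (g₀ 1 t₁) * g₁ 1 t₁
              - (starRingEnd ℂ) (g₁ 1 t₁) * g₀ 1 t₁)) := by
  intro t ht
  subst hg₁ hdg₀
  open HalfLineNLS in
  refine ⟨?_, ?_, ?_⟩
  · rw [← two_mul_c_div_pi]
    exact hq.neumann_free hT le_rfl one_le_two (hg₀ 1 le_rfl) ht
  · rw [← two_mul_c_div_pi]
    exact hq.neumann_free hT one_le_two le_rfl (hg₀ 2 one_le_two) ht
  · have h3 : (1 : ℕ) ≤ 3 := by norm_num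
    have hu := hq.decayingWave_free hT le_rfl one_le_two (hg₀ 1 le_rfl) ht
    have hz := hq.decayingWave_cubic hT (hg₀ 1 le_rfl) (hg₀ 3 h3) ht
    obtain ⟨B₁, hB₁⟩ := exists_bound_clampDeriv ht (hg₀ 1 le_rfl)
    obtain ⟨B₃, hB₃⟩ := exists_bound_clampDeriv ht (hg₀ 3 h3)
    have key := hu.neumann_trace ht.1 hz (continuous_clampDeriv ht (hg₀ 1 le_rfl))
      (continuous_clampDeriv ht (hg₀ 3 h3))
      (hasDerivAt_clampDeriv ht (hg₀ 1 le_rfl) (hq.dirichlet 1 le_rfl))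
      (hasDerivAt_clampDeriv ht (hg₀ 3 h3) (hq.dirichlet 3 h3))
      (fun a => (hB₁ a).trans (le_max_left B₁ B₃)) (fun a => (hB₃ a).trans (le_max_right B₁ B₃))
    -- Every integral in `key` samples its functions only on `[0, t]`, where the extended traces and
    -- clamped derivatives agree with the original data.
    have e0 : EqOn (extend t (q 1) 0) (g₀ 1) (Icc 0 t) := fun s hs => by
      rw [extend_of_mem _ le_rfl hs, hq.dirichlet 1 le_rfl s ⟨hs.1, hs.2.trans_lt ht.2⟩]
    have e1 : EqOn (extend t (dx (q 1)) 0) (neumann q 1) (Icc 0 t) := fun s hs => by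
      rw [extend_of_mem _ le_rfl hs, neumann]
    have ed := fun n => eqOn_clampDeriv T t (g₀ n)
    have nsq : ∀ a : ℂ, (starRingEnd ℂ) a * a = (‖a‖ : ℂ) ^ 2 := fun a => by
      rw [Complex.conj_mul']
    have esq : EqOn (fun s => (starRingEnd ℂ) (extend t (q 1) 0 s) * extend t (q 1) 0 s)
        (fun s => (‖g₀ 1 s‖ : ℂ) ^ 2) (Icc 0 t) := fun s hs => by
      simp only [e0 hs, nsq]
    have ecu : EqOn (fun s => (starRingEnd ℂ) (extend t (q 1) 0 s) * extend t (q 1) 0 s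
        * extend t (q 1) 0 s) (fun s => (‖g₀ 1 s‖ : ℂ) ^ 2 * g₀ 1 s) (Icc 0 t) := fun s hs => by
      simp only [e0 hs, nsq]
    have ei : ∫ s in (0 : ℝ)..t, ((starRingEnd ℂ) (extend t (q 1) 0 s) * extend t (dx (q 1)) 0 s
        - (starRingEnd ℂ) (extend t (dx (q 1)) 0 s) * extend t (q 1) 0 s)
        = ∫ s in (0 : ℝ)..t, ((starRingEnd ℂ) (g₀ 1 s) * neumann q 1 s
          - (starRingEnd ℂ) (neumann q 1 s) * g₀ 1 s) := by
      refine intervalIntegral.integral_congr fun s hs => ?_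
      rw [uIcc_of_le ht.1] at hs
      simp only [e0 hs, e1 hs]
    rw [extend_of_mem _ le_rfl (right_mem_Icc.2 ht.1), ei, e0 (right_mem_Icc.2 ht.1),
      abel_congr ht.1 ecu, abel₂_congr ht.1 esq (ed 1), abel_congr ht.1 (ed 3),
      nested_congr ht.1 e0 e0 (ed 1), nested_congr ht.1 e0 e1 e1, nested_congr ht.1 e1 e0 e1,
      nested_congr ht.1 e1 e1 e0] at key
    exact key
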